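/- **Setting.** Let $\mathbb X,\mathbb Y$ be locally compact second countable Hausdorff spaces with their Borel $\sigma$-algebras. Let $\mathbf N_{\mathbb X}$ be the space of $\sigma$-finite counting measures on $\mathbb X$ and $\widehat{\mathbf N}_{\mathbb Y}$ the space of finite counting measures on $\mathbb Y$, each with the $\sigma$-algebra generated by the maps $\omega\mapsto\omega(B)$, $B$ measurable. Counting measures are treated as multisets, and $\omega\cap A$ denotes restriction to $A$. For $\omega=\sum_{i\in I}\delta_{x_i}$, let $\omega^k_{\neq}$ be the family of tuples $(x_{i_1},\dots,x_{i_k})$ with pairwise distinct $i_1,\dots,i_k\in I$. For a tuple $\mathbf x=(x_1,\dots,x_m)$ put $\delta_{\mathbf x}=\sum_i\delta_{x_i}$, and write $\mathbf x\subset A$ if all $x_i\in A$. Let $\mathcal F$ be the set of closed subsets of $\mathbb X$ with the $\sigma$-algebra generated by the families $\{F: F\cap C\ne\emptyset\}$, $C$ compact. Let $k\ge1$. Let $g:\mathbb X^k\times\mathbf N_{\mathbb X}\to\{0,1\}$, $f:\mathbb X^k\times\mathbf N_{\mathbb X}\to\mathbb Y$, $\mathcal S:\mathbb X^k\times\mathbf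 N_{\mathbb X}\to\mathcal F$ and $\mathbf x\mapsto S_{\mathbf x}$, $\mathbb X^k\to\mathcal F$, be measurable and invariant under permutations of the coordinates of $\mathbf x$, with $\mathbf x\subset S_{\mathbf x}$ for all $\mathbf x$. Assume: * ($f,g$ are localized to $\mathcal S$) for all $\omega\in\mathbf N_{\mathbb X}$, $\mathbf x\in\omega^k_{\neq}$ and measurable $A\supset\mathcal S(\mathbf x,\omega)$: $g(\mathbf x,\omega)=g(\mathbf x,\omega\cap A)$, and if $g(\mathbf x,\omega)=1$ then also $f(\mathbf x,\omega)=f(\mathbf x,\omega\cap A)$; * ($\mathcal S$ is a stopping set) for all $\mathbf x\in\mathbb X^k$ and every closed $A\subset\mathbb X$ that is compact or equal to $S_{\mathbf x}$: $\{\omega:\mathcal S(\mathbf x,\omega)\subset A\}=\{\omega:\mathcal S(\mathbf x,\omega\cap A)\subset A\}$. Let $\eta$ be a Poisson process on $\mathbb X$ with $\sigma$-finite intensity measure $\mathbf K$ and put $$\xi=\frac1{k!}\sum_{\mathbf x\in\eta^k_{\neq}}g(\mathbf x,\eta)\,\delta_{f(\mathbf x,\eta)},\qquad \tilde g(\mathbf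 x,\omega)=g(\mathbf x,\omega)\mathbf 1\{\mathcal S(\mathbf x,\omega)\subset S_{\mathbf x}\},\qquad \xi_{\rm tr}=\frac1{k!}\sum_{\mathbf x\in\eta^k_{\neq}}\tilde g(\mathbf x,\eta)\,\delta_{f(\mathbf x,\eta)} .$$ Assume that the intensity measure $\mathbf L=\mathbb E\,\xi(\cdot)$ of $\xi$ satisfies $\mathbf L(\mathbb Y)<\infty$, and let $\zeta$ be a Poisson process on $\mathbb Y$ with finite intensity measure $\mathbf M$. For measures $\mu,\nu$ let $d_{TV}(\mu,\nu)=\sup\{|\mu(A)-\nu(A)|: A\text{ measurable},\ \mu(A),\nu(A)<\infty\}$. For almost surely finite point processes, let $\mathbf{d_{KR}}(\xi,\zeta)=\sup_h|\mathbb E h(\xi)-\mathbb E h(\zeta)|$, where $h$ runs over the measurable $h:\widehat{\mathbf N}_{\mathbb Y}\to\mathbb R$ with $|h(\omega_1)-h(\omega_2)|\le d_{TV}(\omega_1,\omega_2)$ for all $\omega_1,\omega_2$. **Theorem.** $\xi$ and $\zeta$ are almost surely finite point processes, and $$\begin{aligned}\mathbf{d_{KR}}(\xi,\zeta)&\le d_{TV}(\mathbf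 L,\mathbf M)+2\big(\operatorname{Var}\xi_{\rm tr}(\mathbb Y)-\mathbb E\,\xi_{\rm tr}(\mathbb Y)\big)+E_1+2E_2\\&=d_{TV}(\mathbf L,\mathbf M)+E_1+E_2+E_3+E_4,\end{aligned}$$ where the inequality and the equality are in $[0,\infty]$ (the variance, $E_3$ and $E_4$ may be infinite), and $$\begin{aligned} E_1&=\frac2{k!}\int_{\mathbb X^k}\mathbb E\big[g(\mathbf x,\eta+\delta_{\mathbf x})\mathbf 1\{\mathcal S(\mathbf x,\eta+\delta_{\mathbf x})\not\subset S_{\mathbf x}\}\big]\mathbf K^k(d\mathbf x),\\ E_2&=\frac2{(k!)^2}\int_{\mathbb X^k}\int_{\mathbb X^k}\mathbf 1\{S_{\mathbf x}\cap S_{\mathbf z}\ne\emptyset\}\,\mathbb E[\tilde g(\mathbf x,\eta+\delta_{\mathbf x})]\,\mathbb E[\tilde g(\mathbf z,\eta+\delta_{\mathbf z})]\,\mathbf K^k(d\mathbf z)\mathbf K^k(d\mathbf x),\\ E_3&=\frac2{(k!)^2}\int_{\mathbb X^k}\int_{\mathbb X^k}\mathbf 1\{S_{\mathbf x}\cap S_{\mathbf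 z}\ne\emptyset\}\,\mathbb E[\tilde g(\mathbf x,\eta+\delta_{\mathbf x}+\delta_{\mathbf z})\,\tilde g(\mathbf z,\eta+\delta_{\mathbf x}+\delta_{\mathbf z})]\,\mathbf K^k(d\mathbf z)\mathbf K^k(d\mathbf x),\\ E_4&=\frac2{k!}\sum_{\emptyset\subsetneq I\subsetneq\{1,\dots,k\}}\frac1{(k-|I|)!}\int_{\mathbb X^k}\int_{\mathbb X^{k-|I|}}\mathbb E[\tilde g(\mathbf x,\eta+\delta_{\mathbf x}+\delta_{\mathbf z})\,\tilde g((\mathbf x_I,\mathbf z),\eta+\delta_{\mathbf x}+\delta_{\mathbf z})]\,\mathbf K^{k-|I|}(d\mathbf z)\mathbf K^k(d\mathbf x), \end{aligned}$$ with $(\mathbf x_I,\mathbf z)=(x_{i_1},\dots,x_{i_m},z_1,\dots,z_{k-m})$ for $I=\{i_1<\dots<i_m\}$. -/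

import Mathlib

open MeasureTheory ProbabilityTheory TopologicalSpace
open scoped ENNReal NNReal Nat

noncomputable section

/-- Counting measures: all values on measurable sets lie in `{0, 1, 2, …} ∪ {∞}`. -/
def IsCountingMeasure {X : Type*} [MeasurableSpace X] (μ : Measure X) : Prop :=
  ∀ B : Set X, MeasurableSet B → ∃ n : ℕ∞, μ B = (n : ℝ≥0∞)

/-- The space of `σ`-finite counting measures on `X`. Its `σ`-algebra is the trace of the one on
`Measure X`, i.e. the `σ`-algebra generated by the maps `ω ↦ ω B`, `B` measurable. -/
abbrev PointConfig (X : Type*) [MeasurableSpace X] : Type _ :=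
  {μ : Measure X // SigmaFinite μ ∧ IsCountingMeasure μ}

/-- The space of finite counting measures on `X`, with the `σ`-algebra generated by the maps
`ω ↦ ω B`, `B` measurable. -/
abbrev FinPointConfig (X : Type*) [MeasurableSpace X] : Type _ :=
  {μ : Measure X // IsFiniteMeasure μ ∧ IsCountingMeasure μ}

theorem isCountingMeasure_zero {X : Type*} [MeasurableSpace X] :
    IsCountingMeasure (0 : Measure X) := fun _ _ => ⟨0, by simp⟩

theorem isCountingMeasure_dirac {X : Type*} [MeasurableSpace X] (x : X) :
    IsCountingMeasure (Measure.dirac x) := by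
  intro B hB
  by_cases h : x ∈ B
  · exact ⟨1, by simp [Measure.dirac_apply' x hB, h]⟩
  · exact ⟨0, by simp [Measure.dirac_apply' x hB, h]⟩

theorem IsCountingMeasure.add {X : Type*} [MeasurableSpace X] {μ ν : Measure X}
    (hμ : IsCountingMeasure μ) (hν : IsCountingMeasure ν) : IsCountingMeasure (μ + ν) := by
  intro B hB
  obtain ⟨m, hm⟩ := hμ B hB
  obtain ⟨n, hn⟩ := hν B hB
  exact ⟨m + n, by simp [hm, hn]⟩

theorem IsCountingMeasure.restrict {X : Type*} [MeasurableSpace X] {μ : Measure X}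
    (hμ : IsCountingMeasure μ) (S : Set X) : IsCountingMeasure (μ.restrict S) := by
  intro B hB
  obtain ⟨n, hn⟩ := hμ _ (measurableSet_toMeasurable μ (B ∩ S))
  exact ⟨n, by rw [Measure.restrict_apply hB, ← measure_toMeasurable, hn]⟩

namespace PointConfig

variable {X : Type*} [MeasurableSpace X]

/-- The restriction `ω ∩ S`. -/
def restrict (ω : PointConfig X) (S : Set X) : PointConfig X :=
  ⟨ω.1.restrict S, by have := ω.2.1; infer_instance, ω.2.2.restrict S⟩

/-- Adding a tuple of points: `ω + δ_𝐱 = ω + ∑ i, δ_{x_i}`. -/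
def addPoints (ω : PointConfig X) {m : ℕ} (x : Fin m → X) : PointConfig X :=
  ⟨ω.1 + ∑ i, Measure.dirac (x i), by
    have h : ∀ s : Finset (Fin m),
        IsFiniteMeasure (∑ i ∈ s, Measure.dirac (x i)) ∧
          IsCountingMeasure (∑ i ∈ s, Measure.dirac (x i)) := by
      classical
      intro s
      induction s using Finset.induction_on with
      | empty => exact ⟨by rw [Finset.sum_empty]; infer_instance,
          by rw [Finset.sum_empty]; exact isCountingMeasure_zero⟩
      | insert a s ha ih =>
        have := ih.1
        rw [Finset.sum_insert ha]
        exact ⟨inferInstance, (isCountingMeasure_dirac _).add ih.2⟩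
    have := ω.2.1
    have := (h Finset.univ).1
    exact ⟨inferInstance, ω.2.2.add (h Finset.univ).2⟩⟩

/-- The points of `ω`, listed with multiplicity: a location `x` carries the labels
`0, 1, …, ω{x} - 1`. This is the index set `I` of a representation `ω = ∑_{i ∈ I} δ_{x_i}`. -/
def Points (ω : PointConfig X) : Type _ :=
  {p : X × ℕ // (p.2 : ℝ≥0∞) < ω.1 {p.1}}

/-- The location of a point. -/
def Points.loc {ω : PointConfig X} (p : ω.Points) : X := p.1.1

/-- `ω^k_≠` is indexed by the injections of `Fin k` into the points of `ω`; this is the tuple of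
locations `(x_{i_1}, …, x_{i_k})` belonging to such an injection. -/
def tuple {ω : PointConfig X} {k : ℕ} (t : Fin k ↪ ω.Points) : Fin k → X := fun i => (t i).loc

end PointConfig

/-- `ξ[ω] = (1 / k!) ∑_{𝐱 ∈ ω^k_≠} g(𝐱, ω) δ_{f(𝐱, ω)}`, as a measure on `Y`. -/
def inducedProcess {X Y : Type*} [MeasurableSpace X] [MeasurableSpace Y] {k : ℕ}
    (f : (Fin k → X) → PointConfig X → Y) (g : (Fin k → X) → PointConfig X → ℝ≥0∞)
    (ω : PointConfig X) : Measure Y :=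
  ((k ! : ℕ) : ℝ≥0∞)⁻¹ • Measure.sum (fun t : Fin k ↪ ω.Points =>
    g (PointConfig.tuple t) ω • Measure.dirac (f (PointConfig.tuple t) ω))

/-- `η` is a Poisson process with intensity measure `K` on the probability space `(Ω, P)`
(a Poisson variable with infinite parameter is almost surely infinite). -/
structure IsPoissonProcess {Ω X : Type*} [MeasurableSpace Ω] [MeasurableSpace X]
    (P : Measure Ω) (η : Ω → PointConfig X) (K : Measure X) : Prop where
  measurable : Measurable η
  law : ∀ B : Set X, MeasurableSet B → K B ≠ ∞ → ∀ n : ℕ,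
    P {w | (η w).1 B = (n : ℝ≥0∞)} = poissonMeasure (K B).toNNReal {n}
  law_top : ∀ B : Set X, MeasurableSet B → K B = ∞ → ∀ᵐ w ∂P, (η w).1 B = ∞
  indep : ∀ (m : ℕ) (B : Fin m → Set X), (∀ i, MeasurableSet (B i)) →
    Pairwise (fun i j => Disjoint (B i) (B j)) → iIndepFun (fun i w => (η w).1 (B i)) P

/-- `L` is the intensity measure of the random measure `ξ`: `L(A) = 𝔼 ξ(A)`. -/
def IsIntensityMeasure {Ω Y : Type*} [MeasurableSpace Ω] [MeasurableSpace Y]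
    (P : Measure Ω) (ξ : Ω → Measure Y) (L : Measure Y) : Prop :=
  ∀ A : Set Y, MeasurableSet A → L A = ∫⁻ w, ξ w A ∂P

/-- Total variation distance between measures: the supremum of `|μ A - ν A|` over the measurable
sets `A` of finite measure. -/
def tvDist {Y : Type*} [MeasurableSpace Y] (μ ν : Measure Y) : ℝ≥0∞ :=
  ⨆ (A : Set Y) (_ : MeasurableSet A ∧ μ A < ∞ ∧ ν A < ∞),
    ENNReal.ofReal |(μ A).toReal - (ν A).toReal|

/-- Measurable functionals of finite configurations that are `1`-Lipschitz for the total variation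
distance. -/
def LipFunctionals (Y : Type*) [MeasurableSpace Y] : Set (FinPointConfig Y → ℝ) :=
  {h | Measurable h ∧ ∀ ω₁ ω₂ : FinPointConfig Y,
    ENNReal.ofReal |h ω₁ - h ω₂| ≤ tvDist ω₁.1 ω₂.1}

open Classical in
/-- A finite counting measure as an element of `FinPointConfig Y`. (Measures that are not finite
counting measures are sent to `0`; this is used for random measures that are almost surely finite
counting measures.) -/
def toFinPointConfig {Y : Type*} [MeasurableSpace Y] (μ : Measure Y) : FinPointConfig Y :=
  if h : IsFiniteMeasure μ ∧ IsCountingMeasure μ then ⟨μ, h⟩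
  else ⟨0, inferInstance, isCountingMeasure_zero⟩

/-- Kantorovich–Rubinstein distance between (the laws of) two finite point processes, each on its
own probability space. -/
def krDist {Ω Ω' Y : Type*} [MeasurableSpace Ω] [MeasurableSpace Ω'] [MeasurableSpace Y]
    (P : Measure Ω) (ξ : Ω → FinPointConfig Y) (Q : Measure Ω') (ζ : Ω' → FinPointConfig Y) :
    ℝ≥0∞ :=
  ⨆ h ∈ LipFunctionals Y, ENNReal.ofReal |(∫ w, h (ξ w) ∂P) - ∫ w, h (ζ w) ∂Q|

/-- The `σ`-algebra on the closed subsets of `X` generated by the families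
`{F : F ∩ C ≠ ∅}`, `C` compact (the Borel `σ`-algebra of the Fell topology). -/
@[reducible] def fellMeasurableSpace (X : Type*) [TopologicalSpace X] : MeasurableSpace (Closeds X) :=
  MeasurableSpace.generateFrom
    {A | ∃ C : Set X, IsCompact C ∧ A = {F : Closeds X | ((F : Set X) ∩ C).Nonempty}}

/-- `f` and `g` are localized to `𝒮`: for `𝐱 ∈ ω^k_≠` and measurable `A ⊇ 𝒮(𝐱, ω)`, the value
`g(𝐱, ω)`, and `f(𝐱, ω)` if `g(𝐱, ω) = 1`, do not change when `ω` is replaced by `ω ∩ A`. -/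
def IsLocalizedTo {X Y : Type*} [TopologicalSpace X] [MeasurableSpace X] {k : ℕ}
    (f : (Fin k → X) → PointConfig X → Y) (g : (Fin k → X) → PointConfig X → ℝ≥0∞)
    (𝒮 : (Fin k → X) → PointConfig X → Closeds X) : Prop :=
  ∀ (ω : PointConfig X) (t : Fin k ↪ ω.Points) (A : Set X), MeasurableSet A →
    (𝒮 (PointConfig.tuple t) ω : Set X) ⊆ A →
      g (PointConfig.tuple t) ω = g (PointConfig.tuple t) (ω.restrict A) ∧
      (g (PointConfig.tuple t) ω = 1 →
        f (PointConfig.tuple t) ω = f (PointConfig.tuple t) (ω.restrict A))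

/-- The stopping property of `𝒮(𝐱, ·)` at the closed set `A`:
`{ω : 𝒮(𝐱, ω) ⊆ A} = {ω : 𝒮(𝐱, ω ∩ A) ⊆ A}`. -/
def StopsAt {X : Type*} [TopologicalSpace X] [MeasurableSpace X] {k : ℕ}
    (𝒮 : (Fin k → X) → PointConfig X → Closeds X) (x : Fin k → X) (A : Closeds X) : Prop :=
  {ω : PointConfig X | (𝒮 x ω : Set X) ⊆ A} =
    {ω : PointConfig X | (𝒮 x (ω.restrict A) : Set X) ⊆ A}

section Bound

variable {Ω X : Type*} [MeasurableSpace Ω] [TopologicalSpace X] [MeasurableSpace X] {k : ℕ}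

open Classical in
/-- `g̃(𝐱, ω) = g(𝐱, ω) 1{𝒮(𝐱, ω) ⊆ S_𝐱}`. -/
def truncated (g : (Fin k → X) → PointConfig X → ℝ≥0∞)
    (𝒮 : (Fin k → X) → PointConfig X → Closeds X) (S : (Fin k → X) → Closeds X)
    (x : Fin k → X) (ω : PointConfig X) : ℝ≥0∞ :=
  if (𝒮 x ω : Set X) ⊆ S x then g x ω else 0

open Classical in
/-- `1{S_𝐱 ∩ S_𝐳 ≠ ∅}`. -/
def overlap (S : (Fin k → X) → Closeds X) (x z : Fin k → X) : ℝ≥0∞ :=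
  if ((S x : Set X) ∩ S z).Nonempty then 1 else 0

/-- The tuple `(𝐱_I, 𝐳) = (x_{i_1}, …, x_{i_m}, z_1, …, z_{k-m})` for
`I = {i_1 < … < i_m}`. -/
def mixTuple (x : Fin k → X) (I : Finset (Fin k)) (z : Fin (k - I.card) → X) : Fin k → X :=
  fun j => if h : (j : ℕ) < I.card then x (I.orderEmbOfFin rfl ⟨j, h⟩)
    else z ⟨(j : ℕ) - I.card, by omega⟩

open Classical in
/-- The term `E₁`. -/
def errorE1 (P : Measure Ω) (η : Ω → PointConfig X) (K : Measure X)
    (g : (Fin k → X) → PointConfig X → ℝ≥0∞)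
    (𝒮 : (Fin k → X) → PointConfig X → Closeds X) (S : (Fin k → X) → Closeds X) : ℝ≥0∞ :=
  2 / (k ! : ℕ) * ∫⁻ x : Fin k → X, ∫⁻ w,
    (if (𝒮 x ((η w).addPoints x) : Set X) ⊆ S x then 0 else g x ((η w).addPoints x))
      ∂P ∂(Measure.pi fun _ => K)

/-- The term `E₂`, with `gt` in the role of `g̃`. -/
def errorE2 (P : Measure Ω) (η : Ω → PointConfig X) (K : Measure X)
    (gt : (Fin k → X) → PointConfig X → ℝ≥0∞) (S : (Fin k → X) → Closeds X) : ℝ≥0∞ :=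
  2 / ((k ! : ℕ) : ℝ≥0∞) ^ 2 * ∫⁻ x : Fin k → X, ∫⁻ z : Fin k → X,
    overlap S x z * (∫⁻ w, gt x ((η w).addPoints x) ∂P) * (∫⁻ w, gt z ((η w).addPoints z) ∂P)
      ∂(Measure.pi fun _ => K) ∂(Measure.pi fun _ => K)

/-- The term `E₃`, with `gt` in the role of `g̃`. -/
def errorE3 (P : Measure Ω) (η : Ω → PointConfig X) (K : Measure X)
    (gt : (Fin k → X) → PointConfig X → ℝ≥0∞) (S : (Fin k → X) → Closeds X) : ℝ≥0∞ :=
  2 / ((k ! : ℕ) : ℝ≥0∞) ^ 2 * ∫⁻ x : Fin k → X, ∫⁻ z : Fin k → X,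
    overlap S x z * (∫⁻ w, gt x (((η w).addPoints x).addPoints z) *
      gt z (((η w).addPoints x).addPoints z) ∂P)
      ∂(Measure.pi fun _ => K) ∂(Measure.pi fun _ => K)

open Classical in
/-- The term `E₄`, with `gt` in the role of `g̃`; the sum is over the nonempty proper subsets `I`
of the index set. -/
def errorE4 (P : Measure Ω) (η : Ω → PointConfig X) (K : Measure X)
    (gt : (Fin k → X) → PointConfig X → ℝ≥0∞) : ℝ≥0∞ :=
  2 / (k ! : ℕ) * ∑ I ∈ (Finset.univ : Finset (Finset (Fin k))).filter
      (fun I => I.Nonempty ∧ I ≠ Finset.univ),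
    1 / ((k - I.card) ! : ℕ) * ∫⁻ x : Fin k → X, ∫⁻ z : Fin (k - I.card) → X, ∫⁻ w,
      gt x (((η w).addPoints x).addPoints z) *
        gt (mixTuple x I z) (((η w).addPoints x).addPoints z)
      ∂P ∂(Measure.pi fun _ => K) ∂(Measure.pi fun _ => K)

end Bound

end

/-!
The bound is proved by Stein's method for the Poisson process, with couplings built from the spatial
independence of `η`. Three facts carry it.

*The Stein equation.* For a functional `h` that is `1`-Lipschitz in total variation, there are a
constant `c` and a function `u(y, ω)` with
`h(ω) - c = ∫ u(y, ω - δ_y) ω(dy) - ∫ u(y, ω) M(dy)` for all finite configurations `ω`, where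
`|u| ≤ 1` and `u(y, ω) - u(z, ω) ≤ 1` (`exists_stein_gradient`). Instead of the semigroup of the
immigration-death process, the proof solves the equation which that process, killed at unit rate,
gives for `u` itself: a monotone iteration from `0` converges and preserves both bounds, and a
uniqueness statement (`eq_zero_of_killed_harmonic`) makes `u` a discrete gradient. By the Mecke
equation for `ζ`, the constant `c` is `𝔼 h(ζ)`. The bounds on `u` show that replacing an intensity
measure by `M` costs at most their total variation distance (`abs_integral_sub_le_tvDist`).

*Coupling.* Truncation makes `f` and `g̃` localized to the deterministic sets `S_𝐱`
(`isLocalizedTo_truncated`); this is where the stopping property enters. By the Mecke equation,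
`𝔼 ∫ G(y, ξ - δ_y) ξ(dy)`, for the truncated process `ξ`, is an integral over tuples `𝐱` of
expectations for `η + δ_𝐱`, and `𝔼 ∫ G(y, ξ) L(dy)` is one with an independent copy of `η`.
Replacing the points of that copy outside `S_𝐱` by those of `η` does not change its joint law with
`η ∩ S_𝐱`, which determines the point at `𝐱`. Afterwards the two processes agree, up to the point at
`𝐱`, in all points whose tuples `𝐳` satisfy `S_𝐱 ∩ S_𝐳 = ∅` (`LocalSetting.remove_eq_or_two_le`).
What remains is a count of pairs of tuples with meeting regions: `E₂` for independent copies, and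
`E₃` and `E₄` for `η + δ_𝐱`, according to the number of entries that the tuples share
(`LocalSetting.coupling_bounds`). The points lost by the truncation are counted by `E₁`.

*Second moments.* The same splitting into near and far tuples expresses the second moment of the
number of points through `E₂`, `E₃` and `E₄` (`LocalSetting.lintegral_sq_add`), which makes the two
forms of the bound equal; if the variance is infinite, then so is `E₃ + E₄`.

Sums over tuples are measurable functions of a configuration only where it is finite on the members
of a fixed exhaustion. A Poisson process has this property almost surely with respect to
`spanningSets K`, and `PointConfig.truncOn` modifies it on a null set so as to have it everywhere.
-/

set_option linter.unusedSectionVars false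

/-! ### Counting measures as multisets of points -/

section CountingMeasures

open Set Filter Topology

variable {X : Type*} [TopologicalSpace X] [SecondCountableTopology X] [T2Space X]
  [MeasurableSpace X] [BorelSpace X]

theorem IsCountingMeasure.measure_nonatoms_of_isFiniteMeasure {μ : Measure X}
    (hμ : IsCountingMeasure μ) [IsFiniteMeasure μ] : μ {x | μ {x} = 0} = 0 := by
  refine measure_null_of_locally_null _ fun x hx => ?_
  -- shrinking open neighbourhoods; their masses are integers decreasing to `μ {x} = 0`
  obtain ⟨U, hU⟩ := (𝓝 x).exists_antitone_basis
  by_contra! h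
  have hpos : ∀ n, 1 ≤ μ (⋂ i ∈ Finset.range (n + 1), interior (U i)) := by
    intro n
    have hm : MeasurableSet (⋂ i ∈ Finset.range (n + 1), interior (U i)) :=
      Finset.measurableSet_biInter _ fun i _ => isOpen_interior.measurableSet
    obtain ⟨m, hm'⟩ := hμ _ hm
    have hne : μ (⋂ i ∈ Finset.range (n + 1), interior (U i)) ≠ 0 := by
      refine h _ (mem_nhdsWithin_of_mem_nhds ?_)
      exact (biInter_finset_mem _).2 fun i _ => interior_mem_nhds.2 (hU.1.mem_of_mem trivial)
    rw [hm'] at hne ⊢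
    have : m ≠ 0 := by rintro rfl; simp at hne
    exact_mod_cast Order.one_le_iff_pos.2 (pos_iff_ne_zero.2 this)
  have hlim := tendsto_measure_iInter_atTop (μ := μ)
    (s := fun n => ⋂ i ∈ Finset.range (n + 1), interior (U i))
    (fun n => (Finset.measurableSet_biInter _
      fun i _ => isOpen_interior.measurableSet).nullMeasurableSet)
    (fun a b hab => biInter_subset_biInter_left fun i hi => by
      simp only [Finset.coe_range, mem_Iio] at hi ⊢; omega) ⟨0, measure_ne_top _ _⟩
  have hInter : (⋂ n, ⋂ i ∈ Finset.range (n + 1), interior (U i)) = {x} := by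
    apply subset_antisymm
    · intro y hy
      by_contra hne
      have : {y}ᶜ ∈ 𝓝 x := isOpen_compl_singleton.mem_nhds (by simpa [eq_comm] using hne)
      obtain ⟨n, -, hn⟩ := hU.1.mem_iff.1 this
      have h1 := mem_iInter.1 hy n
      exact hn (interior_subset (mem_iInter₂.1 h1 n (by simp))) rfl
    · rintro _ rfl
      simp only [mem_iInter]
      exact fun n i _ => mem_interior_iff_mem_nhds.2 (hU.1.mem_of_mem trivial)
  rw [hInter, show μ {x} = 0 from hx] at hlim
  exact absurd (ge_of_tendsto' hlim hpos) (by simp)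

/-- A `σ`-finite counting measure is carried by its atoms: a point of mass `0` has a neighbourhood
of mass less than `1`, at least within a set of finite mass. -/
theorem IsCountingMeasure.measure_nonatoms {μ : Measure X} [SigmaFinite μ]
    (hμ : IsCountingMeasure μ) : μ {x | μ {x} = 0} = 0 := by
  have h : ∀ n, μ ({x | μ {x} = 0} ∩ spanningSets μ n) = 0 := by
    intro n
    have hfin : IsFiniteMeasure (μ.restrict (spanningSets μ n)) :=
      ⟨by simpa using measure_spanningSets_lt_top μ n⟩
    have h1 := (hμ.restrict (spanningSets μ n)).measure_nonatoms_of_isFiniteMeasure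
    have h2 := measure_mono_null (t := {x | μ.restrict (spanningSets μ n) {x} = 0})
      (s := {x | μ {x} = 0}) (μ := μ.restrict (spanningSets μ n))
      (fun x hx => le_antisymm ((Measure.restrict_apply_le _ _).trans_eq hx) zero_le) h1
    rwa [Measure.restrict_apply' (measurableSet_spanningSets μ n)] at h2
  have := measure_iUnion_null h
  rwa [← inter_iUnion, iUnion_spanningSets, inter_univ] at this

theorem countable_setOf_measure_singleton_ne_zero (μ : Measure X) [SigmaFinite μ] :
    {x | μ {x} ≠ 0}.Countable := by
  have := Measure.countable_meas_pos_of_disjoint_iUnion (μ := μ) (As := fun x : X => {x})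
    (fun x => measurableSet_singleton x) (fun x y hxy => by simpa using hxy)
  simpa [pos_iff_ne_zero] using this

theorem IsCountingMeasure.lintegral_eq_tsum {μ : Measure X} [SigmaFinite μ]
    (hμ : IsCountingMeasure μ) (u : X → ℝ≥0∞) : ∫⁻ x, u x ∂μ = ∑' x, u x * μ {x} := by
  have hC := countable_setOf_measure_singleton_ne_zero μ
  have hr : μ.restrict {x | μ {x} ≠ 0} = μ := by
    apply Measure.restrict_eq_self_of_ae_mem
    rw [ae_iff]
    simpa using hμ.measure_nonatoms
  conv_lhs => rw [← hr]
  rw [lintegral_countable _ hC]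
  rw [tsum_subtype {x | μ {x} ≠ 0} (fun a => u a * μ {a})]
  congr 1
  ext x
  by_cases hx : μ {x} = 0 <;> simp [hx]

theorem measure_singleton_lt_top_of_sigmaFinite (μ : Measure X) [SigmaFinite μ] (x : X) :
    μ {x} < ∞ := by
  have : x ∈ ⋃ n, spanningSets μ n := by rw [iUnion_spanningSets]; trivial
  obtain ⟨n, hn⟩ := mem_iUnion.1 this
  exact (measure_mono (singleton_subset_iff.2 hn)).trans_lt (measure_spanningSets_lt_top μ n)

end CountingMeasures

section Represents

open Set

variable {X : Type*} [MeasurableSpace X]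

/-- The family of points `loc` represents the counting measure `μ` as a multiset: every location
`v` occurs `μ {v}` times in it. -/
def Represents {α : Type*} (loc : α → X) (μ : Measure X) : Prop :=
  ∀ v, ({a | loc a = v}.encard : ℝ≥0∞) = μ {v}

theorem encard_setOf_natCast_lt (c : ℕ∞) :
    {n : ℕ | (n : ℝ≥0∞) < (c : ℝ≥0∞)}.encard = c := by
  induction c using ENat.recTopCoe with
  | top =>
    have : {n : ℕ | (n : ℝ≥0∞) < ((⊤ : ℕ∞) : ℝ≥0∞)} = univ := by ext n; simp
    rw [this, encard_univ]; simp
  | coe m =>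
    have : {n : ℕ | (n : ℝ≥0∞) < ((m : ℕ∞) : ℝ≥0∞)} = (Finset.range m : Set ℕ) := by
      ext n; simp
    rw [this, encard_coe_eq_coe_finsetCard, Finset.card_range]

variable [TopologicalSpace X] [SecondCountableTopology X] [T2Space X] [BorelSpace X]

theorem represents_points (ω : PointConfig X) :
    Represents (fun p : ω.Points => p.loc) ω.1 := by
  intro v
  obtain ⟨c, hc⟩ := ω.2.2 {v} (measurableSet_singleton v)
  rw [hc, ← encard_setOf_natCast_lt c, ← hc]
  congr 1
  rw [← Function.Injective.encard_image (f := fun p : ω.Points => p.1) Subtype.val_injective,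
    ← Function.Injective.encard_image (f := fun n : ℕ => (v, n)) (fun a b h => by simpa using h)]
  congr 1
  ext ⟨x, n⟩
  constructor
  · rintro ⟨⟨⟨x', n'⟩, hp⟩, h1, h2⟩
    simp only [Prod.mk.injEq] at h2
    obtain ⟨rfl, rfl⟩ := h2
    obtain rfl : x' = v := h1
    exact ⟨n', hp, rfl⟩
  · rintro ⟨n', h1, h2⟩
    simp only [Prod.mk.injEq] at h2
    obtain ⟨rfl, rfl⟩ := h2
    exact ⟨⟨(v, n'), h1⟩, rfl, rfl⟩

theorem Represents.lintegral {α : Type*} {loc : α → X} {μ : Measure X} [SigmaFinite μ]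
    (h : Represents loc μ) (hμ : IsCountingMeasure μ) (u : X → ℝ≥0∞) :
    ∫⁻ x, u x ∂μ = ∑' a, u (loc a) := by
  rw [hμ.lintegral_eq_tsum, ← (Equiv.sigmaFiberEquiv loc).tsum_eq (fun a => u (loc a)),
    ENNReal.tsum_sigma']
  congr 1
  ext v
  have : ∀ a : {a // loc a = v}, u (loc (Equiv.sigmaFiberEquiv loc ⟨v, a⟩)) = u v := by
    rintro ⟨a, rfl⟩; rfl
  simp_rw [this]
  rw [ENNReal.tsum_const, ← h v, mul_comm]
  rfl

/-- A family of points representing `ω` is, up to a relabelling, the family of points of `ω`. -/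
theorem Represents.exists_equiv {α : Type*} {loc : α → X} {ω : PointConfig X}
    (h : Represents loc ω.1) : ∃ e : α ≃ ω.Points, ∀ a, (e a).loc = loc a := by
  have key : ∀ v, Nonempty ({a // loc a = v} ≃ {p : ω.Points // p.loc = v}) := by
    intro v
    have := ω.2.1
    have hlt := measure_singleton_lt_top_of_sigmaFinite ω.1 v
    have h1 := h v
    have h2 := represents_points ω v
    rw [← h1] at hlt
    have hf1 : {a | loc a = v}.Finite := by
      rw [← encard_lt_top_iff]
      simpa using hlt
    have heq : {a | loc a = v}.encard = {p : ω.Points | p.loc = v}.encard := by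
      rw [← h2] at h1
      exact_mod_cast h1
    have hf2 : {p : ω.Points | p.loc = v}.Finite := by
      rw [← encard_lt_top_iff, ← heq]; simpa using hlt
    have : Finite {a // loc a = v} := hf1
    have : Finite {p : ω.Points // p.loc = v} := hf2
    refine Finite.card_eq.1 ?_
    have := congrArg ENat.toNat heq
    simp only [← ncard_def, ← Nat.card_coe_set_eq] at this
    exact this
  exact ⟨Equiv.ofFiberEquiv fun v => (key v).some, fun a => Equiv.ofFiberEquiv_map _ a⟩

theorem Represents.subtype {α : Type*} {loc : α → X} (p : α → Prop) (v : X) :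
    {a : {a // p a} | loc a = v}.encard = {a | p a ∧ loc a = v}.encard := by
  rw [← Function.Injective.encard_image (f := fun a : {a // p a} => a.1) Subtype.val_injective]
  congr 1
  ext a
  simp [and_comm]

theorem Represents.restrict {α : Type*} {loc : α → X} {μ : Measure X} (h : Represents loc μ)
    (B : Set X) : Represents (fun a : {a // loc a ∈ B} => loc a) (μ.restrict B) := by
  intro v
  rw [Represents.subtype (fun a => loc a ∈ B), Measure.restrict_apply (measurableSet_singleton v)]
  by_cases hv : v ∈ B
  · have : {a | loc a ∈ B ∧ loc a = v} = {a | loc a = v} := by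
      ext a; constructor
      · exact fun h => h.2
      · rintro rfl; exact ⟨hv, rfl⟩
    rw [this, h v, inter_eq_left.2 (singleton_subset_iff.2 hv)]
  · have : {a | loc a ∈ B ∧ loc a = v} = ∅ := by
      ext a
      simp only [mem_ofPred_eq, mem_empty_iff_false, iff_false]
      rintro ⟨h, rfl⟩; exact hv h
    rw [this, singleton_inter_eq_empty.2 hv]; simp

theorem Represents.addPoints {α : Type*} {loc : α → X} {ω : PointConfig X}
    (h : Represents loc ω.1) {m : ℕ} (x : Fin m → X) :
    Represents (Sum.elim loc x) (ω.addPoints x).1 := by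
  classical
  intro v
  have h1 : {a : α ⊕ Fin m | Sum.elim loc x a = v} =
      Sum.inl '' {a | loc a = v} ∪ Sum.inr '' {i | x i = v} := by
    ext (a | a) <;> simp
  rw [h1, encard_union_eq (by
    rw [disjoint_left]; rintro _ ⟨a, -, rfl⟩ ⟨b, -, hb⟩; exact Sum.inr_ne_inl hb),
    Sum.inl_injective.encard_image, Sum.inr_injective.encard_image, ENat.toENNReal_add, h v]
  simp only [PointConfig.addPoints, Measure.add_apply, Measure.finsetSum_apply]
  congr 1
  have h2 : {i | x i = v} = (Finset.univ.filter fun i => x i = v : Finset (Fin m)) := by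
    ext; simp
  rw [h2, encard_coe_eq_coe_finsetCard, Finset.card_filter]
  simp [Measure.dirac_apply' _ (measurableSet_singleton v), indicator_apply]

end Represents

/-! ### Removal of a point -/

section Remove

open Set

variable {X : Type*} [MeasurableSpace X]

/-- `μ - δ_x`, if `x` is an atom of the counting measure `μ` (and `μ` otherwise). -/
noncomputable def MeasureTheory.Measure.removePoint (μ : Measure X) (x : X) : Measure X :=
  μ.restrict {x}ᶜ + (μ {x} - 1) • Measure.dirac x

variable [MeasurableSingletonClass X]

theorem removePoint_apply (μ : Measure X) (x : X) {B : Set X} (hB : MeasurableSet B) :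
    μ.removePoint x B = μ (B \ {x}) + (μ {x} - 1) * B.indicator 1 x := by
  simp [Measure.removePoint, Measure.restrict_apply hB, Measure.dirac_apply' x hB, sdiff_eq]

theorem removePoint_le (μ : Measure X) (x : X) : μ.removePoint x ≤ μ := by
  refine Measure.le_iff.2 fun B hB => ?_
  rw [removePoint_apply μ x hB]
  by_cases h : x ∈ B
  · rw [← measure_inter_add_sdiff B (measurableSet_singleton x),
      inter_eq_right.2 (singleton_subset_iff.2 h), add_comm]
    gcongr
    simp [h]
  · simp [h]

theorem removePoint_zero (x : X) : (0 : Measure X).removePoint x = 0 := by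
  simp [Measure.removePoint]

theorem IsCountingMeasure.removePoint {μ : Measure X} (hμ : IsCountingMeasure μ) (x : X) :
    IsCountingMeasure (μ.removePoint x) := by
  refine (hμ.restrict _).add fun B hB => ?_
  obtain ⟨n, hn⟩ := hμ {x} (measurableSet_singleton x)
  by_cases h : x ∈ B
  · exact ⟨n - 1, by simp [hn, h, Measure.dirac_apply' x hB]⟩
  · exact ⟨0, by simp [h, Measure.dirac_apply' x hB]⟩

theorem removePoint_add_dirac_self (μ : Measure X) (x : X) :
    (μ + Measure.dirac x).removePoint x = μ := by
  ext B hB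
  rw [removePoint_apply _ x hB]
  simp only [Measure.add_apply, Measure.dirac_apply' x (measurableSet_singleton x),
    Measure.dirac_apply' x (hB.diff (measurableSet_singleton x))]
  simp only [mem_singleton_iff, indicator_of_mem, Pi.one_apply, mem_sdiff, not_true, and_false,
    not_false_eq_true, indicator_of_notMem, add_zero]
  rw [ENNReal.add_sub_cancel_right (by simp)]
  by_cases hx : x ∈ B
  · conv_rhs => rw [← measure_inter_add_sdiff B (measurableSet_singleton x),
      inter_eq_right.2 (singleton_subset_iff.2 hx), add_comm]
    simp [hx]
  · simp [hx, sdiff_singleton_eq_self hx]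

theorem removePoint_add_dirac {μ : Measure X} {x : X} (h : 1 ≤ μ {x}) :
    μ.removePoint x + Measure.dirac x = μ := by
  ext B hB
  rw [Measure.add_apply, removePoint_apply _ x hB, Measure.dirac_apply' x hB]
  by_cases hx : x ∈ B
  · conv_rhs => rw [← measure_inter_add_sdiff B (measurableSet_singleton x),
      inter_eq_right.2 (singleton_subset_iff.2 hx), add_comm]
    simp [hx, add_assoc, tsub_add_cancel_of_le h]
  · simp [hx, sdiff_singleton_eq_self hx]

theorem IsCountingMeasure.one_le_of_ne_zero {μ : Measure X} (hμ : IsCountingMeasure μ) {B : Set X}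
    (hB : MeasurableSet B) (h : μ B ≠ 0) : 1 ≤ μ B := by
  obtain ⟨n, hn⟩ := hμ B hB
  rw [hn] at h ⊢
  have : n ≠ 0 := by rintro rfl; simp at h
  exact_mod_cast Order.one_le_iff_pos.2 (pos_iff_ne_zero.2 this)

/-- The configuration `ω - δ_x` (which is `ω` if `x` is not a point of `ω`). -/
noncomputable def PointConfig.remove (ω : PointConfig X) (x : X) : PointConfig X :=
  ⟨ω.1.removePoint x, by
    have := ω.2.1
    exact ⟨⟨⟨spanningSets ω.1, fun _ => trivial,
      fun n => (removePoint_le ω.1 x _).trans_lt (measure_spanningSets_lt_top ω.1 n),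
      iUnion_spanningSets ω.1⟩⟩, ω.2.2.removePoint x⟩⟩

variable [TopologicalSpace X] [SecondCountableTopology X] [T2Space X] [BorelSpace X]

theorem Represents.remove {α : Type*} {loc : α → X} {μ : Measure X} (h : Represents loc μ)
    (a : α) : Represents (fun b : {b // b ≠ a} => loc b) (μ.removePoint (loc a)) := by
  intro v
  rw [Represents.subtype (fun b => b ≠ a), removePoint_apply _ _ (measurableSet_singleton v)]
  by_cases hv : loc a = v
  · subst hv
    have : {b | b ≠ a ∧ loc b = loc a} = {b | loc b = loc a} \ {a} := by
      ext b; simp [and_comm]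
    rw [this, encard_sdiff_singleton_of_mem (show a ∈ {b | loc b = loc a} from rfl),
      ENat.toENNReal_sub, h (loc a)]
    simp
  · have : {b | b ≠ a ∧ loc b = v} = {b | loc b = v} := by
      ext b
      simp only [mem_ofPred_eq, and_iff_right_iff_imp]
      rintro rfl rfl; exact hv rfl
    rw [this, h v, sdiff_singleton_eq_self (by simpa using hv)]
    simp [hv]

end Remove

/-! ### Sums over tuples of pairwise distinct points -/

section FactorialSum

open Set

variable {X : Type*} [MeasurableSpace X]

/-- `∑_{𝐱 ∈ ω^k_≠} u(𝐱)`. -/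
noncomputable def factorialSum {k : ℕ} (u : (Fin k → X) → ℝ≥0∞) (ω : PointConfig X) : ℝ≥0∞ :=
  ∑' t : Fin k ↪ ω.Points, u (PointConfig.tuple t)

/-- An injective `k+1`-tuple is a first entry together with an injective `k`-tuple avoiding it. -/
noncomputable def embeddingFinSuccEquiv (α : Type*) (k : ℕ) :
    (Σ a : α, Fin k ↪ {b // b ≠ a}) ≃ (Fin (k + 1) ↪ α) where
  toFun s := ⟨Fin.cons s.1 fun i => (s.2 i).1, by
    refine Fin.cons_injective_iff.2 ⟨?_, fun i j h => s.2.injective (Subtype.ext h)⟩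
    rintro ⟨i, hi⟩
    exact (s.2 i).2 hi⟩
  invFun t := ⟨t 0, ⟨fun i => ⟨t i.succ, fun h => Fin.succ_ne_zero i (t.injective h)⟩,
    fun i j h => by simpa using h⟩⟩
  left_inv s := rfl
  right_inv t := by
    ext i
    refine Fin.cases rfl (fun i => rfl) i

theorem tsum_embedding_succ {α : Type*} {k : ℕ} (loc : α → X) (u : (Fin (k + 1) → X) → ℝ≥0∞) :
    ∑' t : Fin (k + 1) ↪ α, u (loc ∘ t) =
      ∑' a : α, ∑' t : Fin k ↪ {b // b ≠ a}, u (Fin.cons (loc a) fun i => loc (t i)) := by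
  rw [← (embeddingFinSuccEquiv α k).tsum_eq, ENNReal.tsum_sigma']
  refine tsum_congr fun a => tsum_congr fun t => congrArg u ?_
  ext i
  refine Fin.cases rfl (fun i => rfl) i

variable [TopologicalSpace X] [SecondCountableTopology X] [T2Space X] [BorelSpace X]

theorem Represents.factorialSum {α : Type*} {loc : α → X} {ω : PointConfig X}
    (h : Represents loc ω.1) {k : ℕ} (u : (Fin k → X) → ℝ≥0∞) :
    factorialSum u ω = ∑' t : Fin k ↪ α, u (loc ∘ t) := by
  obtain ⟨e, he⟩ := h.exists_equiv
  rw [_root_.factorialSum, ← (Equiv.embeddingCongr (Equiv.refl (Fin k)) e).tsum_eq]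
  refine tsum_congr fun t => congrArg u ?_
  ext i
  exact he _

theorem factorialSum_succ {k : ℕ} (u : (Fin (k + 1) → X) → ℝ≥0∞) (ω : PointConfig X) :
    factorialSum u ω =
      ∫⁻ x, factorialSum (fun z : Fin k → X => u (Fin.cons x z)) (ω.remove x) ∂ω.1 := by
  have := ω.2.1
  have h := represents_points ω
  rw [h.lintegral ω.2.2, h.factorialSum, tsum_embedding_succ]
  refine tsum_congr fun p => ?_
  have h' : Represents (fun b : {b // b ≠ p} => b.1.loc) (ω.remove p.loc).1 := h.remove p
  rw [h'.factorialSum]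
  rfl

theorem factorialSum_zero (u : (Fin 0 → X) → ℝ≥0∞) (ω : PointConfig X) :
    factorialSum u ω = u Fin.elim0 := by
  have : Unique (Fin 0 ↪ ω.Points) :=
    ⟨⟨⟨Fin.elim0, fun i => i.elim0⟩⟩, fun t => by ext i; exact i.elim0⟩
  rw [factorialSum, tsum_eq_single default (fun t ht => absurd (Unique.eq_default t) ht)]
  congr 1
  ext i
  exact i.elim0

/-- Tuples with an entry outside `B` do not count if `u` vanishes on them. -/
theorem factorialSum_restrict {k : ℕ} (u : (Fin k → X) → ℝ≥0∞) (ω : PointConfig X) (B : Set X)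
    (hu : ∀ t : Fin k ↪ ω.Points, (∃ i, (t i).loc ∉ B) → u (PointConfig.tuple t) = 0) :
    factorialSum u ω = factorialSum u (ω.restrict B) := by
  have h' : Represents (fun b : {b : ω.Points // b.loc ∈ B} => b.1.loc) (ω.restrict B).1 :=
    (represents_points ω).restrict B
  rw [h'.factorialSum, factorialSum]
  have hinj : Function.Injective (fun t : Fin k ↪ {b : ω.Points // b.loc ∈ B} =>
      t.trans (Function.Embedding.subtype _)) := by
    intro s t hst
    ext i
    exact congrArg (fun u => u i) hst
  rw [← hinj.tsum_eq]
  · rfl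
  · intro t ht
    have : ∀ i, (t i).loc ∈ B := by
      by_contra! hc
      exact ht (hu t hc)
    exact ⟨⟨fun i => ⟨t i, this i⟩, fun i j h => t.injective (congrArg Subtype.val h)⟩, rfl⟩

/-- The points of a tuple can be chosen as pairwise distinct points of any configuration to which
the tuple has been added. -/
theorem exists_tuple_addPoints {k : ℕ} (ω : PointConfig X) (x : Fin k → X) :
    ∃ t : Fin k ↪ (ω.addPoints x).Points, PointConfig.tuple t = x := by
  obtain ⟨e, he⟩ := ((represents_points ω).addPoints x).exists_equiv
  refine ⟨⟨fun i => e (Sum.inr i), fun i j h => by simpa using h⟩, ?_⟩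
  ext i
  exact he (Sum.inr i)

end FactorialSum

/-! ### Measurability in the configuration -/

section Kernels

open Set

variable {A X : Type*} [MeasurableSpace A] [MeasurableSpace X]

/-- A kernel whose measures are finite on common sets covering the space is `s`-finite, although
no uniform bound is available: split according to the integer part of the mass. -/
theorem isSFiniteKernel_of_finite_on {κ : Kernel A X} {D : ℕ → Set X}
    (hD : ∀ n, MeasurableSet (D n)) (hU : ⋃ n, D n = univ) (hκ : ∀ a n, κ a (D n) < ∞) :
    IsSFiniteKernel κ := by
  classical
  have hD' : ∀ n, MeasurableSet (disjointed D n) := fun n => MeasurableSet.disjointed hD n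
  have hκ' : ∀ a n, κ a (disjointed D n) < ∞ := fun a n =>
    (measure_mono (disjointed_subset D n)).trans_lt (hκ a n)
  have hlevel : ∀ n m : ℕ, MeasurableSet {a | ⌊(κ a (disjointed D n)).toReal⌋₊ = m} := fun n m =>
    (Nat.measurable_floor.comp (κ.measurable_coe (hD' n)).ennreal_toReal)
      (measurableSet_singleton m)
  have hsum : κ = Kernel.sum fun n => Kernel.sum fun m : ℕ =>
      Kernel.piecewise (hlevel n m) (κ.restrict (hD' n)) 0 := by
    refine Kernel.ext fun a => ?_
    ext B hB
    rw [Kernel.sum_apply' _ _ hB]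
    have : ∀ n, (Kernel.sum fun m : ℕ =>
        Kernel.piecewise (hlevel n m) (κ.restrict (hD' n)) 0) a B = κ a (B ∩ disjointed D n) := by
      intro n
      rw [Kernel.sum_apply' _ _ hB, tsum_eq_single ⌊(κ a (disjointed D n)).toReal⌋₊]
      · rw [Kernel.piecewise_apply, if_pos (by rfl), Kernel.restrict_apply' _ _ _ hB]
      · intro m hm
        rw [Kernel.piecewise_apply, if_neg (fun h => hm h.symm)]
        rfl
    simp_rw [this]
    rw [← measure_iUnion (fun i j hij => (disjoint_disjointed D hij).mono inter_subset_right
      inter_subset_right) (fun n => hB.inter (hD' n)), ← inter_iUnion, iUnion_disjointed, hU,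
      inter_univ]
  rw [hsum]
  have : ∀ n m, IsFiniteKernel (Kernel.piecewise (hlevel n m) (κ.restrict (hD' n)) 0) := by
    intro n m
    refine ⟨⟨m + 1, by simp [ENNReal.add_lt_top], fun a => ?_⟩⟩
    rw [Kernel.piecewise_apply]
    split_ifs with h
    · rw [Kernel.restrict_apply' _ _ _ MeasurableSet.univ, univ_inter,
        ← ENNReal.ofReal_toReal (hκ' a n).ne]
      have h1 := (Nat.lt_floor_add_one (κ a (disjointed D n)).toReal).le
      rw [show ⌊(κ a (disjointed D n)).toReal⌋₊ = m from h] at h1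
      exact (ENNReal.ofReal_le_ofReal h1).trans (by
        rw [ENNReal.ofReal_add (by positivity) (by positivity)]; simp)
    · simp
  infer_instance

theorem measurable_lintegral_of_finite_on {m : A → Measure X} (hm : Measurable m) {D : ℕ → Set X}
    (hD : ∀ n, MeasurableSet (D n)) (hU : ⋃ n, D n = univ) (hfin : ∀ a n, m a (D n) < ∞)
    {u : A → X → ℝ≥0∞} (hu : Measurable (fun p : A × X => u p.1 p.2)) :
    Measurable fun a => ∫⁻ x, u a x ∂(m a) := by
  let κ : Kernel A X := ⟨m, hm⟩
  have : IsSFiniteKernel κ := isSFiniteKernel_of_finite_on (κ := κ) hD hU hfin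
  exact Measurable.lintegral_kernel_prod_right (κ := κ) hu

theorem measurable_removePoint [MeasurableEq X] {m : A → Measure X} (hm : Measurable m)
    {D : ℕ → Set X} (hD : ∀ n, MeasurableSet (D n)) (hU : ⋃ n, D n = univ)
    (hfin : ∀ a n, m a (D n) < ∞) :
    Measurable fun p : A × X => (m p.1).removePoint p.2 := by
  refine Measure.measurable_of_measurable_coe _ fun B hB => ?_
  have hm' : Measurable fun p : A × X => m p.1 := hm.comp measurable_fst
  have key : ∀ C : Set ((A × X) × X), MeasurableSet C →
      Measurable fun p : A × X => m p.1 {y | (p, y) ∈ C} := by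
    intro C hC
    have := measurable_lintegral_of_finite_on hm' hD hU (fun p n => hfin p.1 n)
      (u := fun p y => C.indicator 1 (p, y)) (measurable_one.indicator hC)
    convert! this using 2 with p
    exact (lintegral_indicator_one (μ := m p.1) (measurable_prodMk_left (x := p) hC)).symm
  have h1 : Measurable fun p : A × X => m p.1 (B \ {p.2}) :=
    key {q | q.2 ∈ B ∧ q.2 ≠ q.1.2} ((measurable_snd hB).inter
      (measurableSet_eq_fun measurable_snd (measurable_snd.comp measurable_fst)).compl)
  have h2 : Measurable fun p : A × X => m p.1 {p.2} :=
    key {q | q.2 = q.1.2} (measurableSet_eq_fun measurable_snd (measurable_snd.comp measurable_fst))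
  have : (fun p : A × X => (m p.1).removePoint p.2 B) =
      fun p => m p.1 (B \ {p.2}) + (m p.1 {p.2} - 1) * B.indicator 1 p.2 := by
    ext p; exact removePoint_apply _ _ hB
  rw [this]
  exact h1.add ((h2.sub_const 1).mul ((measurable_one.indicator hB).comp measurable_snd))

end Kernels

namespace PointConfig

open Set

variable {A X : Type*} [MeasurableSpace A] [MeasurableSpace X]

theorem measurable_apply {B : Set X} (hB : MeasurableSet B) :
    Measurable fun ω : PointConfig X => ω.1 B :=
  (Measure.measurable_coe hB).comp measurable_subtype_coe

theorem measurable_iff {ω : A → PointConfig X} :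
    Measurable ω ↔ ∀ B, MeasurableSet B → Measurable fun a => (ω a).1 B :=
  ⟨fun h _ hB => (measurable_apply hB).comp h, fun h =>
    (Measure.measurable_of_measurable_coe _ h).subtype_mk⟩

theorem addPoints_apply (ω : PointConfig X) {m : ℕ} (x : Fin m → X) {B : Set X}
    (hB : MeasurableSet B) :
    (ω.addPoints x).1 B = ω.1 B + ∑ i, B.indicator 1 (x i) := by
  simp [addPoints, Measure.dirac_apply' _ hB]

theorem restrict_apply (ω : PointConfig X) {S B : Set X} (hB : MeasurableSet B) :
    (ω.restrict S).1 B = ω.1 (B ∩ S) :=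
  Measure.restrict_apply hB

theorem measurable_restrict {S : Set X} (hS : MeasurableSet S) :
    Measurable fun ω : PointConfig X => ω.restrict S :=
  measurable_iff.2 fun B hB => by
    simp_rw [restrict_apply _ hB]
    exact measurable_apply (hB.inter hS)

theorem measurable_addPoints {m : ℕ} :
    Measurable fun p : (Fin m → X) × PointConfig X => p.2.addPoints p.1 :=
  measurable_iff.2 fun B hB => by
    simp_rw [addPoints_apply _ _ hB]
    refine ((measurable_apply hB).comp measurable_snd).add
      (Finset.measurable_sum _ fun i _ => (measurable_one.indicator hB).comp ?_)
    exact (measurable_pi_apply i).comp measurable_fst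

theorem _root_.Measurable.addPoints {m : ℕ} {x : A → Fin m → X} {ω : A → PointConfig X}
    (hω : Measurable ω) (hx : Measurable x) : Measurable fun a => (ω a).addPoints (x a) :=
  measurable_addPoints.comp (hx.prodMk hω)

theorem ext_measure {ω ω' : PointConfig X} (h : ∀ B, MeasurableSet B → ω.1 B = ω'.1 B) :
    ω = ω' :=
  Subtype.ext (Measure.ext h)

theorem addPoints_comm (ω : PointConfig X) {m n : ℕ} (x : Fin m → X) (z : Fin n → X) :
    (ω.addPoints x).addPoints z = (ω.addPoints z).addPoints x :=
  ext_measure fun B hB => by simp only [addPoints_apply _ _ hB]; exact add_right_comm _ _ _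

theorem addPoints_cons (ω : PointConfig X) {m : ℕ} (x : X) (z : Fin m → X) :
    ω.addPoints (Fin.cons x z : Fin (m + 1) → X) =
      (ω.addPoints (fun _ : Fin 1 => x)).addPoints z :=
  ext_measure fun B hB => by
    simp only [addPoints_apply _ _ hB, Fin.sum_univ_succ]
    simp [add_assoc]

theorem restrict_addPoints_of_mem (ω : PointConfig X) {m : ℕ} {x : Fin m → X} {S : Set X}
    (hS : MeasurableSet S) (hx : ∀ i, x i ∈ S) :
    (ω.addPoints x).restrict S = (ω.restrict S).addPoints x :=
  ext_measure fun B hB => by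
    rw [restrict_apply _ hB, addPoints_apply _ _ hB, addPoints_apply _ _ (hB.inter hS),
      restrict_apply _ hB]
    congr 1
    refine Finset.sum_congr rfl fun i _ => ?_
    by_cases h : x i ∈ B <;> simp [h, hx i]

theorem restrict_addPoints_of_notMem (ω : PointConfig X) {m : ℕ} {x : Fin m → X} {S : Set X}
    (hS : MeasurableSet S) (hx : ∀ i, x i ∉ S) :
    (ω.addPoints x).restrict S = ω.restrict S :=
  ext_measure fun B hB => by
    rw [restrict_apply _ hB, addPoints_apply _ _ (hB.inter hS), restrict_apply _ hB,
      Finset.sum_eq_zero, add_zero]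
    intro i _
    simp [hx i]

theorem restrict_restrict (ω : PointConfig X) {S T : Set X} (hS : MeasurableSet S) :
    (ω.restrict T).restrict S = ω.restrict (S ∩ T) :=
  Subtype.ext (Measure.restrict_restrict hS)

theorem addPoints_lt_top {ω : PointConfig X} {B : Set X} (hB : MeasurableSet B) (h : ω.1 B < ∞)
    {m : ℕ} (x : Fin m → X) : (ω.addPoints x).1 B < ∞ := by
  rw [addPoints_apply _ _ hB, ENNReal.add_lt_top]
  refine ⟨h, ENNReal.sum_lt_top.2 fun i _ => ?_⟩
  by_cases h : x i ∈ B <;> simp [h]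

theorem remove_addPoints [MeasurableSingletonClass X] (ω : PointConfig X) (x : X) :
    (ω.addPoints (fun _ : Fin 1 => x)).remove x = ω := by
  refine Subtype.ext ?_
  simp only [remove, addPoints, Finset.univ_unique, Finset.sum_singleton]
  exact removePoint_add_dirac_self _ _

instance : Zero (PointConfig X) := ⟨⟨0, inferInstance, isCountingMeasure_zero⟩⟩

open Classical in
/-- The configuration `ω` if it is finite on all the sets `D n`, and the empty one otherwise. Sums
over the points of `ω` depend measurably on `ω` only on the configurations of the first kind. -/
noncomputable def truncOn (D : ℕ → Set X) (ω : PointConfig X) : PointConfig X :=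
  if ∀ n, ω.1 (D n) < ∞ then ω else 0

theorem truncOn_lt_top (D : ℕ → Set X) (ω : PointConfig X) (n : ℕ) :
    (truncOn D ω).1 (D n) < ∞ := by
  rw [truncOn]
  split_ifs with h
  · exact h n
  · exact (measure_empty (μ := (0 : Measure X))).trans_lt (by simp : (0 : ℝ≥0∞) < ∞) |>.trans_le'
      (by change (0 : Measure X) (D n) ≤ _; simp)

theorem truncOn_eq {D : ℕ → Set X} {ω : PointConfig X} (h : ∀ n, ω.1 (D n) < ∞) :
    truncOn D ω = ω := if_pos h

theorem measurable_truncOn {D : ℕ → Set X} (hD : ∀ n, MeasurableSet (D n)) :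
    Measurable (truncOn D) := by
  classical
  refine Measurable.ite ?_ measurable_id measurable_const
  rw [show {ω : PointConfig X | ∀ n, ω.1 (D n) < ∞} = ⋂ n, {ω | ω.1 (D n) < ∞} by ext; simp]
  exact MeasurableSet.iInter fun n => measurableSet_lt (measurable_apply (hD n)) measurable_const

end PointConfig

section MeasurableFactorialSum

open Set

variable {X : Type*} [MeasurableSpace X]
  [TopologicalSpace X] [SecondCountableTopology X] [T2Space X] [BorelSpace X]

theorem PointConfig.measurable_remove {A : Type*} [MeasurableSpace A] {ω : A → PointConfig X}
    (hω : Measurable ω) {D : ℕ → Set X} (hD : ∀ n, MeasurableSet (D n)) (hU : ⋃ n, D n = univ)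
    (hfin : ∀ a n, (ω a).1 (D n) < ∞) : Measurable fun p : A × X => (ω p.1).remove p.2 :=
  (measurable_removePoint (measurable_subtype_coe.comp hω) hD hU hfin).subtype_mk

theorem PointConfig.measurable_remove_comp {A : Type*} [MeasurableSpace A]
    {ω : A → PointConfig X} (hω : Measurable ω) {D : ℕ → Set X} (hD : ∀ n, MeasurableSet (D n))
    (hU : ⋃ n, D n = univ) (hfin : ∀ a n, (ω a).1 (D n) < ∞) {x : A → X} (hx : Measurable x) :
    Measurable fun a => (ω a).remove (x a) :=
  (PointConfig.measurable_remove hω hD hU hfin).comp (measurable_id.prodMk hx)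

end MeasurableFactorialSum

section

open Set

universe u v

/-- The induction removes the points of the tuple one at a time, with the removed point as an
additional parameter, so that the parameter space has to be at least in the universe of `X`. -/
theorem measurable_factorialSum_aux {X : Type u} [MeasurableSpace X]
    [TopologicalSpace X] [SecondCountableTopology X] [T2Space X] [BorelSpace X]
    {D : ℕ → Set X} (hD : ∀ n, MeasurableSet (D n)) (hU : ⋃ n, D n = univ) (k : ℕ) :
    ∀ {A : Type (max u v)} [MeasurableSpace A] {ω : A → PointConfig X}, Measurable ω →
      (∀ a n, (ω a).1 (D n) < ∞) → ∀ {w : A → (Fin k → X) → ℝ≥0∞},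
      Measurable (fun p : A × (Fin k → X) => w p.1 p.2) →
      Measurable fun a => factorialSum (w a) (ω a) := by
  induction k with
  | zero =>
    intro A _ ω hω hfin w hw
    simp_rw [factorialSum_zero]
    exact hw.comp (measurable_id.prodMk measurable_const)
  | succ k ih =>
    intro A _ ω hω hfin w hw
    simp_rw [factorialSum_succ]
    refine measurable_lintegral_of_finite_on (measurable_subtype_coe.comp hω) hD hU hfin ?_
    refine ih (A := A × X) (ω := fun p => (ω p.1).remove p.2)
      (w := fun p z => w p.1 (Fin.cons p.2 z))
      (PointConfig.measurable_remove hω hD hU hfin)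
      (fun p n => (removePoint_le _ _ _).trans_lt (hfin p.1 n)) ?_
    refine hw.comp ((measurable_fst.comp measurable_fst).prodMk ?_)
    refine measurable_pi_lambda _ fun i => ?_
    refine Fin.cases ?_ (fun i => ?_) i
    · exact measurable_snd.comp measurable_fst
    · exact (measurable_pi_apply i).comp measurable_snd

theorem measurable_factorialSum {X : Type u} [MeasurableSpace X]
    [TopologicalSpace X] [SecondCountableTopology X] [T2Space X] [BorelSpace X]
    {D : ℕ → Set X} (hD : ∀ n, MeasurableSet (D n)) (hU : ⋃ n, D n = univ) {k : ℕ}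
    {A : Type v} [MeasurableSpace A] {ω : A → PointConfig X} (hω : Measurable ω)
    (hfin : ∀ a n, (ω a).1 (D n) < ∞) {w : A → (Fin k → X) → ℝ≥0∞}
    (hw : Measurable (fun p : A × (Fin k → X) => w p.1 p.2)) :
    Measurable fun a => factorialSum (w a) (ω a) := by
  have := measurable_factorialSum_aux.{u, v} hD hU k (A := ULift.{u} A)
    (ω := fun a => ω a.down) (hω.comp measurable_down) (fun a n => hfin a.down n)
    (w := fun a => w a.down)
    (hw.comp ((measurable_down.comp measurable_fst).prodMk measurable_snd))
  exact this.comp measurable_up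

end

/-! ### The induced process -/

section InducedProcess

open Set

variable {X Y : Type*} [MeasurableSpace X] [MeasurableSpace Y] {k : ℕ}
  {f : (Fin k → X) → PointConfig X → Y} {g : (Fin k → X) → PointConfig X → ℝ≥0∞}

theorem lintegral_inducedProcess (ω : PointConfig X) {u : Y → ℝ≥0∞} (hu : Measurable u) :
    ∫⁻ y, u y ∂(inducedProcess f g ω) =
      ((k ! : ℕ) : ℝ≥0∞)⁻¹ * factorialSum (fun x => g x ω * u (f x ω)) ω := by
  rw [inducedProcess, lintegral_smul_measure, lintegral_sum_measure, factorialSum, smul_eq_mul]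
  congr 1
  refine tsum_congr fun t => ?_
  rw [lintegral_smul_measure, lintegral_dirac' _ hu, smul_eq_mul]

theorem inducedProcess_apply (ω : PointConfig X) {B : Set Y} (hB : MeasurableSet B) :
    inducedProcess f g ω B =
      ((k ! : ℕ) : ℝ≥0∞)⁻¹ * factorialSum (fun x => g x ω * B.indicator 1 (f x ω)) ω := by
  rw [← lintegral_indicator_one hB, lintegral_inducedProcess ω (measurable_one.indicator hB)]

theorem inducedProcess_univ (ω : PointConfig X) :
    inducedProcess f g ω univ = ((k ! : ℕ) : ℝ≥0∞)⁻¹ * factorialSum (fun x => g x ω) ω := by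
  simp [inducedProcess_apply ω MeasurableSet.univ]

variable [TopologicalSpace X] [SecondCountableTopology X] [T2Space X] [BorelSpace X]

/-- Local finiteness on a common exhaustion is what makes the sums over tuples measurable. -/
theorem measurable_inducedProcess
    (hf : Measurable (fun p : (Fin k → X) × PointConfig X => f p.1 p.2))
    (hg : Measurable (fun p : (Fin k → X) × PointConfig X => g p.1 p.2))
    {D : ℕ → Set X} (hD : ∀ n, MeasurableSet (D n)) (hU : ⋃ n, D n = univ)
    {A : Type*} [MeasurableSpace A] {ω : A → PointConfig X} (hω : Measurable ω)
    (hfin : ∀ a n, (ω a).1 (D n) < ∞) : Measurable fun a => inducedProcess f g (ω a) := by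
  refine Measure.measurable_of_measurable_coe _ fun B hB => ?_
  simp_rw [inducedProcess_apply _ hB]
  refine (measurable_factorialSum hD hU hω hfin ?_).const_mul _
  have h : Measurable fun p : A × (Fin k → X) => (p.2, ω p.1) :=
    measurable_snd.prodMk (hω.comp measurable_fst)
  exact (hg.comp h).mul ((measurable_one.indicator hB).comp (hf.comp h))

end InducedProcess

/-! ### Cylinder events of configurations -/

section Cylinders

open Set

variable {X : Type*} [MeasurableSpace X]

/-- The numbers of points of `ω` in the cells of the partition of the space given by `c`. -/
def cellCounts {m : ℕ} (c : X → Fin m) (ω : PointConfig X) : Fin m → ℝ≥0∞ :=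
  fun j => ω.1 (c ⁻¹' {j})

theorem measurable_cellCounts {m : ℕ} {c : X → Fin m} (hc : Measurable c) :
    Measurable (cellCounts c) :=
  measurable_pi_lambda _ fun j => PointConfig.measurable_apply (hc (measurableSet_singleton j))

/-- The events that depend on the numbers of points in the cells of a finite measurable
partition. -/
def configCylinders (X : Type*) [MeasurableSpace X] : Set (Set (PointConfig X)) :=
  {E | ∃ (m : ℕ) (c : X → Fin m), Measurable c ∧ ∃ A : Set (Fin m → ℝ≥0∞), MeasurableSet A ∧
    E = cellCounts c ⁻¹' A}

/-- Two finite partitions have a common refinement, whose cell counts determine those of both; the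
cells of the refinement are sorted by the cells of `d` that contain them. -/
theorem exists_common_refinement {m n : ℕ} {c : X → Fin m} {d : X → Fin n} (hc : Measurable c)
    (hd : Measurable d) : ∃ (l : ℕ) (e : X → Fin l), Measurable e ∧
      (∃ p : (Fin l → ℝ≥0∞) → Fin m → ℝ≥0∞, Measurable p ∧
        ∀ ω, cellCounts c ω = p (cellCounts e ω)) ∧
      (∃ q : (Fin l → ℝ≥0∞) → Fin n → ℝ≥0∞, Measurable q ∧
        ∀ ω, cellCounts d ω = q (cellCounts e ω)) ∧ ∃ r : Fin l → Fin n, d = r ∘ e := by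
  have he : Measurable fun x => finProdFinEquiv (c x, d x) :=
    (measurable_of_countable finProdFinEquiv).comp (hc.prodMk hd)
  refine ⟨m * n, fun x => finProdFinEquiv (c x, d x), he,
    ⟨fun v j => ∑ i, v (finProdFinEquiv (j, i)), ?_, fun ω => ?_⟩,
    ⟨fun v i => ∑ j, v (finProdFinEquiv (j, i)), ?_, fun ω => ?_⟩,
    fun l => (finProdFinEquiv.symm l).2, funext fun x => by
      simp only [Function.comp, Equiv.symm_apply_apply]⟩
  · exact measurable_pi_lambda _ fun j => Finset.measurable_sum _ fun i _ => measurable_pi_apply _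
  · ext j
    simp only [cellCounts]
    rw [← tsum_fintype (L := .unconditional _), ← measure_iUnion]
    · congr 1
      ext x
      simp
    · intro a b hab
      refine disjoint_left.2 fun x hx hx' => hab ?_
      simp only [mem_preimage, mem_singleton_iff, EmbeddingLike.apply_eq_iff_eq,
        Prod.mk.injEq] at hx hx'
      rw [← hx.2, ← hx'.2]
    · exact fun i => he (measurableSet_singleton _)
  · exact measurable_pi_lambda _ fun j => Finset.measurable_sum _ fun i _ => measurable_pi_apply _
  · ext j
    simp only [cellCounts]
    rw [← tsum_fintype (L := .unconditional _), ← measure_iUnion]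
    · congr 1
      ext x
      simp
    · intro a b hab
      refine disjoint_left.2 fun x hx hx' => hab ?_
      simp only [mem_preimage, mem_singleton_iff, EmbeddingLike.apply_eq_iff_eq,
        Prod.mk.injEq] at hx hx'
      rw [← hx.1, ← hx'.1]
    · exact fun i => he (measurableSet_singleton _)

theorem isPiSystem_configCylinders : IsPiSystem (configCylinders X) := by
  rintro _ ⟨m, c, hc, A, hA, rfl⟩ _ ⟨n, d, hd, B, hB, rfl⟩ -
  obtain ⟨l, e, he, ⟨p, hp, hpc⟩, ⟨q, hq, hqd⟩, -⟩ := exists_common_refinement hc hd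
  refine ⟨l, e, he, p ⁻¹' A ∩ q ⁻¹' B, (hp hA).inter (hq hB), ?_⟩
  ext ω
  simp [hpc, hqd]

theorem measurableSet_of_mem_configCylinders {E : Set (PointConfig X)}
    (hE : E ∈ configCylinders X) : MeasurableSet E := by
  obtain ⟨m, c, hc, A, hA, rfl⟩ := hE
  exact measurable_cellCounts hc hA

theorem exists_fin_two_indicator {B : Set X} (hB : MeasurableSet B) :
    ∃ c : X → Fin 2, Measurable c ∧ c ⁻¹' {1} = B := by
  classical
  refine ⟨fun x => if x ∈ B then 1 else 0,
    Measurable.ite hB measurable_const measurable_const, ?_⟩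
  ext x
  by_cases h : x ∈ B <;> simp [h]

theorem generateFrom_configCylinders :
    (Subtype.instMeasurableSpace : MeasurableSpace (PointConfig X)) =
      MeasurableSpace.generateFrom (configCylinders X) := by
  apply le_antisymm
  · have : @Measurable _ _ (MeasurableSpace.generateFrom (configCylinders X)) _
        (id : PointConfig X → PointConfig X) := by
      refine (@PointConfig.measurable_iff (PointConfig X) X
        (MeasurableSpace.generateFrom (configCylinders X)) _ id).2 fun B hB A hA => ?_
      obtain ⟨c, hc, rfl⟩ := exists_fin_two_indicator hB
      exact MeasurableSpace.measurableSet_generateFrom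
        ⟨2, c, hc, (fun v => v 1) ⁻¹' A, measurable_pi_apply _ hA, rfl⟩
    intro s hs
    exact this hs
  · exact MeasurableSpace.generateFrom_le fun E hE => measurableSet_of_mem_configCylinders hE

end Cylinders

/-! ### Poisson processes: independence and the Mecke equation -/

section Poisson

open Set

/-- The size-biasing identity `𝔼[N ψ(N)] = r 𝔼[ψ(N + 1)]` of the Poisson distribution. -/
theorem lintegral_poissonMeasure_natCast_mul (r : ℝ≥0) (ψ : ℕ → ℝ≥0∞) :
    ∫⁻ n, (n : ℝ≥0∞) * ψ n ∂(poissonMeasure r) = r * ∫⁻ n, ψ (n + 1) ∂(poissonMeasure r) := by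
  rw [lintegral_countable', lintegral_countable', tsum_eq_zero_add' ENNReal.summable,
    ← ENNReal.tsum_mul_left]
  simp only [Nat.cast_zero, zero_mul, zero_add]
  refine tsum_congr fun n => ?_
  rw [poissonMeasure_singleton, poissonMeasure_singleton, mul_comm _ (ψ (n + 1)), mul_assoc,
    mul_left_comm (r : ℝ≥0∞)]
  congr 1
  rw [← ENNReal.ofReal_natCast, ← ENNReal.ofReal_coe_nnreal,
    ← ENNReal.ofReal_mul (by positivity), ← ENNReal.ofReal_mul (by positivity)]
  congr 1
  rw [Nat.factorial_succ]
  push_cast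
  field_simp
  ring

variable {Ω X : Type*} [MeasurableSpace Ω] [MeasurableSpace X] {P : Measure Ω}
  [IsProbabilityMeasure P] {η : Ω → PointConfig X} {K : Measure X}

theorem IsPoissonProcess.measurable_apply (hη : IsPoissonProcess P η K) {B : Set X}
    (hB : MeasurableSet B) : Measurable fun w => (η w).1 B :=
  (PointConfig.measurable_apply hB).comp hη.measurable

/-- The probabilities of the values `n : ℕ` already sum to one, so that no mass is left for other
values. -/
theorem IsPoissonProcess.map_apply (hη : IsPoissonProcess P η K) {B : Set X}
    (hB : MeasurableSet B) (hKB : K B ≠ ∞) :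
    P.map (fun w => (η w).1 B) =
      (poissonMeasure (K B).toNNReal).map (Nat.cast : ℕ → ℝ≥0∞) := by
  have hN := hη.measurable_apply hB
  have hatom : ∀ n : ℕ, (P.map fun w => (η w).1 B) {(n : ℝ≥0∞)} =
      poissonMeasure (K B).toNNReal {n} := fun n => by
    rw [Measure.map_apply hN (measurableSet_singleton _)]
    exact hη.law B hB hKB n
  have hle : ∀ A : Set ℝ≥0∞, MeasurableSet A →
      (poissonMeasure (K B).toNNReal).map (Nat.cast : ℕ → ℝ≥0∞) A ≤
        (P.map fun w => (η w).1 B) A := by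
    intro A hA
    rw [Measure.map_apply (measurable_of_countable _) hA]
    have h1 : (Nat.cast ⁻¹' A : Set ℕ) = ⋃ n ∈ (Nat.cast ⁻¹' A : Set ℕ), {n} := by ext n; simp
    have h2 : (⋃ n ∈ (Nat.cast ⁻¹' A : Set ℕ), {(n : ℝ≥0∞)}) ⊆ A := by
      simp only [iUnion_subset_iff, singleton_subset_iff]
      exact fun n hn => hn
    refine le_trans (le_of_eq ?_) (measure_mono h2)
    conv_lhs => rw [h1]
    rw [measure_biUnion (to_countable _) (fun i _ j _ hij => by simpa using hij)
      (fun n _ => measurableSet_singleton n),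
      measure_biUnion (to_countable _) (fun i _ j _ hij => by simpa using hij)
      (fun n _ => measurableSet_singleton _)]
    exact tsum_congr fun n => (hatom n).symm
  have := Measure.isProbabilityMeasure_map (μ := P) hN.aemeasurable
  refine (Measure.eq_of_le_of_measure_univ_eq (Measure.le_iff.2 hle) ?_).symm
  simp

/-- The Mecke equation for a functional of the number of points in a single set. -/
theorem IsPoissonProcess.lintegral_mul (hη : IsPoissonProcess P η K) {B : Set X}
    (hB : MeasurableSet B) (hKB : K B ≠ ∞) {ψ : ℝ≥0∞ → ℝ≥0∞} (hψ : Measurable ψ) :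
    ∫⁻ w, (η w).1 B * ψ ((η w).1 B) ∂P = K B * ∫⁻ w, ψ ((η w).1 B + 1) ∂P := by
  have hN := hη.measurable_apply hB
  have h1 : ∀ u : ℝ≥0∞ → ℝ≥0∞, Measurable u → ∫⁻ w, u ((η w).1 B) ∂P =
      ∫⁻ n : ℕ, u n ∂(poissonMeasure (K B).toNNReal) := fun u hu => by
    rw [← lintegral_map hu hN, hη.map_apply hB hKB, lintegral_map hu (measurable_of_countable _)]
  rw [h1 (fun x => x * ψ x) (measurable_id.mul hψ),
    h1 (fun x => ψ (x + 1)) (hψ.comp (measurable_id.add_const 1)),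
    lintegral_poissonMeasure_natCast_mul _ (fun n => ψ n), ENNReal.coe_toNNReal hKB]
  simp

theorem IsPoissonProcess.lintegral_apply (hη : IsPoissonProcess P η K) {B : Set X}
    (hB : MeasurableSet B) (hKB : K B ≠ ∞) : ∫⁻ w, (η w).1 B ∂P = K B := by
  simpa using hη.lintegral_mul hB hKB (measurable_const (a := (1 : ℝ≥0∞)))

theorem IsPoissonProcess.ae_lt_top (hη : IsPoissonProcess P η K) {B : Set X}
    (hB : MeasurableSet B) (hKB : K B ≠ ∞) : ∀ᵐ w ∂P, (η w).1 B < ∞ :=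
  MeasureTheory.ae_lt_top (hη.measurable_apply hB) (by rwa [hη.lintegral_apply hB hKB])

theorem IsPoissonProcess.iIndepFun_apply (hη : IsPoissonProcess P η K) {ι : Type*} [Fintype ι]
    {B : ι → Set X} (hB : ∀ i, MeasurableSet (B i))
    (hd : Pairwise fun i j => Disjoint (B i) (B j)) :
    iIndepFun (fun i w => (η w).1 (B i)) P := by
  have e := Fintype.equivFin ι
  have := hη.indep _ (fun j => B (e.symm j)) (fun j => hB _)
    (fun i j hij => hd (by simpa using hij))
  have h2 := this.precomp e.injective
  simpa using h2

/-- The Mecke equation for a functional of the numbers of points in the cells of a partition; both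
sides define product measures. -/
theorem IsPoissonProcess.lintegral_cellCounts (hη : IsPoissonProcess P η K) {m : ℕ}
    {c : X → Fin m} (hc : Measurable c) (i : Fin m) (hK : K (c ⁻¹' {i}) ≠ ∞)
    {A : Set (Fin m → ℝ≥0∞)} (hA : MeasurableSet A) :
    ∫⁻ w, (η w).1 (c ⁻¹' {i}) * A.indicator 1 (cellCounts c (η w)) ∂P =
      K (c ⁻¹' {i}) * ∫⁻ w, A.indicator 1 (cellCounts c (η w) + Pi.single i 1) ∂P := by
  classical
  have hcell : ∀ j, MeasurableSet (c ⁻¹' {j}) := fun j => hc (measurableSet_singleton j)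
  have hN : Measurable fun w => cellCounts c (η w) := (measurable_cellCounts hc).comp hη.measurable
  have hi : Measurable fun w => (η w).1 (c ⁻¹' {i}) := hη.measurable_apply (hcell i)
  let ν₁ : Measure (Fin m → ℝ≥0∞) :=
    (P.withDensity fun w => (η w).1 (c ⁻¹' {i})).map fun w => cellCounts c (η w)
  let ν₂ : Measure (Fin m → ℝ≥0∞) :=
    K (c ⁻¹' {i}) • P.map fun w => cellCounts c (η w) + Pi.single i 1
  have hN2 : Measurable fun w => cellCounts c (η w) + Pi.single i 1 := hN.add_const _
  have e₁ : ∀ A, MeasurableSet A → ν₁ A =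
      ∫⁻ w, (η w).1 (c ⁻¹' {i}) * A.indicator 1 (cellCounts c (η w)) ∂P := fun A hA => by
    rw [Measure.map_apply hN hA, withDensity_apply _ (hN hA), ← lintegral_indicator (hN hA)]
    refine lintegral_congr fun w => ?_
    by_cases h : cellCounts c (η w) ∈ A <;> simp [h]
  have e₂ : ∀ A, MeasurableSet A → ν₂ A =
      K (c ⁻¹' {i}) * ∫⁻ w, A.indicator 1 (cellCounts c (η w) + Pi.single i 1) ∂P :=
    fun A hA => by
    rw [Measure.smul_apply, Measure.map_apply hN2 hA, smul_eq_mul,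
      ← lintegral_indicator_one (hN2 hA)]
    rfl
  rw [← e₁ A hA, ← e₂ A hA]
  congr 1
  -- it suffices to compare the two measures on rectangles
  have hrect : ∀ s : Fin m → Set ℝ≥0∞, (∀ j, MeasurableSet (s j)) →
      ν₁ (univ.pi s) = ν₂ (univ.pi s) := by
    intro s hs
    rw [e₁ _ (MeasurableSet.univ_pi hs), e₂ _ (MeasurableSet.univ_pi hs)]
    have hind := hη.iIndepFun_apply (B := fun j => c ⁻¹' {j}) hcell fun a b hab =>
      Disjoint.preimage _ (by simpa using hab)
    have hpi : ∀ v : Fin m → ℝ≥0∞, (univ.pi s).indicator (1 : (Fin m → ℝ≥0∞) → ℝ≥0∞) v =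
        ∏ j, (s j).indicator 1 (v j) := by
      intro v
      by_cases hv : ∀ j, v j ∈ s j
      · rw [indicator_of_mem (by simpa using hv), Finset.prod_eq_one (fun j _ => by simp [hv j])]
        rfl
      · rw [indicator_of_notMem (by simpa using hv)]
        push Not at hv
        obtain ⟨j, hj⟩ := hv
        exact (Finset.prod_eq_zero (Finset.mem_univ j) (by simp [hj])).symm
    have hone : ∀ j, Measurable ((s j).indicator (1 : ℝ≥0∞ → ℝ≥0∞)) :=
      fun j => measurable_one.indicator (hs j)
    -- the number of points in the cell `i` is independent of the numbers in the other cells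
    have key : ∀ F : ℝ≥0∞ → ℝ≥0∞, Measurable F →
        ∫⁻ w, F ((η w).1 (c ⁻¹' {i})) *
          ∏ j ∈ Finset.univ.erase i, (s j).indicator 1 ((η w).1 (c ⁻¹' {j})) ∂P =
        (∫⁻ w, F ((η w).1 (c ⁻¹' {i})) ∂P) *
          ∏ j ∈ Finset.univ.erase i, ∫⁻ w, (s j).indicator 1 ((η w).1 (c ⁻¹' {j})) ∂P := by
      intro F hF
      let G : Fin m → ℝ≥0∞ → ℝ≥0∞ := Function.update (fun j => (s j).indicator 1) i F
      have hG : ∀ j, Measurable (G j) := fun j => by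
        by_cases h : j = i
        · subst h; simpa [G] using hF
        · simpa [G, h] using hone j
      have h1 := lintegral_prod_eq_prod_lintegral_of_indepFun Finset.univ
        (fun j w => G j ((η w).1 (c ⁻¹' {j}))) (hind.comp G hG)
        (fun j => (hG j).comp (hη.measurable_apply (hcell j)))
      have hGi : G i = F := by simp [G]
      have hGj : ∀ j ∈ Finset.univ.erase i, G j = (s j).indicator 1 := fun j hj => by
        simp [G, Finset.ne_of_mem_erase hj]
      rw [← Finset.mul_prod_erase _ _ (Finset.mem_univ i), hGi,
        Finset.prod_congr rfl (fun j hj => by rw [hGj j hj])] at h1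
      rw [← h1]
      refine lintegral_congr fun w => ?_
      rw [← Finset.mul_prod_erase _ _ (Finset.mem_univ i), hGi]
      exact congrArg _ (Finset.prod_congr rfl fun j hj => by rw [hGj j hj])
    have h1 := key (fun x => x * (s i).indicator 1 x) (measurable_id.mul (hone i))
    have h2 := key (fun x => (s i).indicator 1 (x + 1)) ((hone i).comp (measurable_id.add_const 1))
    have h3 : ∀ w, (η w).1 (c ⁻¹' {i}) * (univ.pi s).indicator 1 (cellCounts c (η w)) =
        (η w).1 (c ⁻¹' {i}) * (s i).indicator 1 ((η w).1 (c ⁻¹' {i})) *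
          ∏ j ∈ Finset.univ.erase i, (s j).indicator 1 ((η w).1 (c ⁻¹' {j})) := fun w => by
      rw [hpi, ← Finset.mul_prod_erase _ _ (Finset.mem_univ i), ← mul_assoc]; rfl
    have h4 : ∀ w, (univ.pi s).indicator 1 (cellCounts c (η w) + Pi.single i 1) =
        (s i).indicator 1 ((η w).1 (c ⁻¹' {i}) + 1) *
          ∏ j ∈ Finset.univ.erase i, (s j).indicator 1 ((η w).1 (c ⁻¹' {j})) := fun w => by
      rw [hpi, ← Finset.mul_prod_erase _ _ (Finset.mem_univ i)]
      refine congrArg₂ _ (by simp [cellCounts]) (Finset.prod_congr rfl fun j hj => ?_)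
      simp [cellCounts, Finset.ne_of_mem_erase hj]
    simp_rw [h3, h4]
    rw [h1, h2, hη.lintegral_mul (hcell i) hK (hone i), mul_assoc]
  have huniv : ν₁ univ = ν₂ univ := by simpa using hrect (fun _ => univ) (fun _ => .univ)
  have : IsFiniteMeasure ν₂ := ⟨by
    rw [e₂ _ MeasurableSet.univ]
    simpa using hK.lt_top⟩
  have : IsFiniteMeasure ν₁ := ⟨by rw [huniv]; exact measure_lt_top _ _⟩
  refine MeasureTheory.ext_of_generate_finite _ generateFrom_pi.symm isPiSystem_pi ?_ huniv
  rintro _ ⟨s, hs, rfl⟩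
  exact hrect s fun j => hs j trivial

end Poisson

section Mecke

open Set

variable {Ω X : Type*} [MeasurableSpace Ω] [MeasurableSpace X] {P : Measure Ω}
  [IsProbabilityMeasure P] {η : Ω → PointConfig X} {K : Measure X}

/-- The Mecke equation for a set and a cylinder event: refine the partition until the set is a union
of cells, and add the equations of these cells. -/
theorem IsPoissonProcess.lintegral_cylinder (hη : IsPoissonProcess P η K) {B : Set X}
    (hB : MeasurableSet B) (hK : K B ≠ ∞) {E : Set (PointConfig X)} (hE : E ∈ configCylinders X) :
    ∫⁻ w, (η w).1 B * E.indicator 1 (η w) ∂P =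
      ∫⁻ x in B, ∫⁻ w, E.indicator 1 ((η w).addPoints fun _ : Fin 1 => x) ∂P ∂K := by
  obtain ⟨m, c, hc, A, hA, rfl⟩ := hE
  obtain ⟨d, hd, rfl⟩ := exists_fin_two_indicator hB
  obtain ⟨l, e, he, ⟨p, hp, hpc⟩, -, r, rfl⟩ := exists_common_refinement hc hd
  have hcell : ∀ j, MeasurableSet (e ⁻¹' {j}) := fun j => he (measurableSet_singleton j)
  have hunion : r ∘ e ⁻¹' {1} = ⋃ j ∈ Finset.univ.filter (fun j => r j = 1), e ⁻¹' {j} := by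
    ext x; simp
  have hdisj : (↑(Finset.univ.filter fun j => r j = 1) : Set (Fin l)).PairwiseDisjoint
      fun j => e ⁻¹' {j} := fun a _ b _ hab => Disjoint.preimage _ (by simpa using hab)
  have hmeas : ∀ ω : PointConfig X, ω.1 (r ∘ e ⁻¹' {1}) =
      ∑ j ∈ Finset.univ.filter (fun j => r j = 1), ω.1 (e ⁻¹' {j}) := fun ω => by
    rw [hunion, measure_biUnion_finset hdisj fun j _ => hcell j]
  have hA' : MeasurableSet (p ⁻¹' A) := hp hA
  have hind : ∀ ω, (cellCounts c ⁻¹' A).indicator (1 : PointConfig X → ℝ≥0∞) ω =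
      (p ⁻¹' A).indicator 1 (cellCounts e ω) := fun ω => by
    change A.indicator 1 (cellCounts c ω) = _
    rw [hpc]; rfl
  have hηe : Measurable fun w => cellCounts e (η w) := (measurable_cellCounts he).comp hη.measurable
  simp_rw [hmeas, Finset.sum_mul, hind]
  have hsum : ∀ j, Measurable fun w =>
      (η w).1 (e ⁻¹' {j}) * (p ⁻¹' A).indicator 1 (cellCounts e (η w)) := fun j =>
    (hη.measurable_apply (hcell j)).mul ((measurable_one.indicator hA').comp hηe)
  rw [lintegral_finsetSum _ fun j _ => hsum j, hunion,
    lintegral_biUnion_finset hdisj fun j _ => hcell j]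
  refine Finset.sum_congr rfl fun j hj => ?_
  have hKj : K (e ⁻¹' {j}) ≠ ∞ := ne_top_of_le_ne_top hK (measure_mono fun x hx => by
    simp only [mem_preimage, mem_singleton_iff, Function.comp] at hx ⊢
    simpa [hx] using hj)
  rw [hη.lintegral_cellCounts he j hKj hA', mul_comm, ← setLIntegral_const]
  refine setLIntegral_congr_fun (hcell j) fun x hx => lintegral_congr fun w => congrArg _ ?_
  ext i
  simp only [cellCounts, Pi.add_apply, PointConfig.addPoints_apply _ _ (hcell i),
    Finset.univ_unique, Finset.sum_singleton]
  congr 1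
  rw [mem_preimage, mem_singleton_iff] at hx
  by_cases hij : i = j
  · subst hij; simp [hx]
  · simp [hij, hx, Ne.symm hij]

variable [SigmaFinite K] {D : ℕ → Set X}

/-- The Mecke equation `𝔼 ∫ u(x, η) η(dx) = ∫ 𝔼 u(x, η + δ_x) K(dx)`. -/
theorem IsPoissonProcess.mecke (hη : IsPoissonProcess P η K)
    (hD : ∀ n, MeasurableSet (D n)) (hU : ⋃ n, D n = univ) (hKD : ∀ n, K (D n) ≠ ∞)
    (hfin : ∀ w n, (η w).1 (D n) < ∞) {u : X → PointConfig X → ℝ≥0∞}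
    (hu : Measurable fun p : X × PointConfig X => u p.1 p.2) :
    ∫⁻ w, ∫⁻ x, u x (η w) ∂(η w).1 ∂P =
      ∫⁻ x, ∫⁻ w, u x ((η w).addPoints fun _ : Fin 1 => x) ∂P ∂K := by
  let κ : Kernel Ω X := ⟨fun w => (η w).1, measurable_subtype_coe.comp hη.measurable⟩
  have : IsSFiniteKernel κ := isSFiniteKernel_of_finite_on (κ := κ) hD hU hfin
  have hφ₁ : Measurable fun p : Ω × X => (p.2, η p.1) :=
    measurable_snd.prodMk (hη.measurable.comp measurable_fst)
  have hφ₂ : Measurable fun p : X × Ω => (p.1, (η p.2).addPoints fun _ : Fin 1 => p.1) :=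
    measurable_fst.prodMk ((hη.measurable.comp measurable_snd).addPoints
      (measurable_pi_lambda _ fun _ => measurable_fst))
  -- the Campbell measures; they agree on products of a set and a cylinder event, hence everywhere
  let C₁ : Measure (X × PointConfig X) := (P ⊗ₘ κ).map fun p => (p.2, η p.1)
  let C₂ : Measure (X × PointConfig X) :=
    (K.prod P).map fun p => (p.1, (η p.2).addPoints fun _ : Fin 1 => p.1)
  have h₁ : ∀ v : X × PointConfig X → ℝ≥0∞, Measurable v →
      ∫⁻ q, v q ∂C₁ = ∫⁻ w, ∫⁻ x, v (x, η w) ∂(η w).1 ∂P := fun v hv => by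
    have hv' : Measurable fun p : Ω × X => v (p.2, η p.1) := hv.comp hφ₁
    rw [lintegral_map hv hφ₁, Measure.lintegral_compProd hv']; rfl
  have h₂ : ∀ v : X × PointConfig X → ℝ≥0∞, Measurable v →
      ∫⁻ q, v q ∂C₂ = ∫⁻ x, ∫⁻ w, v (x, (η w).addPoints fun _ : Fin 1 => x) ∂P ∂K :=
    fun v hv => by
    have hv' : Measurable fun p : X × Ω => v (p.1, (η p.2).addPoints fun _ : Fin 1 => p.1) :=
      hv.comp hφ₂
    rw [lintegral_map hv hφ₂, lintegral_prod _ hv'.aemeasurable]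
  suffices hC : C₁ = C₂ by rw [← h₁ _ hu, ← h₂ _ hu, hC]
  have e₁ : ∀ B E, MeasurableSet B → MeasurableSet E →
      C₁ (B ×ˢ E) = ∫⁻ w, (η w).1 B * E.indicator 1 (η w) ∂P := fun B E hB hE => by
    rw [← lintegral_indicator_one (hB.prod hE), h₁ _ (measurable_one.indicator (hB.prod hE))]
    refine lintegral_congr fun w => ?_
    have : ∀ x, (B ×ˢ E).indicator (1 : X × PointConfig X → ℝ≥0∞) (x, η w) =
        B.indicator 1 x * E.indicator 1 (η w) := fun x => by
      by_cases hx : x ∈ B <;> by_cases hw : η w ∈ E <;> simp [hx, hw]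
    simp_rw [this]
    rw [lintegral_mul_const _ (measurable_one.indicator hB), lintegral_indicator_one hB]
  have e₂ : ∀ B E, MeasurableSet B → MeasurableSet E → C₂ (B ×ˢ E) =
      ∫⁻ x in B, ∫⁻ w, E.indicator 1 ((η w).addPoints fun _ : Fin 1 => x) ∂P ∂K :=
    fun B E hB hE => by
    rw [← lintegral_indicator_one (hB.prod hE), h₂ _ (measurable_one.indicator (hB.prod hE)),
      ← lintegral_indicator hB]
    refine lintegral_congr fun x => ?_
    by_cases hx : x ∈ B
    · rw [indicator_of_mem hx]
      refine lintegral_congr fun w => ?_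
      by_cases hw : (η w).addPoints (fun _ : Fin 1 => x) ∈ E <;> simp [hx, hw]
    · rw [indicator_of_notMem hx]
      simp [hx]
  have hfinrect : ∀ B, MeasurableSet B → K B ≠ ∞ → C₂ (B ×ˢ univ) = K B := fun B hB hKB => by
    rw [e₂ B univ hB MeasurableSet.univ]
    simp
  have huniv : ∀ B, MeasurableSet B → K B ≠ ∞ → C₁ (B ×ˢ univ) = C₂ (B ×ˢ univ) :=
    fun B hB hKB => by
    rw [hfinrect B hB hKB, e₁ B univ hB MeasurableSet.univ]
    simpa using hη.lintegral_apply hB hKB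
  -- for fixed `B` of finite measure, both sides are finite measures in `E`
  have hrect : ∀ B E, MeasurableSet B → K B ≠ ∞ → MeasurableSet E →
      C₁ (B ×ˢ E) = C₂ (B ×ˢ E) := by
    intro B E hB hKB hE
    have hs : ∀ (C : Measure (X × PointConfig X)) (F : Set (PointConfig X)), MeasurableSet F →
        ((C.restrict (B ×ˢ univ)).map Prod.snd) F = C (B ×ˢ F) := fun C F hF => by
      rw [Measure.map_apply measurable_snd hF, Measure.restrict_apply (measurable_snd hF)]
      congr 1
      ext ⟨x, ω⟩
      simp [and_comm]
    rw [← hs C₁ E hE, ← hs C₂ E hE]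
    congr 1
    have : IsFiniteMeasure ((C₁.restrict (B ×ˢ univ)).map Prod.snd) :=
      ⟨by rw [hs _ _ MeasurableSet.univ, huniv B hB hKB, hfinrect B hB hKB]; exact hKB.lt_top⟩
    refine ext_of_generate_finite _ generateFrom_configCylinders isPiSystem_configCylinders
      (fun F hF => ?_) ?_
    · have hF' := measurableSet_of_mem_configCylinders hF
      rw [hs _ _ hF', hs _ _ hF', e₁ _ _ hB hF', e₂ _ _ hB hF', hη.lintegral_cylinder hB hKB hF]
    · rw [hs _ _ MeasurableSet.univ, hs _ _ MeasurableSet.univ, huniv B hB hKB]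
  refine Measure.ext_of_generateFrom_of_cover (T := range fun n => D n ×ˢ univ)
    generateFrom_prod.symm (countable_range _) isPiSystem_prod ?_ ?_ ?_ ?_
  · rw [sUnion_range, ← iUnion_prod_const, hU, univ_prod_univ]
  · rintro _ ⟨n, rfl⟩
    rw [huniv _ (hD n) (hKD n), hfinrect _ (hD n) (hKD n)]
    exact hKD n
  · rintro _ ⟨n, rfl⟩ _ ⟨B, hB, E, hE, rfl⟩
    rw [prod_inter_prod]
    exact hrect _ _ (MeasurableSet.inter (by exact hB) (hD n))
      (ne_top_of_le_ne_top (hKD n) (measure_mono inter_subset_right))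
      (MeasurableSet.inter (by exact hE) MeasurableSet.univ)
  · rintro _ ⟨n, rfl⟩
    exact huniv _ (hD n) (hKD n)

theorem lintegral_pi_succ (K : Measure X) [SigmaFinite K] {k : ℕ} {u : (Fin (k + 1) → X) → ℝ≥0∞}
    (hu : Measurable u) : ∫⁻ x, u x ∂(Measure.pi fun _ => K) =
      ∫⁻ x, ∫⁻ z : Fin k → X, u (Fin.cons x z) ∂(Measure.pi fun _ => K) ∂K := by
  have h := (measurePreserving_piFinSuccAbove (fun _ : Fin (k + 1) => K) 0).symm
  rw [← h.lintegral_comp_emb (MeasurableEquiv.measurableEmbedding _), lintegral_prod]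
  · refine lintegral_congr fun x => lintegral_congr fun z => congrArg u ?_
    simp [MeasurableEquiv.piFinSuccAbove, Fin.insertNthEquiv]
  · exact (hu.comp (MeasurableEquiv.measurable _)).aemeasurable

theorem Measurable.finCons {A : Type*} [MeasurableSpace A] {k : ℕ} {x : A → X}
    {z : A → Fin k → X} (hx : Measurable x) (hz : Measurable z) :
    Measurable fun a => (Fin.cons (x a) (z a) : Fin (k + 1) → X) := by
  refine measurable_pi_lambda _ fun i => ?_
  refine Fin.cases ?_ (fun i => ?_) i
  · exact hx
  · exact (measurable_pi_apply i).comp hz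

variable [TopologicalSpace X] [SecondCountableTopology X] [T2Space X] [BorelSpace X]

/-- The multivariate Mecke equation
`𝔼 ∑_{𝐱 ∈ η^k_≠} u(𝐱, η) = ∫ 𝔼 u(𝐱, η + δ_𝐱) K^k(d𝐱)`. -/
theorem IsPoissonProcess.mecke_multi (hη : IsPoissonProcess P η K)
    (hD : ∀ n, MeasurableSet (D n)) (hU : ⋃ n, D n = univ) (hKD : ∀ n, K (D n) ≠ ∞)
    (hfin : ∀ w n, (η w).1 (D n) < ∞) {k : ℕ} {u : (Fin k → X) → PointConfig X → ℝ≥0∞}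
    (hu : Measurable fun p : (Fin k → X) × PointConfig X => u p.1 p.2) :
    ∫⁻ w, factorialSum (fun x => u x (η w)) (η w) ∂P =
      ∫⁻ x, ∫⁻ w, u x ((η w).addPoints x) ∂P ∂(Measure.pi fun _ => K) := by
  induction k with
  | zero =>
    simp_rw [factorialSum_zero]
    rw [Measure.pi_of_empty (fun _ : Fin 0 => K) Fin.elim0,
      lintegral_dirac' _ (Measurable.lintegral_prod_right' (f := fun p : (Fin 0 → X) × Ω =>
        u p.1 ((η p.2).addPoints p.1)) (hu.comp (measurable_fst.prodMk
        ((hη.measurable.comp measurable_snd).addPoints measurable_fst))))]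
    refine lintegral_congr fun w => congrArg _ (PointConfig.ext_measure fun B hB => ?_)
    simp [PointConfig.addPoints_apply _ _ hB]
  | succ k ih =>
    -- `PointConfig.truncOn` makes the integrand measurable on the whole configuration space; it
    -- does not change the configurations `η w` and `η w + δ_x`
    have htr : Measurable fun p : X × PointConfig X => PointConfig.truncOn D p.2 :=
      (PointConfig.measurable_truncOn hD).comp measurable_snd
    have htrfin : ∀ (p : X × PointConfig X) n, (PointConfig.truncOn D p.2).1 (D n) < ∞ :=
      fun p n => PointConfig.truncOn_lt_top D p.2 n
    have hrem : Measurable fun p : X × PointConfig X => (PointConfig.truncOn D p.2).remove p.1 :=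
      PointConfig.measurable_remove_comp htr hD hU htrfin measurable_fst
    have hw : Measurable fun p : (X × PointConfig X) × (Fin k → X) =>
        u (Fin.cons p.1.1 p.2) (PointConfig.truncOn D p.1.2) := by
      have h : Measurable fun p : (X × PointConfig X) × (Fin k → X) =>
          ((Fin.cons p.1.1 p.2 : Fin (k + 1) → X), PointConfig.truncOn D p.1.2) :=
        ((measurable_fst.comp measurable_fst).finCons measurable_snd).prodMk
          (htr.comp measurable_fst)
      exact hu.comp h
    have h1 := hη.mecke hD hU hKD hfin
      (u := fun x ω => factorialSum
        (fun z : Fin k → X => u (Fin.cons x z) (PointConfig.truncOn D ω))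
        ((PointConfig.truncOn D ω).remove x))
      (measurable_factorialSum hD hU hrem
        (fun p n => (removePoint_le (PointConfig.truncOn D p.2).1 p.1 (D n)).trans_lt (htrfin p n))
        (w := fun p z => u (Fin.cons p.1 z) (PointConfig.truncOn D p.2)) hw)
    have htr' : ∀ w, PointConfig.truncOn D (η w) = η w := fun w => PointConfig.truncOn_eq (hfin w)
    have htr'' : ∀ w x, PointConfig.truncOn D ((η w).addPoints fun _ : Fin 1 => x) =
        (η w).addPoints fun _ : Fin 1 => x := fun w x =>
      PointConfig.truncOn_eq fun n => PointConfig.addPoints_lt_top (hD n) (hfin w n) _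
    simp_rw [htr', htr'', PointConfig.remove_addPoints] at h1
    simp_rw [factorialSum_succ]
    have hmeas : Measurable fun p : (Fin (k + 1) → X) × Ω => u p.1 ((η p.2).addPoints p.1) :=
      hu.comp (measurable_fst.prodMk ((hη.measurable.comp measurable_snd).addPoints measurable_fst))
    rw [h1, lintegral_pi_succ K hmeas.lintegral_prod_right']
    refine lintegral_congr fun x => ?_
    have hx : Measurable fun p : (Fin k → X) × PointConfig X =>
        ((Fin.cons x p.1 : Fin (k + 1) → X), p.2.addPoints fun _ : Fin 1 => x) :=
      (measurable_const.finCons measurable_fst).prodMk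
        (measurable_snd.addPoints measurable_const)
    rw [ih (u := fun z ω => u (Fin.cons x z) (ω.addPoints fun _ : Fin 1 => x)) (hu.comp hx)]
    refine lintegral_congr fun z => lintegral_congr fun w => ?_
    rw [PointConfig.addPoints_cons, PointConfig.addPoints_comm]

end Mecke

section Independence

open Set

variable {Ω X : Type*} [MeasurableSpace Ω] [MeasurableSpace X] {P : Measure Ω}
  [IsProbabilityMeasure P] {η : Ω → PointConfig X} {K : Measure X}

/-- The restrictions of a Poisson process to disjoint sets are independent. -/
theorem IsPoissonProcess.indepFun_restrict (hη : IsPoissonProcess P η K) {S T : Set X}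
    (hS : MeasurableSet S) (hT : MeasurableSet T) (hST : Disjoint S T) :
    IndepFun (fun w => (η w).restrict S) (fun w => (η w).restrict T) P := by
  have hmS : Measurable fun w => (η w).restrict S :=
    (PointConfig.measurable_restrict hS).comp hη.measurable
  have hmT : Measurable fun w => (η w).restrict T :=
    (PointConfig.measurable_restrict hT).comp hη.measurable
  rw [IndepFun_iff_Indep]
  refine IndepSets.indep hmS.comap_le hmT.comap_le
    (isPiSystem_configCylinders.comap fun w => (η w).restrict S)
    (isPiSystem_configCylinders.comap fun w => (η w).restrict T) ?_ ?_ ?_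
  · rw [generateFrom_configCylinders, MeasurableSpace.comap_generateFrom]; rfl
  · rw [generateFrom_configCylinders, MeasurableSpace.comap_generateFrom]; rfl
  rw [IndepSets_iff]
  rintro _ _ ⟨_, ⟨m, c, hc, A, hA, rfl⟩, rfl⟩ ⟨_, ⟨n, d, hd, B, hB, rfl⟩, rfl⟩
  -- the cells of the two partitions, cut off to `S` and to `T`, form one disjoint family
  have hcm : ∀ j, MeasurableSet (c ⁻¹' {j}) := fun j => hc (measurableSet_singleton j)
  have hdm : ∀ j, MeasurableSet (d ⁻¹' {j}) := fun j => hd (measurableSet_singleton j)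
  let C : Fin m ⊕ Fin n → Set X := Sum.elim (fun j => c ⁻¹' {j} ∩ S) fun j => d ⁻¹' {j} ∩ T
  have hCm : ∀ j, MeasurableSet (C j) := by
    rintro (j | j)
    · exact (hcm j).inter hS
    · exact (hdm j).inter hT
  have hCd : Pairwise fun i j => Disjoint (C i) (C j) := by
    rintro (i | i) (j | j) hij
    · exact (Disjoint.preimage c (by simpa using hij)).mono inter_subset_left inter_subset_left
    · exact hST.mono inter_subset_right inter_subset_right
    · exact hST.symm.mono inter_subset_right inter_subset_right
    · exact (Disjoint.preimage d (by simpa using hij)).mono inter_subset_left inter_subset_left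
  have hind := hη.iIndepFun_apply hCm hCd
  have h2 := hind.indepFun_finset (Finset.univ.map Function.Embedding.inl)
    (Finset.univ.map Function.Embedding.inr)
    (by rw [Finset.disjoint_left]; simp) fun i => hη.measurable_apply (hCm i)
  have hl : Measurable fun (v : ↥(Finset.univ.map Function.Embedding.inl :
      Finset (Fin m ⊕ Fin n)) → ℝ≥0∞) (j : Fin m) => v ⟨Sum.inl j, by simp⟩ :=
    measurable_pi_lambda _ fun j => measurable_pi_apply _
  have hr : Measurable fun (v : ↥(Finset.univ.map Function.Embedding.inr :
      Finset (Fin m ⊕ Fin n)) → ℝ≥0∞) (j : Fin n) => v ⟨Sum.inr j, by simp⟩ :=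
    measurable_pi_lambda _ fun j => measurable_pi_apply _
  have h3 := h2.comp hl hr
  have h4 := (IndepFun_iff_Indep _ _ _).1 h3
  rw [Indep_iff] at h4
  have hc' : ∀ w, cellCounts c ((η w).restrict S) = fun j => (η w).1 (C (Sum.inl j)) := fun w => by
    ext j; exact PointConfig.restrict_apply _ (hcm j)
  have hd' : ∀ w, cellCounts d ((η w).restrict T) = fun j => (η w).1 (C (Sum.inr j)) := fun w => by
    ext j; exact PointConfig.restrict_apply _ (hdm j)
  refine h4 _ _ ⟨A, hA, ?_⟩ ⟨B, hB, ?_⟩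
  · ext w; simp [hc']
  · ext w; simp [hd']

instance : Add (PointConfig X) := ⟨fun ω ω' => ⟨ω.1 + ω'.1, by
  have := ω.2.1
  have := ω'.2.1
  exact ⟨inferInstance, ω.2.2.add ω'.2.2⟩⟩⟩

theorem PointConfig.add_apply (ω ω' : PointConfig X) (B : Set X) :
    (ω + ω').1 B = ω.1 B + ω'.1 B := rfl

theorem PointConfig.measurable_add :
    Measurable fun p : PointConfig X × PointConfig X => p.1 + p.2 :=
  measurable_iff.2 fun _ hB => ((measurable_apply hB).comp measurable_fst).add
    ((measurable_apply hB).comp measurable_snd)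

theorem PointConfig.restrict_add_restrict_compl (ω : PointConfig X) {S : Set X}
    (hS : MeasurableSet S) : ω.restrict S + ω.restrict Sᶜ = ω :=
  ext_measure fun B hB => by
    rw [add_apply, restrict_apply _ hB, restrict_apply _ hB, ← sdiff_eq,
      measure_inter_add_sdiff B hS]

/-- If `η'` is an independent copy of `η`, then `(η' ∩ S, η)` and
`(η' ∩ S, (η ∩ S) + (η' ∩ Sᶜ))` have the same law. -/
theorem IsPoissonProcess.lintegral_resample (hη : IsPoissonProcess P η K) {S : Set X}
    (hS : MeasurableSet S) {u : PointConfig X → PointConfig X → ℝ≥0∞}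
    (hu : Measurable fun p : PointConfig X × PointConfig X => u p.1 p.2) :
    ∫⁻ w', ∫⁻ w, u ((η w').restrict S) (η w) ∂P ∂P =
      ∫⁻ w', ∫⁻ w, u ((η w').restrict S) ((η w).restrict S + (η w').restrict Sᶜ) ∂P ∂P := by
  have hmS : Measurable fun w => (η w).restrict S :=
    (PointConfig.measurable_restrict hS).comp hη.measurable
  have hmT : Measurable fun w => (η w).restrict Sᶜ :=
    (PointConfig.measurable_restrict hS.compl).comp hη.measurable
  set α := fun w => (η w).restrict S
  set β := fun w => (η w).restrict Sᶜ
  have hprod : P.map (fun w => (α w, β w)) = (P.map α).prod (P.map β) :=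
    (hη.indepFun_restrict hS hS.compl disjoint_compl_right).map_prod_eq_prod_map_map
      hmS.aemeasurable hmT.aemeasurable
  have hpα := Measure.isProbabilityMeasure_map (μ := P) hmS.aemeasurable
  have hpβ := Measure.isProbabilityMeasure_map (μ := P) hmT.aemeasurable
  have key : ∀ v : PointConfig X → PointConfig X → ℝ≥0∞,
      Measurable (fun p : PointConfig X × PointConfig X => v p.1 p.2) →
      ∫⁻ w, v (α w) (β w) ∂P = ∫⁻ a, ∫⁻ b, v a b ∂(P.map β) ∂(P.map α) := fun v hv => by
    rw [← lintegral_prod _ hv.aemeasurable, ← hprod, lintegral_map hv (hmS.prodMk hmT)]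
  have hadd := PointConfig.measurable_add (X := X)
  have hL : ∀ w', ∫⁻ w, u (α w') (η w) ∂P =
      ∫⁻ a, ∫⁻ b, u (α w') (a + b) ∂(P.map β) ∂(P.map α) := fun w' => by
    rw [← key (fun a b => u (α w') (a + b)) (hu.comp (measurable_const.prodMk hadd))]
    exact lintegral_congr fun w => by rw [PointConfig.restrict_add_restrict_compl _ hS]
  have h3 : Measurable fun q : (PointConfig X × PointConfig X) × PointConfig X =>
      u q.1.1 (q.1.2 + q.2) := hu.comp ((measurable_fst.comp measurable_fst).prodMk
        (hadd.comp ((measurable_snd.comp measurable_fst).prodMk measurable_snd)))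
  have hR : ∀ w', ∫⁻ w, u (α w') (α w + β w') ∂P =
      ∫⁻ a, u (α w') (a + β w') ∂(P.map α) := fun w' => by
    rw [lintegral_map (f := fun a => u (α w') (a + β w'))
      (hu.comp (measurable_const.prodMk (hadd.comp (measurable_id.prodMk measurable_const)))) hmS]
  rw [lintegral_congr hL, lintegral_congr hR, key (fun a' b' => ∫⁻ a, u a' (a + b') ∂(P.map α)),
    ← lintegral_map (f := fun a' => ∫⁻ a, ∫⁻ b, u a' (a + b) ∂(P.map β) ∂(P.map α)) _ hmS]
  · refine lintegral_congr fun a' => ?_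
    rw [lintegral_lintegral_swap]
    exact (h3.comp ((measurable_const.prodMk measurable_fst).prodMk measurable_snd)).aemeasurable
  · exact (h3.lintegral_prod_right').lintegral_prod_right'
  · exact Measurable.lintegral_prod_right' (f := fun q : (PointConfig X × PointConfig X) × _ =>
      u q.1.1 (q.2 + q.1.2)) (h3.comp (((measurable_fst.comp measurable_fst).prodMk
        measurable_snd).prodMk (measurable_snd.comp measurable_fst)))

end Independence

/-! ### Tuples versus subsets -/

section Subsets

open Set

variable {α : Type*} {k : ℕ}

/-- An enumeration of a `k`-element set, preceded by a permutation of the indices. -/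
noncomputable def permEnum (s : {s : Finset α // s.card = k}) (σ : Equiv.Perm (Fin k)) :
    Fin k ↪ α :=
  ⟨fun i => ((s.1.equivFinOfCardEq s.2).symm (σ i)).1, fun i j h => by
    simpa using Subtype.ext h⟩

theorem permEnum_apply (s : {s : Finset α // s.card = k}) (σ : Equiv.Perm (Fin k)) (i : Fin k) :
    permEnum s σ i = ((s.1.equivFinOfCardEq s.2).symm (σ i)).1 := rfl

theorem map_permEnum (s : {s : Finset α // s.card = k}) (σ : Equiv.Perm (Fin k)) :
    Finset.univ.map (permEnum s σ) = s.1 := by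
  ext a
  simp only [Finset.mem_map, Finset.mem_univ, true_and, permEnum_apply]
  constructor
  · rintro ⟨i, rfl⟩; exact Subtype.prop _
  · intro ha
    exact ⟨σ.symm (s.1.equivFinOfCardEq s.2 ⟨a, ha⟩), by simp⟩

theorem permEnum_bijective : Function.Bijective
    fun p : {s : Finset α // s.card = k} × Equiv.Perm (Fin k) => permEnum p.1 p.2 := by
  constructor
  · rintro ⟨s, σ⟩ ⟨s', σ'⟩ h
    have h1 : s = s' := Subtype.ext (by
      rw [← map_permEnum s σ, ← map_permEnum s' σ']; exact congrArg (fun t => Finset.univ.map t) h)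
    subst h1
    refine Prod.ext rfl (Equiv.ext fun i => ?_)
    have := congrArg (fun t : Fin k ↪ α => t i) h
    simpa only [permEnum_apply, SetLike.coe_eq_coe, EmbeddingLike.apply_eq_iff_eq] using this
  · intro t
    let s : {s : Finset α // s.card = k} := ⟨Finset.univ.map t, by simp⟩
    have ht : ∀ i, t i ∈ s.1 := fun i => by simp [s]
    let σ : Fin k → Fin k := fun i => s.1.equivFinOfCardEq s.2 ⟨t i, ht i⟩
    have hσ : Function.Injective σ := fun i j h => by simpa [σ] using h
    refine ⟨(s, Equiv.ofBijective σ (Finite.injective_iff_bijective.1 hσ)), ?_⟩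
    ext i
    simp only [permEnum_apply]
    simp [σ]

/-- A sum over injective tuples of a functional of the set of their entries. -/
theorem tsum_embedding_eq_factorial_mul (u : (Fin k ↪ α) → ℝ≥0∞) (U : Finset α → ℝ≥0∞)
    (h : ∀ t, u t = U (Finset.univ.map t)) :
    ∑' t, u t = ((k ! : ℕ) : ℝ≥0∞) * ∑' s : {s : Finset α // s.card = k}, U s := by
  rw [← (Equiv.ofBijective _ permEnum_bijective).tsum_eq u, ENNReal.tsum_prod',
    ← ENNReal.tsum_mul_left]
  refine tsum_congr fun s => ?_
  simp only [Equiv.ofBijective_apply, h, map_permEnum, ENNReal.tsum_const]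
  simp [Fintype.card_perm]

theorem exists_perm_of_map_eq {t t' : Fin k ↪ α}
    (h : Finset.univ.map t = Finset.univ.map t') : ∃ σ : Equiv.Perm (Fin k), ⇑t' = t ∘ σ := by
  obtain ⟨⟨s, σ⟩, rfl⟩ := permEnum_bijective.2 t
  obtain ⟨⟨s', σ'⟩, rfl⟩ := permEnum_bijective.2 t'
  have : s = s' := Subtype.ext (by simpa only [map_permEnum] using h)
  subst this
  refine ⟨σ'.trans σ.symm, ?_⟩
  ext i
  simp [permEnum_apply]

open Classical in
/-- The common value of a symmetric function at the enumerations of a set of labels (and `0` if the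
set does not have `k` elements). -/
noncomputable def setValue {X : Type*} (loc : α → X) (v : (Fin k → X) → ℝ≥0∞) (s : Finset α) :
    ℝ≥0∞ :=
  if h : s.card = k then v (loc ∘ permEnum ⟨s, h⟩ 1) else 0

theorem setValue_map {X : Type*} (loc : α → X) {v : (Fin k → X) → ℝ≥0∞}
    (hv : ∀ (σ : Equiv.Perm (Fin k)) x, v (x ∘ σ) = v x) (t : Fin k ↪ α) :
    v (loc ∘ t) = setValue loc v (Finset.univ.map t) := by
  rw [setValue, dif_pos (by simp)]
  obtain ⟨σ, hσ⟩ := exists_perm_of_map_eq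
    (t := permEnum (k := k) ⟨Finset.univ.map t, by simp⟩ 1) (t' := t) (map_permEnum _ _)
  rw [hσ, ← Function.comp_assoc, hv]

theorem tsum_embedding_symm {X : Type*} (loc : α → X) {v : (Fin k → X) → ℝ≥0∞}
    (hv : ∀ (σ : Equiv.Perm (Fin k)) x, v (x ∘ σ) = v x) :
    ∑' t : Fin k ↪ α, v (loc ∘ t) =
      ((k ! : ℕ) : ℝ≥0∞) * ∑' s : {s : Finset α // s.card = k}, setValue loc v s :=
  tsum_embedding_eq_factorial_mul _ _ fun t => setValue_map loc hv t

/-- A `k`-element set of labels from `β` or `Fin k` consists of a set `I` of labels from `Fin k` and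
`k - |I|` labels from `β`. -/
noncomputable def subsetSumEquiv (β : Type*) (k : ℕ) :
    {s : Finset (β ⊕ Fin k) // s.card = k} ≃
      Σ I : Finset (Fin k), {r : Finset β // r.card = k - I.card} where
  toFun s := ⟨s.1.toRight, s.1.toLeft, by
    have := Finset.card_toLeft_add_card_toRight (u := s.1); have := s.2; omega⟩
  invFun p := ⟨p.2.1.disjSum p.1, by
    have := p.2.2
    have h := Finset.card_le_univ p.1
    rw [Fintype.card_fin] at h
    rw [Finset.card_disjSum]; omega⟩
  left_inv s := Subtype.ext Finset.toLeft_disjSum_toRight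
  right_inv p := by
    obtain ⟨I, r, hr⟩ := p
    refine Sigma.ext (by simp) ?_
    simp only [Finset.toLeft_disjSum]
    congr 1 <;> simp

/-- The labels of the tuple `(𝐱_I, 𝐳)` when `𝐳` has the labels `t` and `𝐱` the labels `inr`. -/
noncomputable def mixEmbedding {β : Type*} (I : Finset (Fin k)) (t : Fin (k - I.card) ↪ β) :
    Fin k ↪ β ⊕ Fin k :=
  ⟨fun j => if h : (j : ℕ) < I.card then Sum.inr (I.orderEmbOfFin rfl ⟨j, h⟩)
    else Sum.inl (t ⟨(j : ℕ) - I.card, by omega⟩), fun i j h => by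
      dsimp only at h
      split_ifs at h with h1 h2 h2
      · simpa [Fin.ext_iff] using h
      · have := t.injective (Sum.inl_injective h)
        simp only [Fin.mk.injEq] at this
        exact Fin.ext (by omega)⟩

theorem mixEmbedding_apply {β : Type*} (I : Finset (Fin k)) (t : Fin (k - I.card) ↪ β)
    (j : Fin k) : mixEmbedding I t j = if h : (j : ℕ) < I.card then
      Sum.inr (I.orderEmbOfFin rfl ⟨j, h⟩) else Sum.inl (t ⟨(j : ℕ) - I.card, by omega⟩) := rfl

theorem comp_mixEmbedding {β X : Type*} (loc : β → X) (x : Fin k → X) (I : Finset (Fin k))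
    (t : Fin (k - I.card) ↪ β) :
    Sum.elim loc x ∘ mixEmbedding I t = mixTuple x I (loc ∘ t) := by
  ext j
  simp only [mixEmbedding_apply, mixTuple, Function.comp]
  split_ifs <;> rfl

theorem map_mixEmbedding {β : Type*} (I : Finset (Fin k)) (t : Fin (k - I.card) ↪ β) :
    Finset.univ.map (mixEmbedding I t) = (Finset.univ.map t).disjSum I := by
  refine Finset.eq_of_subset_of_card_le ?_ ?_
  · intro a ha
    obtain ⟨j, -, rfl⟩ := Finset.mem_map.1 ha
    rw [mixEmbedding_apply]
    split_ifs with h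
    · exact Finset.inr_mem_disjSum.2 (Finset.orderEmbOfFin_mem _ _ _)
    · exact Finset.inl_mem_disjSum.2 (by simp)
  · have h := Finset.card_le_univ I
    rw [Fintype.card_fin] at h
    simp [Finset.card_disjSum]; omega

/-- Splitting a sum over injective `k`-tuples, taken from a family containing `k` distinguished
labels, according to the set `I` of the distinguished labels that are used. -/
theorem tsum_embedding_sum {β X : Type*} (loc : β → X) (x : Fin k → X) {v : (Fin k → X) → ℝ≥0∞}
    (hv : ∀ (σ : Equiv.Perm (Fin k)) x, v (x ∘ σ) = v x) :
    ∑' t : Fin k ↪ β ⊕ Fin k, v (Sum.elim loc x ∘ t) =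
      ∑ I : Finset (Fin k), ((k ! : ℕ) : ℝ≥0∞) / ((k - I.card) ! : ℕ) *
        ∑' t : Fin (k - I.card) ↪ β, v (mixTuple x I (loc ∘ t)) := by
  rw [tsum_embedding_symm _ hv, ← (subsetSumEquiv β k).symm.tsum_eq, ENNReal.tsum_sigma',
    tsum_fintype, Finset.mul_sum]
  refine Finset.sum_congr rfl fun I _ => ?_
  rw [tsum_embedding_eq_factorial_mul _
    (fun r => setValue (Sum.elim loc x) v (r.disjSum I)) fun t => by
      rw [← map_mixEmbedding, ← setValue_map _ hv, comp_mixEmbedding], ← mul_assoc,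
    ENNReal.div_mul_cancel (by exact_mod_cast Nat.factorial_ne_zero _) (ENNReal.natCast_ne_top _)]
  rfl

end Subsets

section InducedProcess

open Set

variable {X Y : Type*} [MeasurableSpace X] [MeasurableSpace Y] {k : ℕ}
  {f : (Fin k → X) → PointConfig X → Y} {g : (Fin k → X) → PointConfig X → ℝ≥0∞}

theorem inducedProcess_apply_eq_tsum
    (hf : ∀ (σ : Equiv.Perm (Fin k)) x ω, f (x ∘ σ) ω = f x ω)
    (hg : ∀ (σ : Equiv.Perm (Fin k)) x ω, g (x ∘ σ) ω = g x ω)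
    (ω : PointConfig X) {B : Set Y} (hB : MeasurableSet B) :
    inducedProcess f g ω B = ∑' s : {s : Finset ω.Points // s.card = k},
      setValue (PointConfig.Points.loc (ω := ω)) (fun x => g x ω * B.indicator 1 (f x ω)) s.1 := by
  rw [inducedProcess_apply ω hB, factorialSum]
  have := tsum_embedding_symm (PointConfig.Points.loc (ω := ω)) (k := k)
    (v := fun x => g x ω * B.indicator 1 (f x ω)) fun σ x => by rw [hf, hg]
  simp only [Function.comp_def] at this
  unfold PointConfig.tuple
  rw [this, ← mul_assoc, ENNReal.inv_mul_cancel (by exact_mod_cast Nat.factorial_ne_zero _)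
    (ENNReal.natCast_ne_top _), one_mul]

theorem isCountingMeasure_inducedProcess
    (hf : ∀ (σ : Equiv.Perm (Fin k)) x ω, f (x ∘ σ) ω = f x ω)
    (hg : ∀ (σ : Equiv.Perm (Fin k)) x ω, g (x ∘ σ) ω = g x ω)
    (hg01 : ∀ x ω, g x ω = 0 ∨ g x ω = 1) (ω : PointConfig X) :
    IsCountingMeasure (inducedProcess f g ω) := by
  intro B hB
  rw [inducedProcess_apply_eq_tsum hf hg ω hB]
  set V : {s : Finset ω.Points // s.card = k} → ℝ≥0∞ := fun s =>
    setValue (PointConfig.Points.loc (ω := ω)) (fun x => g x ω * B.indicator 1 (f x ω)) s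
  have h01 : ∀ s, V s = 0 ∨ V s = 1 := by
    intro s
    simp only [V, setValue, dif_pos s.2]
    set x := PointConfig.Points.loc ∘ permEnum s 1
    by_cases hx : f x ω ∈ B <;> rcases hg01 x ω with h | h <;> simp [h, hx]
  have hV : V = {s | V s = 1}.indicator fun _ => 1 := by
    ext s
    rcases h01 s with h | h <;> simp [indicator, h]
  refine ⟨ENat.card {s | V s = 1}, ?_⟩
  rw [hV, ← tsum_subtype, ENNReal.tsum_const, mul_one, ← hV]

variable [TopologicalSpace X] [SecondCountableTopology X] [T2Space X] [BorelSpace X]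

theorem factorialSum_addPoints {u : (Fin k → X) → ℝ≥0∞}
    (hu : ∀ (σ : Equiv.Perm (Fin k)) x, u (x ∘ σ) = u x) (ω : PointConfig X) (x : Fin k → X) :
    factorialSum u (ω.addPoints x) = ∑ I : Finset (Fin k),
      ((k ! : ℕ) : ℝ≥0∞) / ((k - I.card) ! : ℕ) *
        factorialSum (fun z : Fin (k - I.card) → X => u (mixTuple x I z)) ω := by
  rw [((represents_points ω).addPoints x).factorialSum, tsum_embedding_sum _ _ hu]
  rfl

/-- The point of the induced process that comes from an added tuple. -/
theorem dirac_le_inducedProcess_addPoints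
    (hf : ∀ (σ : Equiv.Perm (Fin k)) x ω, f (x ∘ σ) ω = f x ω)
    (hg : ∀ (σ : Equiv.Perm (Fin k)) x ω, g (x ∘ σ) ω = g x ω) (ω : PointConfig X)
    (x : Fin k → X) (hx : g x (ω.addPoints x) = 1) :
    Measure.dirac (f x (ω.addPoints x)) ≤ inducedProcess f g (ω.addPoints x) := by
  refine Measure.le_iff.2 fun B hB => ?_
  rw [inducedProcess_apply_eq_tsum hf hg _ hB, Measure.dirac_apply' _ hB]
  obtain ⟨t, ht⟩ := exists_tuple_addPoints ω x
  refine le_trans (le_of_eq ?_) (ENNReal.le_tsum ⟨Finset.univ.map t, by simp⟩)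
  have := setValue_map (PointConfig.Points.loc (ω := ω.addPoints x)) (k := k)
    (v := fun y => g y (ω.addPoints x) * B.indicator 1 (f y (ω.addPoints x)))
    (fun σ y => by rw [hf, hg]) t
  rw [← this]
  change _ = g (PointConfig.tuple t) _ * B.indicator 1 (f (PointConfig.tuple t) _)
  rw [ht, hx, one_mul]

end InducedProcess

/-! ### Finite configurations -/

namespace FinPointConfig

open Set

variable {A Y : Type*} [MeasurableSpace A] [MeasurableSpace Y]

instance instIsFiniteMeasure (ω : FinPointConfig Y) : IsFiniteMeasure ω.1 := ω.2.1

/-- The configuration `ω + δ_y`. -/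
noncomputable def addPoint (ω : FinPointConfig Y) (y : Y) : FinPointConfig Y :=
  ⟨ω.1 + Measure.dirac y, inferInstance, ω.2.2.add (isCountingMeasure_dirac y)⟩

/-- The configuration `ω - δ_y` (which is `ω` if `y` is not a point of `ω`). -/
noncomputable def remove [MeasurableSingletonClass Y] (ω : FinPointConfig Y) (y : Y) :
    FinPointConfig Y :=
  ⟨ω.1.removePoint y, ⟨(removePoint_le ω.1 y univ).trans_lt (measure_lt_top _ _)⟩,
    ω.2.2.removePoint y⟩

/-- The number of points of a finite configuration. -/
noncomputable def mass (ω : FinPointConfig Y) : ℝ := ω.1.real univ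

theorem mass_nonneg (ω : FinPointConfig Y) : 0 ≤ ω.mass := measureReal_nonneg

theorem mass_addPoint (ω : FinPointConfig Y) (y : Y) : (ω.addPoint y).mass = ω.mass + 1 := by
  simp [mass, addPoint, measureReal_add_apply]

theorem addPoint_comm (ω : FinPointConfig Y) (y z : Y) :
    (ω.addPoint y).addPoint z = (ω.addPoint z).addPoint y :=
  Subtype.ext (add_right_comm _ _ _)

theorem measurable_iff {ω : A → FinPointConfig Y} :
    Measurable ω ↔ ∀ B, MeasurableSet B → Measurable fun a => (ω a).1 B :=
  ⟨fun h _ hB => (Measure.measurable_coe hB).comp (measurable_subtype_coe.comp h), fun h =>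
    (Measure.measurable_of_measurable_coe _ h).subtype_mk⟩

theorem measurable_apply {B : Set Y} (hB : MeasurableSet B) :
    Measurable fun ω : FinPointConfig Y => ω.1 B := measurable_iff.1 measurable_id B hB

theorem _root_.Measurable.addPoint {ω : A → FinPointConfig Y} {y : A → Y} (hω : Measurable ω)
    (hy : Measurable y) : Measurable fun a => (ω a).addPoint (y a) :=
  measurable_iff.2 fun B hB => by
    have : ∀ a, ((ω a).addPoint (y a)).1 B = (ω a).1 B + B.indicator 1 (y a) := fun a => by
      simp [FinPointConfig.addPoint, Measure.dirac_apply' _ hB]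
    rw [show (fun a => ((ω a).addPoint (y a)).1 B) = _ from funext this]
    exact (measurable_iff.1 hω B hB).add ((measurable_one.indicator hB).comp hy)

theorem measurable_lintegral {ω : A → FinPointConfig Y} (hω : Measurable ω)
    {u : A → Y → ℝ≥0∞} (hu : Measurable fun p : A × Y => u p.1 p.2) :
    Measurable fun a => ∫⁻ y, u a y ∂(ω a).1 :=
  measurable_lintegral_of_finite_on (m := fun a => (ω a).1) (D := fun _ => univ)
    (measurable_subtype_coe.comp hω) (fun _ => MeasurableSet.univ) (iUnion_const _)
    (fun _ _ => measure_lt_top _ _) hu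

variable [MeasurableEq Y] [MeasurableSingletonClass Y]

theorem _root_.Measurable.remove {ω : A → FinPointConfig Y} {y : A → Y} (hω : Measurable ω)
    (hy : Measurable y) : Measurable fun a => (ω a).remove (y a) := by
  have h := measurable_removePoint (m := fun a => (ω a).1) (D := fun _ => univ)
    (measurable_subtype_coe.comp hω) (fun _ => MeasurableSet.univ) (iUnion_const _)
    (fun _ _ => measure_lt_top _ _)
  exact (h.comp (measurable_id.prodMk hy)).subtype_mk

omit [MeasurableEq Y]

theorem remove_addPoint_self (ω : FinPointConfig Y) (y : Y) : (ω.addPoint y).remove y = ω :=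
  Subtype.ext (removePoint_add_dirac_self _ _)

theorem addPoint_remove {ω : FinPointConfig Y} {y : Y} (h : 1 ≤ ω.1 {y}) :
    (ω.remove y).addPoint y = ω :=
  Subtype.ext (removePoint_add_dirac h)

theorem mass_remove {ω : FinPointConfig Y} {y : Y} (h : 1 ≤ ω.1 {y}) :
    (ω.remove y).mass = ω.mass - 1 := by
  conv_rhs => rw [← addPoint_remove h, mass_addPoint, add_sub_cancel_right]

theorem remove_addPoint_comm {ω : FinPointConfig Y} {y : Y} (h : 1 ≤ ω.1 {y}) (z : Y) :
    (ω.addPoint z).remove y = (ω.remove y).addPoint z := by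
  conv_lhs => rw [← addPoint_remove h, addPoint_comm, remove_addPoint_self]

variable [TopologicalSpace Y] [SecondCountableTopology Y] [T2Space Y] [BorelSpace Y]

theorem ae_one_le (ω : FinPointConfig Y) : ∀ᵐ y ∂ω.1, 1 ≤ ω.1 {y} := by
  have h := ω.2.2.measure_nonatoms
  rw [measure_eq_zero_iff_ae_notMem] at h
  filter_upwards [h] with y hy
  exact ω.2.2.one_le_of_ne_zero (measurableSet_singleton y) hy

/-- Every finite configuration arises from the empty one by adding points. -/
theorem induction_addPoint {p : FinPointConfig Y → Prop}
    (zero : p ⟨0, inferInstance, isCountingMeasure_zero⟩)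
    (add : ∀ ω y, p ω → p (ω.addPoint y)) (ω : FinPointConfig Y) : p ω := by
  have hnat : ∃ n : ℕ, ω.1 univ = n := by
    obtain ⟨n, hn⟩ := ω.2.2 univ MeasurableSet.univ
    have h := measure_ne_top ω.1 univ
    rw [hn] at h
    obtain ⟨m, rfl⟩ := ENat.ne_top_iff_exists.1 (fun h' : n = ⊤ => h (by simp [h']))
    exact ⟨m, by simpa using hn⟩
  obtain ⟨n, hn⟩ := hnat
  induction n generalizing ω with
  | zero =>
    have : ω = ⟨0, inferInstance, isCountingMeasure_zero⟩ :=
      Subtype.ext (Measure.measure_univ_eq_zero.1 (by simpa using hn))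
    rwa [this]
  | succ n ih =>
    have hne : NeZero ω.1 := ⟨fun h => by rw [h] at hn; simp at hn; norm_cast at hn⟩
    obtain ⟨y, hy⟩ := (ae_one_le ω).exists
    rw [← addPoint_remove hy]
    refine add _ _ (ih _ ?_)
    have h1 : ((ω.remove y).addPoint y).1 univ = (n + 1 : ℕ) := by rw [addPoint_remove hy, hn]
    have h2 : (ω.remove y).1 univ + 1 = n + 1 := by
      simpa [addPoint] using h1
    exact (ENNReal.add_left_inj ENNReal.one_ne_top).1 h2

end FinPointConfig

/-! ### The Stein equation of a Poisson process -/

section Stein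

open Set Filter Topology FinPointConfig

variable {Y : Type*} [MeasurableSpace Y] [TopologicalSpace Y] [SecondCountableTopology Y]
  [T2Space Y] [BorelSpace Y] (M : Measure Y) [IsFiniteMeasure M]

/-- One step of the iteration for the equation
`(1 + M(Y) + ω(Y)) G(y, ω) = b(y, ω) + ∫ G(y, ω + δ_z) M(dz) + ∫ G(y, ω - δ_x) ω(dx)`. -/
noncomputable def steinStep (b G : Y × FinPointConfig Y → ℝ≥0∞) (p : Y × FinPointConfig Y) :
    ℝ≥0∞ :=
  (b p + ∫⁻ z, G (p.1, p.2.addPoint z) ∂M + ∫⁻ x, G (p.1, p.2.remove x) ∂p.2.1) /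
    (1 + M univ + p.2.1 univ)

/-- The iterates of `steinStep`, from `0`. -/
noncomputable def steinIter (b : Y × FinPointConfig Y → ℝ≥0∞) :
    ℕ → Y × FinPointConfig Y → ℝ≥0∞
  | 0 => 0
  | n + 1 => steinStep M b (steinIter b n)

variable {M} {b : Y × FinPointConfig Y → ℝ≥0∞}

theorem stein_den_ne_zero (p : Y × FinPointConfig Y) : 1 + M univ + p.2.1 univ ≠ 0 := by
  simp

theorem stein_den_ne_top (p : Y × FinPointConfig Y) : 1 + M univ + p.2.1 univ ≠ ∞ := by
  simp [ENNReal.add_eq_top]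

theorem measurable_steinStep {G : Y × FinPointConfig Y → ℝ≥0∞} (hb : Measurable b)
    (hG : Measurable G) : Measurable (steinStep M b G) := by
  refine Measurable.div (Measurable.add (Measurable.add hb ?_) ?_) ?_
  · have h : Measurable fun q : (Y × FinPointConfig Y) × Y => (q.1.1, q.1.2.addPoint q.2) :=
      (measurable_fst.comp measurable_fst).prodMk
        ((measurable_snd.comp measurable_fst).addPoint measurable_snd)
    exact (hG.comp h).lintegral_prod_right'
  · have h : Measurable fun q : (Y × FinPointConfig Y) × Y => (q.1.1, q.1.2.remove q.2) :=
      (measurable_fst.comp measurable_fst).prodMk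
        ((measurable_snd.comp measurable_fst).remove measurable_snd)
    exact measurable_lintegral (u := fun p x => G (p.1, p.2.remove x)) measurable_snd (hG.comp h)
  · exact ((measurable_apply MeasurableSet.univ).comp measurable_snd).const_add _

theorem measurable_steinIter (hb : Measurable b) (n : ℕ) : Measurable (steinIter M b n) := by
  induction n with
  | zero => exact measurable_const
  | succ n ih => exact measurable_steinStep hb ih

theorem steinStep_mono {G G' : Y × FinPointConfig Y → ℝ≥0∞} (h : G ≤ G') :
    steinStep M b G ≤ steinStep M b G' := by
  intro p
  unfold steinStep
  gcongr
  · exact h _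
  · exact h _

theorem monotone_steinIter : Monotone (steinIter M b) := by
  refine monotone_nat_of_le_succ fun n => ?_
  induction n with
  | zero => exact fun p => zero_le
  | succ n ih => exact steinStep_mono ih

theorem steinIter_le {c : ℝ≥0∞} (hb : ∀ p, b p ≤ c) (n : ℕ) (p : Y × FinPointConfig Y) :
    steinIter M b n p ≤ c := by
  induction n generalizing p with
  | zero => exact zero_le
  | succ n ih =>
    refine ENNReal.div_le_of_le_mul ?_
    calc _ ≤ c + ∫⁻ _, c ∂M + ∫⁻ _, c ∂p.2.1 :=
          add_le_add (add_le_add (hb p) (lintegral_mono fun z => ih _))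
            (lintegral_mono fun z => ih _)
      _ = _ := by simp only [lintegral_const]; ring

/-- The iteration preserves the bound on the oscillation in the added point, since the denominator
exceeds the total mass of the two averages by one. -/
theorem steinIter_le_add (hb : ∀ y z ω, b (y, ω) ≤ b (z, ω) + 1) (n : ℕ) (y z : Y)
    (ω : FinPointConfig Y) : steinIter M b n (y, ω) ≤ steinIter M b n (z, ω) + 1 := by
  induction n generalizing ω with
  | zero => simp [steinIter]
  | succ n ih =>
    refine ENNReal.div_le_of_le_mul ?_
    rw [steinIter, steinStep, add_mul, ENNReal.div_mul_cancel (stein_den_ne_zero (z, ω))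
      (stein_den_ne_top (z, ω))]
    calc _ ≤ (b (z, ω) + 1) + ∫⁻ v, (steinIter M b n (z, ω.addPoint v) + 1) ∂M
          + ∫⁻ x, (steinIter M b n (z, ω.remove x) + 1) ∂ω.1 :=
          add_le_add (add_le_add (hb y z ω) (lintegral_mono fun v => ih _))
            (lintegral_mono fun v => ih _)
      _ = _ := by
        rw [lintegral_add_right _ measurable_const, lintegral_add_right _ measurable_const]
        simp only [lintegral_const]; ring

/-- The solution of the equation of `steinStep`, as the limit of an increasing iteration. -/
noncomputable def steinSol (M : Measure Y) [IsFiniteMeasure M] (b : Y × FinPointConfig Y → ℝ≥0∞)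
    (p : Y × FinPointConfig Y) : ℝ≥0∞ := ⨆ n, steinIter M b n p

theorem measurable_steinSol (hb : Measurable b) : Measurable (steinSol M b) :=
  Measurable.iSup fun n => measurable_steinIter hb n

/-- By monotone convergence in both integrals. -/
theorem steinSol_eq (hb : Measurable b) (p : Y × FinPointConfig Y) :
    steinSol M b p = steinStep M b (steinSol M b) p := by
  have hmono := monotone_steinIter (M := M) (b := b)
  have h1 : steinSol M b p = ⨆ n, steinIter M b (n + 1) p :=
    (Monotone.iSup_nat_add (f := fun n => steinIter M b n p) (fun m n h => hmono h p) 1).symm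
  rw [h1]
  simp only [steinIter, steinStep, steinSol]
  rw [← ENNReal.iSup_div]
  congr 1
  have hR : Monotone fun n => ∫⁻ x, steinIter M b n (p.1, p.2.remove x) ∂p.2.1 :=
    fun m n h => lintegral_mono fun z => hmono h _
  rw [lintegral_iSup, lintegral_iSup, ENNReal.add_iSup (a := b p),
    ENNReal.iSup_add_iSup_of_monotone _ hR]
  · exact fun m n h => by gcongr; exact hmono h _
  · exact fun n => (measurable_steinIter hb n).comp
      (measurable_const.prodMk (measurable_const.remove measurable_id))
  · exact fun m n h x => hmono h _
  · exact fun n => (measurable_steinIter hb n).comp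
      (measurable_const.prodMk (measurable_const.addPoint measurable_id))
  · exact fun m n h x => hmono h _

theorem integrable_of_bound {Z : Type*} [MeasurableSpace Z] {μ : Measure Z} [IsFiniteMeasure μ]
    {v : Z → ℝ} (hv : Measurable v) {C : ℝ} (hC : ∀ z, |v z| ≤ C) : Integrable v μ :=
  Integrable.of_bound hv.aestronglyMeasurable C (Eventually.of_forall hC)

/-- Uniqueness: a bounded function that is dominated by its own averages under the killed
immigration-death dynamics vanishes. Compare with multiples of `ω(Y) + M(Y)`. -/
theorem eq_zero_of_killed_harmonic {v : FinPointConfig Y → ℝ} {C : ℝ}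
    (hC : ∀ ω, |v ω| ≤ C)
    (heq : ∀ ω, (2 + M.real univ + ω.mass) * v ω =
      ∫ z, v (ω.addPoint z) ∂M + ∫ x, v (ω.remove x) ∂ω.1) (ω : FinPointConfig Y) : v ω = 0 := by
  set m := M.real univ with hm
  have hm0 : 0 ≤ m := measureReal_nonneg
  have hC0 : 0 ≤ C := (abs_nonneg _).trans (hC ω)
  have key : ∀ ε > 0, ∀ ω, |v ω| ≤ ε * (ω.mass + m) := by
    intro ε hε
    -- For `ω(Y) ≥ N` the bound `ε ω(Y)` exceeds `C`. For `ω(Y) ≤ N` the averaging is a contraction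
    -- with factor `ρ`, up to the drift of `ω(Y)`, which the term `ε M(Y)` compensates.
    set N := C / ε with hN
    have hN0 : 0 ≤ N := by positivity
    set ρ := (m + N) / (2 + m + N) with hρ
    have hρ0 : 0 ≤ ρ := by positivity
    have hρ1 : ρ < 1 := (div_lt_one (by positivity)).2 (by linarith)
    have step : ∀ n : ℕ, ∀ ω, |v ω| ≤ C * ρ ^ n + ε * (ω.mass + m) := by
      intro n
      induction n with
      | zero =>
        intro ω
        have := ω.mass_nonneg
        have : 0 ≤ ε * (ω.mass + m) := by positivity
        simpa using (hC ω).trans (by linarith)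
      | succ n ih =>
        intro ω
        have hω := ω.mass_nonneg
        set a := C * ρ ^ n with ha
        have ha0 : 0 ≤ a := by positivity
        rcases le_total N ω.mass with hle | hle
        · have h1 : C ≤ ε * ω.mass := by
            rw [hN, div_le_iff₀ hε] at hle; linarith
          have : 0 ≤ C * ρ ^ (n + 1) := by positivity
          have : 0 ≤ ε * m := by positivity
          linarith [hC ω]
        · have hI1 : |∫ z, v (ω.addPoint z) ∂M| ≤ (a + ε * (ω.mass + 1 + m)) * m := by
            have := norm_integral_le_of_norm_le_const (μ := M) (f := fun z => v (ω.addPoint z))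
              (C := a + ε * (ω.mass + 1 + m)) (Eventually.of_forall fun z => by
                have := ih (ω.addPoint z); rwa [mass_addPoint] at this)
            simpa using this
          have hI2 : |∫ x, v (ω.remove x) ∂ω.1| ≤ (a + ε * (ω.mass - 1 + m)) * ω.mass := by
            have := norm_integral_le_of_norm_le_const (μ := ω.1) (f := fun x => v (ω.remove x))
              (C := a + ε * (ω.mass - 1 + m)) (by
                filter_upwards [ω.ae_one_le] with x hx
                have := ih (ω.remove x); rwa [mass_remove hx] at this)
            simpa [mass] using this
          have hpos : 0 < 2 + m + ω.mass := by positivity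
          have h1 : (2 + m + ω.mass) * |v ω| ≤
              (a + ε * (ω.mass + 1 + m)) * m + (a + ε * (ω.mass - 1 + m)) * ω.mass := by
            rw [← abs_of_pos hpos, ← abs_mul, heq ω]
            exact (abs_add_le _ _).trans (add_le_add hI1 hI2)
          have h2 : m + ω.mass ≤ ρ * (2 + m + ω.mass) := by
            rw [hρ, div_mul_eq_mul_div, le_div_iff₀ (by positivity)]
            nlinarith
          have h3 : (2 + m + ω.mass) * |v ω| ≤
              (2 + m + ω.mass) * (C * ρ ^ (n + 1) + ε * (ω.mass + m)) := by
            refine h1.trans ?_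
            have h4 : a * (m + ω.mass) ≤ a * (ρ * (2 + m + ω.mass)) :=
              mul_le_mul_of_nonneg_left h2 ha0
            have h5 : C * ρ ^ (n + 1) = a * ρ := by rw [ha, pow_succ]; ring
            rw [h5]
            have h6 : 0 ≤ ε * (m + 3 * ω.mass) := by positivity
            nlinarith
          exact le_of_mul_le_mul_left h3 hpos
    intro ω
    have hlim : Tendsto (fun n : ℕ => C * ρ ^ n + ε * (ω.mass + m)) atTop
        (𝓝 (C * 0 + ε * (ω.mass + m))) :=
      ((tendsto_pow_atTop_nhds_zero_of_lt_one hρ0 hρ1).const_mul C).add_const _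
    rw [mul_zero, zero_add] at hlim
    exact ge_of_tendsto' hlim fun n => step n ω
  have hlim : Tendsto (fun ε : ℝ => ε * (ω.mass + m)) (𝓝[>] 0) (𝓝 (0 * (ω.mass + m))) :=
    (tendsto_nhdsWithin_of_tendsto_nhds tendsto_id).mul_const _
  rw [zero_mul] at hlim
  have := ge_of_tendsto hlim (by filter_upwards [self_mem_nhdsWithin] with ε hε using key ε hε ω)
  exact abs_eq_zero.1 (le_antisymm this (abs_nonneg _))

theorem integral_addPoint_remove {v : FinPointConfig Y → ℝ} (hv : Measurable v) {C : ℝ}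
    (hC : ∀ ω, |v ω| ≤ C) (ω : FinPointConfig Y) (z : Y) :
    ∫ x, v ((ω.addPoint z).remove x) ∂(ω.addPoint z).1 =
      ∫ x, v ((ω.remove x).addPoint z) ∂ω.1 + v ω := by
  have hm : Measurable fun x => v ((ω.addPoint z).remove x) :=
    hv.comp (measurable_const.remove measurable_id)
  change ∫ x, v ((ω.addPoint z).remove x) ∂(ω.1 + Measure.dirac z) = _
  rw [integral_add_measure (integrable_of_bound hm fun _ => hC _)
    (integrable_of_bound hm fun _ => hC _), integral_dirac' _ _ hm.stronglyMeasurable,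
    remove_addPoint_self]
  congr 1
  refine integral_congr_ae ?_
  filter_upwards [ω.ae_one_le] with x hx
  rw [remove_addPoint_comm hx]

/-- The equation for the gradient of the Stein solution of a Lipschitz functional `h` has a
solution bounded by `1` with oscillation at most `1` in the added point. -/
theorem exists_stein_solution (M : Measure Y) [IsFiniteMeasure M] {h : FinPointConfig Y → ℝ}
    (hh : Measurable h) (h1 : ∀ (ω : FinPointConfig Y) y, |h (ω.addPoint y) - h ω| ≤ 1)
    (h2 : ∀ (ω : FinPointConfig Y) y z, h (ω.addPoint y) - h (ω.addPoint z) ≤ 1) :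
    ∃ g : Y → FinPointConfig Y → ℝ, Measurable (fun p : Y × FinPointConfig Y => g p.1 p.2) ∧
      (∀ y ω, |g y ω| ≤ 1) ∧ (∀ y z ω, g y ω - g z ω ≤ 1) ∧
      ∀ y (ω : FinPointConfig Y), (1 + M.real univ + ω.mass) * g y ω =
        h (ω.addPoint y) - h ω + ∫ z, g y (ω.addPoint z) ∂M + ∫ x, g y (ω.remove x) ∂ω.1 := by
  -- the equation is shifted by `1` to make all terms nonnegative
  let b : Y × FinPointConfig Y → ℝ≥0∞ := fun p =>
    ENNReal.ofReal (h (p.2.addPoint p.1) - h p.2 + 1)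
  have hb : Measurable b := (((hh.comp (measurable_snd.addPoint measurable_fst)).sub
    (hh.comp measurable_snd)).add_const 1).ennreal_ofReal
  have hb2 : ∀ p, b p ≤ 2 := fun p => by
    refine ENNReal.ofReal_le_of_le_toReal ?_
    have := (abs_le.1 (h1 p.2 p.1)).2
    simp only [ENNReal.toReal_ofNat]; linarith
  have hb1 : ∀ y z ω, b (y, ω) ≤ b (z, ω) + 1 := fun y z ω => by
    have h3 := (abs_le.1 (h1 ω z)).1
    rw [← ENNReal.ofReal_one, ← ENNReal.ofReal_add (by linarith) zero_le_one]
    exact ENNReal.ofReal_le_ofReal (by have := h2 ω y z; simp only; linarith)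
  obtain ⟨G, hGdef⟩ : ∃ G, G = steinSol M b := ⟨_, rfl⟩
  have hG : Measurable G := hGdef ▸ measurable_steinSol hb
  have hG2 : ∀ p, G p ≤ 2 := fun p => by
    rw [hGdef]; exact iSup_le fun n => steinIter_le hb2 n p
  have hGtop : ∀ p, G p ≠ ∞ := fun p => ne_top_of_le_ne_top (by simp) (hG2 p)
  have hG1 : ∀ y z ω, G (y, ω) ≤ G (z, ω) + 1 := fun y z ω => by
    rw [hGdef]
    exact iSup_le fun n => (steinIter_le_add hb1 n y z ω).trans
      (by gcongr; exact le_iSup (fun n => steinIter M b n (z, ω)) n)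
  have hbound : ∀ p, |(G p).toReal - 1| ≤ 1 := fun p => by
    have h3 : (G p).toReal ≤ 2 := ENNReal.toReal_le_of_le_ofReal (by norm_num)
      (by simpa using hG2 p)
    have h4 : 0 ≤ (G p).toReal := ENNReal.toReal_nonneg
    exact abs_le.2 ⟨by linarith, by linarith⟩
  refine ⟨fun y ω => (G (y, ω)).toReal - 1, hG.ennreal_toReal.sub_const 1, fun y ω => hbound _,
    fun y z ω => ?_, fun y ω => ?_⟩
  · have h3 := ENNReal.toReal_mono (by simp [hGtop]) (hG1 y z ω)
    rw [ENNReal.toReal_add (hGtop _) (by simp)] at h3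
    simp only [ENNReal.toReal_one] at h3
    linarith
  · have hI : ∀ (μ : Measure Y) [IsFiniteMeasure μ] (s : Y → FinPointConfig Y), Measurable s →
        (∫⁻ z, G (y, s z) ∂μ).toReal = ∫ z, ((G (y, s z)).toReal - 1) ∂μ + μ.real univ := by
      intro μ _ s hs
      have hm : Measurable fun z => G (y, s z) := hG.comp (measurable_const.prodMk hs)
      rw [← integral_toReal hm.aemeasurable (Eventually.of_forall fun z => (hGtop _).lt_top)]
      have h5 : ∀ z, (G (y, s z)).toReal = ((G (y, s z)).toReal - 1) + 1 := fun z => by ring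
      conv_lhs => rw [funext h5]
      rw [integral_add (integrable_of_bound (hm.ennreal_toReal.sub_const 1) fun _ => hbound _)
        (integrable_const _)]
      simp
    have hfin : ∀ (μ : Measure Y) [IsFiniteMeasure μ] (s : Y → FinPointConfig Y),
        ∫⁻ z, G (y, s z) ∂μ ≠ ∞ := fun μ _ s => by
      refine ne_top_of_le_ne_top ?_ (lintegral_mono fun z => hG2 (y, s z))
      simp [ENNReal.mul_eq_top]
    have h3 : G (y, ω) = (b (y, ω) + ∫⁻ z, G (y, ω.addPoint z) ∂M +
        ∫⁻ x, G (y, ω.remove x) ∂ω.1) / (1 + M univ + ω.1 univ) := by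
      rw [hGdef]; exact steinSol_eq (M := M) hb (y, ω)
    rw [ENNReal.eq_div_iff (stein_den_ne_zero (y, ω)) (stein_den_ne_top (y, ω))] at h3
    have hbt : b (y, ω) ≠ ∞ := ne_top_of_le_ne_top (by simp) (hb2 _)
    have hbr : (b (y, ω)).toReal = h (ω.addPoint y) - h ω + 1 :=
      ENNReal.toReal_ofReal (by have := (abs_le.1 (h1 ω y)).1; simp only; linarith)
    have h4 := congrArg ENNReal.toReal h3
    rw [ENNReal.toReal_mul, ENNReal.toReal_add (by simp [ENNReal.add_eq_top]) (by simp),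
      ENNReal.toReal_add (by simp) (by simp),
      ENNReal.toReal_add (ENNReal.add_ne_top.2 ⟨hbt, hfin M _⟩) (hfin ω.1 _),
      ENNReal.toReal_add hbt (hfin M _),
      hI M (fun z => ω.addPoint z) (measurable_const.addPoint measurable_id),
      hI ω.1 (fun z => ω.remove z) (measurable_const.remove measurable_id), hbr,
      ENNReal.toReal_one] at h4
    change (1 + M.real univ + ω.mass) * (G (y, ω)).toReal = _ + (_ + ω.mass) at h4
    linarith

/-- The second differences of the solution of the equation for the gradient are symmetric, so
that it is the gradient of a function. -/
theorem stein_solution_closed {M : Measure Y} [IsFiniteMeasure M] {h : FinPointConfig Y → ℝ}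
    {g : Y → FinPointConfig Y → ℝ} (hg : Measurable (fun p : Y × FinPointConfig Y => g p.1 p.2))
    (hgb : ∀ y ω, |g y ω| ≤ 1)
    (hgeq : ∀ y (ω : FinPointConfig Y), (1 + M.real univ + ω.mass) * g y ω =
        h (ω.addPoint y) - h ω + ∫ z, g y (ω.addPoint z) ∂M + ∫ x, g y (ω.remove x) ∂ω.1)
    (y z : Y) (ω : FinPointConfig Y) :
    g y (ω.addPoint z) - g y ω = g z (ω.addPoint y) - g z ω := by
  have hgy : ∀ y, Measurable (g y) := fun y => hg.comp (measurable_const.prodMk measurable_id)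
  refine sub_eq_zero.1 (eq_zero_of_killed_harmonic (M := M)
    (v := fun ω => (g y (ω.addPoint z) - g y ω) - (g z (ω.addPoint y) - g z ω)) (C := 4)
    (fun ω => ?_) (fun ω => ?_) ω)
  · have a1 := abs_le.1 (hgb y (ω.addPoint z))
    have a2 := abs_le.1 (hgb y ω)
    have a3 := abs_le.1 (hgb z (ω.addPoint y))
    have a4 := abs_le.1 (hgb z ω)
    exact abs_le.2 ⟨by linarith, by linarith⟩
  · have e1 : ∀ y z, (2 + M.real univ + ω.mass) * (g y (ω.addPoint z) - g y ω) =
        (h ((ω.addPoint z).addPoint y) - h (ω.addPoint z) - h (ω.addPoint y) + h ω)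
        + (∫ x, g y ((ω.addPoint x).addPoint z) ∂M - ∫ x, g y (ω.addPoint x) ∂M)
        + (∫ x, g y ((ω.remove x).addPoint z) ∂ω.1 - ∫ x, g y (ω.remove x) ∂ω.1) := by
      intro y z
      have q1 := hgeq y (ω.addPoint z)
      have q2 := hgeq y ω
      rw [mass_addPoint, integral_addPoint_remove (hgy y) (hgb y)] at q1
      simp_rw [addPoint_comm ω z] at q1
      rw [addPoint_comm ω z y]
      linarith
    have hs : ∀ (μ : Measure Y) [IsFiniteMeasure μ] (s : Y → FinPointConfig Y), Measurable s →
        ∫ x, ((g y ((s x).addPoint z) - g y (s x)) - (g z ((s x).addPoint y) - g z (s x))) ∂μ =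
          (∫ x, g y ((s x).addPoint z) ∂μ - ∫ x, g y (s x) ∂μ) -
          (∫ x, g z ((s x).addPoint y) ∂μ - ∫ x, g z (s x) ∂μ) := by
      intro μ _ s hs
      have i1 : ∀ y, Integrable (fun x => g y (s x)) μ := fun y =>
        integrable_of_bound ((hgy y).comp hs) fun _ => hgb _ _
      have i2 : ∀ y z, Integrable (fun x => g y ((s x).addPoint z)) μ := fun y z =>
        integrable_of_bound ((hgy y).comp (hs.addPoint measurable_const)) fun _ => hgb _ _
      rw [← integral_sub (i2 y z) (i1 y), ← integral_sub (i2 z y) (i1 z)]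
      exact integral_sub ((i2 y z).sub (i1 y)) ((i2 z y).sub (i1 z))
    rw [hs M (fun x => ω.addPoint x) (measurable_const.addPoint measurable_id),
      hs ω.1 (fun x => ω.remove x) (measurable_const.remove measurable_id),
      mul_sub, e1 y z, e1 z y, addPoint_comm ω z y]
    ring

/-- The discrete gradient of the solution of the Stein equation for a Lipschitz functional `h`:
bounded by `1`, with oscillation at most `1` in the added point, and recovering `h` up to a
constant. -/
theorem exists_stein_gradient (M : Measure Y) [IsFiniteMeasure M] {h : FinPointConfig Y → ℝ}
    (hh : Measurable h) (h1 : ∀ (ω : FinPointConfig Y) y, |h (ω.addPoint y) - h ω| ≤ 1)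
    (h2 : ∀ (ω : FinPointConfig Y) y z, h (ω.addPoint y) - h (ω.addPoint z) ≤ 1) :
    ∃ g : Y → FinPointConfig Y → ℝ, Measurable (fun p : Y × FinPointConfig Y => g p.1 p.2) ∧
      (∀ y ω, |g y ω| ≤ 1) ∧ (∀ y z ω, g y ω - g z ω ≤ 1) ∧
      ∃ c : ℝ, ∀ ω, h ω - c = ∫ x, g x (ω.remove x) ∂ω.1 - ∫ z, g z ω ∂M := by
  obtain ⟨g, hg, hgb, hgosc, hgeq⟩ := exists_stein_solution M hh h1 h2
  have hclosed := stein_solution_closed hg hgb hgeq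
  have i1 : ∀ (μ : Measure Y) [IsFiniteMeasure μ] y (s : Y → FinPointConfig Y), Measurable s →
      Integrable (fun x => g y (s x)) μ := fun μ _ y s hs =>
    integrable_of_bound (hg.comp (measurable_const.prodMk hs)) fun _ => hgb _ _
  have i2 : ∀ (μ : Measure Y) [IsFiniteMeasure μ] (s : Y → FinPointConfig Y), Measurable s →
      Integrable (fun x => g x (s x)) μ := fun μ _ s hs =>
    integrable_of_bound (hg.comp (measurable_id.prodMk hs)) fun _ => hgb _ _
  have mA : ∀ ω : FinPointConfig Y, Measurable fun x => ω.addPoint x := fun ω =>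
    measurable_const.addPoint measurable_id
  have mR : ∀ ω : FinPointConfig Y, Measurable fun x => ω.remove x := fun ω =>
    measurable_const.remove measurable_id
  -- the right-hand side of the Stein equation has the same increments as `h`
  let s : FinPointConfig Y → ℝ := fun ω => ∫ x, g x (ω.remove x) ∂ω.1 - ∫ z, g z ω ∂M
  have hs : ∀ ω y, s (ω.addPoint y) - s ω = h (ω.addPoint y) - h ω := by
    intro ω y
    have hm2 : Measurable fun x => g x ((ω.addPoint y).remove x) :=
      hg.comp (measurable_id.prodMk (mR _))
    have e1 : ∫ x, g x ((ω.addPoint y).remove x) ∂(ω.addPoint y).1 =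
        ∫ x, g x ((ω.remove x).addPoint y) ∂ω.1 + g y ω := by
      change ∫ x, g x ((ω.addPoint y).remove x) ∂(ω.1 + Measure.dirac y) = _
      rw [integral_add_measure (i2 _ _ (mR _)) (i2 _ _ (mR _)),
        integral_dirac' _ _ hm2.stronglyMeasurable, remove_addPoint_self]
      congr 1
      refine integral_congr_ae ?_
      filter_upwards [ω.ae_one_le] with x hx
      rw [remove_addPoint_comm hx]
    have e2 : ∫ x, g x ((ω.remove x).addPoint y) ∂ω.1 - ∫ x, g x (ω.remove x) ∂ω.1 =
        ω.mass * g y ω - ∫ x, g y (ω.remove x) ∂ω.1 := by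
      rw [← integral_sub (i2 _ (fun x => (ω.remove x).addPoint y)
        ((mR ω).addPoint measurable_const)) (i2 _ _ (mR ω))]
      have : ω.mass * g y ω = ∫ _, g y ω ∂ω.1 := by simp [mass]
      rw [this, ← integral_sub (integrable_const _) (i1 _ y _ (mR ω))]
      refine integral_congr_ae ?_
      filter_upwards [ω.ae_one_le] with x hx
      have := hclosed x y (ω.remove x)
      rw [addPoint_remove hx] at this
      exact this
    have e3 : ∫ z, g z (ω.addPoint y) ∂M - ∫ z, g z ω ∂M =
        ∫ z, g y (ω.addPoint z) ∂M - M.real univ * g y ω := by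
      rw [← integral_sub (i2 M (fun _ => ω.addPoint y) measurable_const)
        (i2 M (fun _ => ω) measurable_const)]
      have : M.real univ * g y ω = ∫ _, g y ω ∂M := by simp
      rw [this, ← integral_sub (i1 _ y _ (mA ω)) (integrable_const _)]
      exact integral_congr_ae (Eventually.of_forall fun z => hclosed z y ω)
    have e4 := hgeq y ω
    simp only [s]
    rw [e1]
    linarith
  let ω₀ : FinPointConfig Y := ⟨0, inferInstance, isCountingMeasure_zero⟩
  refine ⟨g, hg, hgb, hgosc, h ω₀ - s ω₀, fun ω => ?_⟩
  change h ω - (h ω₀ - s ω₀) = s ω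
  induction ω using induction_addPoint with
  | zero => simp only [ω₀]; ring
  | add ω y ih => linarith [hs ω y]

end Stein

/-! ### Measurability for random closed sets -/

section Fell

open Set

variable {A X : Type*} [MeasurableSpace A] [TopologicalSpace X] {F G : A → Closeds X}

theorem measurableSet_hits (hF : Measurable[_, fellMeasurableSpace X] F) {C : Set X}
    (hC : IsCompact C) : MeasurableSet {a | ((F a : Set X) ∩ C).Nonempty} := by
  have h : MeasurableSet[fellMeasurableSpace X] {F : Closeds X | ((F : Set X) ∩ C).Nonempty} :=
    MeasurableSpace.measurableSet_generateFrom ⟨C, hC, rfl⟩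
  exact hF h

variable [LocallyCompactSpace X] [SecondCountableTopology X] [T2Space X]

variable (X) in
/-- The members of a countable base whose closure is compact. -/
def compactBasis : Set (Set X) := {V ∈ countableBasis X | IsCompact (closure V)}

theorem countable_compactBasis : (compactBasis X).Countable :=
  (countable_countableBasis X).mono fun _ h => h.1

theorem exists_mem_compactBasis {x : X} {G : Closeds X} (hx : x ∉ G) :
    ∃ V ∈ compactBasis X, x ∈ V ∧ (G : Set X) ∩ closure V = ∅ := by
  obtain ⟨C, hC, hxC, hCG⟩ := exists_compact_subset G.isClosed.isOpen_compl
    (show x ∈ (G : Set X)ᶜ from hx)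
  obtain ⟨V, hV, hxV, hVC⟩ := (isBasis_countableBasis X).exists_subset_of_mem_open hxC
    isOpen_interior
  have hcl : closure V ⊆ C := closure_minimal (hVC.trans interior_subset) hC.isClosed
  refine ⟨V, ⟨hV, hC.of_isClosed_subset isClosed_closure hcl⟩, hxV, ?_⟩
  exact eq_empty_of_forall_notMem fun y hy => hCG (hcl hy.2) hy.1

/-- `F ⊆ G` if and only if `G` hits the closure of every basic set whose closure `F` hits. -/
theorem measurableSet_closeds_subset (hF : Measurable[_, fellMeasurableSpace X] F)
    (hG : Measurable[_, fellMeasurableSpace X] G) :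
    MeasurableSet {a | (F a : Set X) ⊆ G a} := by
  have h : {a | (F a : Set X) ⊆ G a} = ⋂ V ∈ compactBasis X,
      ({a | ((F a : Set X) ∩ closure V).Nonempty}ᶜ ∪
        {a | ((G a : Set X) ∩ closure V).Nonempty}) := by
    ext a
    simp only [mem_ofPred_eq, mem_iInter, mem_union, mem_compl_iff]
    refine ⟨fun h V _ => or_iff_not_imp_left.2 fun hV => (not_not.1 hV).mono
      (inter_subset_inter_left _ h), fun h x hx => ?_⟩
    by_contra hxG
    obtain ⟨V, hV, hxV, hGV⟩ := exists_mem_compactBasis hxG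
    rcases h V hV with h | h
    · exact h ⟨x, hx, subset_closure hxV⟩
    · exact h.ne_empty hGV
  rw [h]
  exact MeasurableSet.biInter countable_compactBasis fun V hV =>
    (measurableSet_hits hF hV.2).compl.union (measurableSet_hits hG hV.2)

theorem measurableSet_closeds_inter (hF : Measurable[_, fellMeasurableSpace X] F)
    (hG : Measurable[_, fellMeasurableSpace X] G) :
    MeasurableSet {a | ((F a : Set X) ∩ G a).Nonempty} := by
  -- `F` and `G` do not meet in a compact set `C` if and only if finitely many members of the base
  -- cover `F ∩ C` and have closures that do not meet `G`
  have h : {a | ((F a : Set X) ∩ G a).Nonempty} = ⋃ n, (⋃ T ∈ {T : Set (Set X) | T.Finite ∧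
      T ⊆ compactBasis X}, ((⋂ V ∈ T, {a | ((G a : Set X) ∩ closure V).Nonempty}ᶜ) ∩
        {a | ((F a : Set X) ∩ (compactCovering X n \ ⋃₀ T)).Nonempty}ᶜ))ᶜ := by
    ext a
    simp only [mem_ofPred_eq, mem_iUnion, mem_compl_iff, mem_inter_iff, mem_iInter, not_exists,
      exists_prop]
    constructor
    · rintro ⟨x, hxF, hxG⟩
      obtain ⟨n, hn⟩ := mem_iUnion.1 ((iUnion_compactCovering X).symm ▸ mem_univ x)
      refine ⟨n, fun T hT => ?_⟩
      obtain ⟨-, h1, h2⟩ := hT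
      refine h2 ⟨x, hxF, hn, ?_⟩
      rintro ⟨V, hV, hxV⟩
      exact h1 V hV ⟨x, hxG, subset_closure hxV⟩
    · rintro ⟨n, hn⟩
      by_contra hc
      have hcov : ∀ x ∈ (F a : Set X) ∩ compactCovering X n, ∃ V ∈ compactBasis X, x ∈ V ∧
          (G a : Set X) ∩ closure V = ∅ := fun x hx =>
        exists_mem_compactBasis fun hxG => hc ⟨x, hx.1, hxG⟩
      obtain ⟨T, hT, hTf, hcT⟩ := ((isCompact_compactCovering X n).inter_left
        (F a).isClosed).elim_finite_subcover_image
        (b := {V ∈ compactBasis X | (G a : Set X) ∩ closure V = ∅}) (c := id)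
        (fun V hV => isOpen_of_mem_countableBasis hV.1.1)
        (fun x hx => by
          obtain ⟨V, hV, hxV, hGV⟩ := hcov x hx
          exact mem_biUnion (show V ∈ _ from ⟨hV, hGV⟩) hxV)
      refine hn T ⟨⟨hTf, hT.trans fun V hV => hV.1⟩, fun V hV hne => hne.ne_empty (hT hV).2, ?_⟩
      rintro ⟨x, hxF, hxC, hxT⟩
      obtain ⟨V, hV, hxV⟩ := mem_iUnion₂.1 (hcT ⟨hxF, hxC⟩)
      exact hxT ⟨V, hV, hxV⟩
  rw [h]
  refine MeasurableSet.iUnion fun n => (MeasurableSet.biUnion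
    (countable_ofPred_finite_subset countable_compactBasis) fun T hT => ?_).compl
  refine (MeasurableSet.biInter hT.1.countable fun V hV =>
    (measurableSet_hits hG (hT.2 hV).2).compl).inter (measurableSet_hits hF ?_).compl
  exact (isCompact_compactCovering X n).diff
    (isOpen_sUnion fun V hV => isOpen_of_mem_countableBasis (hT.2 hV).1)

end Fell

/-! ### Truncation and localization -/

section Truncation

open Set

variable {X Y : Type*} [TopologicalSpace X] [MeasurableSpace X] {k : ℕ}
  {f : (Fin k → X) → PointConfig X → Y} {g : (Fin k → X) → PointConfig X → ℝ≥0∞}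
  {𝒮 : (Fin k → X) → PointConfig X → Closeds X} {S : (Fin k → X) → Closeds X}

theorem truncated_zero_or_one (hg01 : ∀ x ω, g x ω = 0 ∨ g x ω = 1) (x : Fin k → X)
    (ω : PointConfig X) : truncated g 𝒮 S x ω = 0 ∨ truncated g 𝒮 S x ω = 1 := by
  rw [truncated]
  split_ifs
  · exact hg01 x ω
  · exact Or.inl rfl

theorem truncated_symm (hg : ∀ (σ : Equiv.Perm (Fin k)) x ω, g (x ∘ σ) ω = g x ω)
    (h𝒮 : ∀ (σ : Equiv.Perm (Fin k)) x ω, 𝒮 (x ∘ σ) ω = 𝒮 x ω)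
    (hS : ∀ (σ : Equiv.Perm (Fin k)) x, S (x ∘ σ) = S x) (σ : Equiv.Perm (Fin k))
    (x : Fin k → X) (ω : PointConfig X) :
    truncated g 𝒮 S (x ∘ σ) ω = truncated g 𝒮 S x ω := by
  rw [truncated, truncated, hg, h𝒮, hS]

/-- After truncation, `f` and `g` are localized to the deterministic sets `S_𝐱`. -/
theorem isLocalizedTo_truncated [BorelSpace X] (hloc : IsLocalizedTo f g 𝒮)
    (hSx : ∀ x, StopsAt 𝒮 x (S x)) :
    IsLocalizedTo f (truncated g 𝒮 S) (fun x _ => S x) := by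
  intro ω t B hB hSB
  set x := PointConfig.tuple t
  have hS : MeasurableSet (S x : Set X) := (S x).isClosed.measurableSet
  have h : ∀ ω, (𝒮 x ω : Set X) ⊆ S x ↔ (𝒮 x (ω.restrict (S x)) : Set X) ⊆ S x := fun ω =>
    Set.ext_iff.1 (hSx x) ω
  have hiff : (𝒮 x ω : Set X) ⊆ S x ↔ (𝒮 x (ω.restrict B) : Set X) ⊆ S x := by
    rw [h ω, h (ω.restrict B), PointConfig.restrict_restrict _ hS, inter_eq_left.2 hSB]
  by_cases hc : (𝒮 x ω : Set X) ⊆ S x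
  · simp only [truncated, if_pos hc, if_pos (hiff.1 hc)]
    exact hloc ω t B hB (hc.trans hSB)
  · simp only [truncated, if_neg hc, if_neg (fun h => hc (hiff.2 h))]
    simp

variable [LocallyCompactSpace X] [SecondCountableTopology X] [T2Space X]

theorem measurable_truncated
    (hg : Measurable (fun p : (Fin k → X) × PointConfig X => g p.1 p.2))
    (h𝒮 : Measurable[_, fellMeasurableSpace X]
      (fun p : (Fin k → X) × PointConfig X => 𝒮 p.1 p.2))
    (hS : Measurable[_, fellMeasurableSpace X] S) :
    Measurable (fun p : (Fin k → X) × PointConfig X => truncated g 𝒮 S p.1 p.2) := by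
  classical
  have hS' : Measurable[_, fellMeasurableSpace X]
      (fun p : (Fin k → X) × PointConfig X => S p.1) := fun B hB => measurable_fst (hS hB)
  simp only [truncated]
  exact Measurable.ite (measurableSet_closeds_subset h𝒮 hS') hg measurable_const

theorem measurable_overlap (hS : Measurable[_, fellMeasurableSpace X] S) :
    Measurable (fun p : (Fin k → X) × (Fin k → X) => overlap S p.1 p.2) := by
  classical
  have h1 : Measurable[_, fellMeasurableSpace X]
      (fun p : (Fin k → X) × (Fin k → X) => S p.1) := fun B hB => measurable_fst (hS hB)
  have h2 : Measurable[_, fellMeasurableSpace X]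
      (fun p : (Fin k → X) × (Fin k → X) => S p.2) := fun B hB => measurable_snd (hS hB)
  simp only [overlap]
  exact Measurable.ite (measurableSet_closeds_inter h1 h2) measurable_const measurable_const

end Truncation

/-! ### Splitting the induced process around a tuple -/

section Splitting

open Set

variable {X Y : Type*} [TopologicalSpace X] [MeasurableSpace X] [MeasurableSpace Y] {k : ℕ}
  {f : (Fin k → X) → PointConfig X → Y} {g : (Fin k → X) → PointConfig X → ℝ≥0∞}
  {S : (Fin k → X) → Closeds X}

theorem overlap_zero_or_one (S : (Fin k → X) → Closeds X) (x z : Fin k → X) :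
    overlap S x z = 0 ∨ overlap S x z = 1 := by
  rw [overlap]; split_ifs <;> simp

theorem overlap_le_one (S : (Fin k → X) → Closeds X) (x z : Fin k → X) : overlap S x z ≤ 1 := by
  rcases overlap_zero_or_one S x z with h | h <;> simp [h]

theorem overlap_eq_one {x z : Fin k → X} {v : X} (hx : v ∈ S x) (hz : v ∈ S z) :
    overlap S x z = 1 := if_pos ⟨v, hx, hz⟩

/-- The factor that selects the tuples `𝐳` with `S_𝐳 ∩ S_𝐱 ≠ ∅`. -/
noncomputable def nearPart (S : (Fin k → X) → Closeds X) (g : (Fin k → X) → PointConfig X → ℝ≥0∞)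
    (x z : Fin k → X) (ω : PointConfig X) : ℝ≥0∞ := overlap S x z * g z ω

/-- The factor that selects the tuples `𝐳` with `S_𝐳 ∩ S_𝐱 = ∅`. -/
noncomputable def farPart (S : (Fin k → X) → Closeds X) (g : (Fin k → X) → PointConfig X → ℝ≥0∞)
    (x z : Fin k → X) (ω : PointConfig X) : ℝ≥0∞ := (1 - overlap S x z) * g z ω

theorem farPart_add_nearPart (x z : Fin k → X) (ω : PointConfig X) :
    farPart S g x z ω + nearPart S g x z ω = g z ω := by
  rw [farPart, nearPart, ← add_mul, tsub_add_cancel_of_le (overlap_le_one S x z), one_mul]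

theorem nearPart_symm (hg : ∀ (σ : Equiv.Perm (Fin k)) x ω, g (x ∘ σ) ω = g x ω)
    (hS : ∀ (σ : Equiv.Perm (Fin k)) x, S (x ∘ σ) = S x) (x : Fin k → X) (σ : Equiv.Perm (Fin k))
    (z : Fin k → X) (ω : PointConfig X) :
    nearPart S g x (z ∘ σ) ω = nearPart S g x z ω := by
  rw [nearPart, nearPart, overlap, overlap, hg, hS]

theorem nearPart_zero_or_one (hg01 : ∀ x ω, g x ω = 0 ∨ g x ω = 1) (x z : Fin k → X)
    (ω : PointConfig X) : nearPart S g x z ω = 0 ∨ nearPart S g x z ω = 1 := by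
  rcases overlap_zero_or_one S x z with h | h <;> rcases hg01 z ω with h' | h' <;>
    simp [nearPart, h, h']

theorem inducedProcess_farPart_add_nearPart (x : Fin k → X) (ω : PointConfig X) :
    inducedProcess f (farPart S g x) ω + inducedProcess f (nearPart S g x) ω =
      inducedProcess f g ω := by
  ext B hB
  rw [Measure.add_apply, inducedProcess_apply _ hB, inducedProcess_apply _ hB,
    inducedProcess_apply _ hB, ← mul_add, factorialSum, factorialSum, ← ENNReal.tsum_add]
  congr 1
  refine tsum_congr fun t => ?_
  rw [← add_mul, farPart_add_nearPart]

variable [SecondCountableTopology X] [T2Space X] [BorelSpace X]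

/-- The part of the process that is far from `𝐱` is determined by the points outside `S_𝐱`. -/
theorem inducedProcess_farPart_restrict (hloc : IsLocalizedTo f g (fun x _ => S x))
    (hg01 : ∀ x ω, g x ω = 0 ∨ g x ω = 1) (hxS : ∀ x i, x i ∈ S x) (x : Fin k → X)
    (ω : PointConfig X) :
    inducedProcess f (farPart S g x) (ω.restrict (S x : Set X)ᶜ) =
      inducedProcess f (farPart S g x) ω := by
  ext B hB
  rw [inducedProcess_apply _ hB, inducedProcess_apply _ hB]
  congr 1
  rw [← factorialSum_restrict _ ω]
  · refine tsum_congr fun t => ?_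
    set z := PointConfig.tuple t
    -- if `S_𝐳` does not meet `S_𝐱`, it is contained in the complement of `S_𝐱`
    rcases overlap_zero_or_one S x z with h | h
    · have hsub : (S z : Set X) ⊆ (S x : Set X)ᶜ := by
        intro v hv hvx
        rw [overlap_eq_one hvx hv] at h
        exact one_ne_zero h
      obtain ⟨h1, h2⟩ := hloc ω t _ (S x).isClosed.measurableSet.compl hsub
      change g z ω = g z _ at h1
      change g z ω = 1 → f z ω = f z _ at h2
      simp only [farPart, h, tsub_zero, one_mul]
      rw [← h1]
      rcases hg01 z ω with h0 | h0
      · rw [h0, zero_mul, zero_mul]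
      · rw [← h2 h0]
    · simp [farPart, h]
  -- tuples with an entry in `S_𝐱` do not count, as `𝐳 ⊆ S_𝐳`
  · rintro t ⟨i, hi⟩
    have : overlap S x (PointConfig.tuple t) = 1 :=
      overlap_eq_one (not_not.1 hi) (hxS (PointConfig.tuple t) i)
    simp [farPart, this]

/-- For a tuple that has been added, `g` and `f` are determined by the points in `S_𝐱`. -/
theorem IsLocalizedTo.addPoints_restrict (hloc : IsLocalizedTo f g (fun x _ => S x))
    (hxS : ∀ x i, x i ∈ S x) (x : Fin k → X) (ω : PointConfig X) :
    g x (ω.addPoints x) = g x ((ω.restrict (S x)).addPoints x) ∧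
      (g x (ω.addPoints x) = 1 →
        f x (ω.addPoints x) = f x ((ω.restrict (S x)).addPoints x)) := by
  obtain ⟨t, ht⟩ := exists_tuple_addPoints ω x
  have hS := (S x).isClosed.measurableSet
  have h := hloc (ω.addPoints x) t (S x) hS (by rw [ht])
  rwa [ht, PointConfig.restrict_addPoints_of_mem _ hS (hxS x)] at h

end Splitting

/-! ### Intensity measures of induced processes -/

section Intensity

open Set

variable {Ω X Y : Type*} [MeasurableSpace Ω] {P : Measure Ω} [IsProbabilityMeasure P]
  [TopologicalSpace X] [SecondCountableTopology X] [T2Space X] [MeasurableSpace X] [BorelSpace X]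
  [MeasurableSpace Y] {K : Measure X} [SigmaFinite K] {η : Ω → PointConfig X} {k : ℕ}
  {f : (Fin k → X) → PointConfig X → Y} {g : (Fin k → X) → PointConfig X → ℝ≥0∞}

theorem measurable_comp_addPoints {Z : Type*} [MeasurableSpace Z]
    {u : (Fin k → X) → PointConfig X → Z}
    (hu : Measurable fun p : (Fin k → X) × PointConfig X => u p.1 p.2) (hη : Measurable η) :
    Measurable fun p : (Fin k → X) × Ω => u p.1 ((η p.2).addPoints p.1) :=
  hu.comp (measurable_fst.prodMk ((hη.comp measurable_snd).addPoints measurable_fst))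

theorem IsIntensityMeasure.lintegral {ξ : Ω → Measure Y} {L : Measure Y}
    (hL : IsIntensityMeasure P ξ L) (hξ : Measurable ξ) {u : Y → ℝ≥0∞} (hu : Measurable u) :
    ∫⁻ y, u y ∂L = ∫⁻ w, ∫⁻ y, u y ∂(ξ w) ∂P := by
  have : L = P.bind ξ := Measure.ext fun B hB => by
    rw [hL B hB, Measure.bind_apply hB hξ.aemeasurable]
  rw [this, Measure.lintegral_bind hξ.aemeasurable hu.aemeasurable]

/-- The Mecke equation with respect to the exhaustion of `X` by the spanning sets of `K`. -/
theorem IsPoissonProcess.mecke_spanningSets (hη : IsPoissonProcess P η K)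
    (hfin : ∀ w n, (η w).1 (spanningSets K n) < ∞)
    {u : (Fin k → X) → PointConfig X → ℝ≥0∞}
    (hu : Measurable fun p : (Fin k → X) × PointConfig X => u p.1 p.2) :
    ∫⁻ w, factorialSum (fun x => u x (η w)) (η w) ∂P =
      ∫⁻ x, ∫⁻ w, u x ((η w).addPoints x) ∂P ∂(Measure.pi fun _ => K) :=
  hη.mecke_multi (measurableSet_spanningSets K) (iUnion_spanningSets K)
    (fun n => (measure_spanningSets_lt_top K n).ne) hfin hu

theorem IsPoissonProcess.measurable_induced (hη : IsPoissonProcess P η K)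
    (hfin : ∀ w n, (η w).1 (spanningSets K n) < ∞)
    (hf : Measurable (fun p : (Fin k → X) × PointConfig X => f p.1 p.2))
    (hg : Measurable (fun p : (Fin k → X) × PointConfig X => g p.1 p.2)) :
    Measurable fun w => inducedProcess f g (η w) :=
  _root_.measurable_inducedProcess hf hg (measurableSet_spanningSets K) (iUnion_spanningSets K)
    hη.measurable hfin

theorem IsPoissonProcess.lintegral_intensity (hη : IsPoissonProcess P η K)
    (hfin : ∀ w n, (η w).1 (spanningSets K n) < ∞)
    (hf : Measurable (fun p : (Fin k → X) × PointConfig X => f p.1 p.2))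
    (hg : Measurable (fun p : (Fin k → X) × PointConfig X => g p.1 p.2)) {L : Measure Y}
    (hL : IsIntensityMeasure P (fun w => inducedProcess f g (η w)) L) {u : Y → ℝ≥0∞}
    (hu : Measurable u) :
    ∫⁻ y, u y ∂L = ((k ! : ℕ) : ℝ≥0∞)⁻¹ * ∫⁻ x, ∫⁻ w, g x ((η w).addPoints x) *
      u (f x ((η w).addPoints x)) ∂P ∂(Measure.pi fun _ => K) := by
  have hgu : Measurable fun p : (Fin k → X) × PointConfig X => g p.1 p.2 * u (f p.1 p.2) :=
    hg.mul (hu.comp hf)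
  rw [hL.lintegral (hη.measurable_induced hfin hf hg) hu]
  simp_rw [lintegral_inducedProcess _ hu]
  rw [lintegral_const_mul _ (measurable_factorialSum (measurableSet_spanningSets K)
    (iUnion_spanningSets K) hη.measurable hfin
    (hgu.comp (measurable_snd.prodMk (hη.measurable.comp measurable_fst)))),
    hη.mecke_spanningSets hfin (u := fun x ω => g x ω * u (f x ω)) hgu]

theorem IsPoissonProcess.intensity_univ (hη : IsPoissonProcess P η K)
    (hfin : ∀ w n, (η w).1 (spanningSets K n) < ∞)
    (hf : Measurable (fun p : (Fin k → X) × PointConfig X => f p.1 p.2))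
    (hg : Measurable (fun p : (Fin k → X) × PointConfig X => g p.1 p.2)) {L : Measure Y}
    (hL : IsIntensityMeasure P (fun w => inducedProcess f g (η w)) L) :
    L univ = ((k ! : ℕ) : ℝ≥0∞)⁻¹ * ∫⁻ x, ∫⁻ w, g x ((η w).addPoints x) ∂P
      ∂(Measure.pi fun _ => K) := by
  simpa using hη.lintegral_intensity hfin hf hg hL measurable_one

end Intensity

/-! ### The second moment of the induced process -/

section Moments

open Set

variable {Ω X Y : Type*} [MeasurableSpace Ω] [TopologicalSpace X] [MeasurableSpace X]
  [MeasurableSpace Y] {k : ℕ}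

/-- A functional of a Poisson process that is localized to deterministic sets `S_𝐱`. The process
is finite on the spanning sets of its intensity measure everywhere and not just almost surely,
which makes sums over its points measurable. -/
structure LocalSetting (P : Measure Ω) (η : Ω → PointConfig X) (K : Measure X) [SigmaFinite K]
    (f : (Fin k → X) → PointConfig X → Y) (g : (Fin k → X) → PointConfig X → ℝ≥0∞)
    (S : (Fin k → X) → Closeds X) : Prop where
  poisson : IsPoissonProcess P η K
  lt_top : ∀ w n, (η w).1 (spanningSets K n) < ∞
  pos : 1 ≤ k
  measurable_f : Measurable (fun p : (Fin k → X) × PointConfig X => f p.1 p.2)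
  f_symm : ∀ (σ : Equiv.Perm (Fin k)) x ω, f (x ∘ σ) ω = f x ω
  measurable_g : Measurable (fun p : (Fin k → X) × PointConfig X => g p.1 p.2)
  g_symm : ∀ (σ : Equiv.Perm (Fin k)) x ω, g (x ∘ σ) ω = g x ω
  zero_or_one : ∀ x ω, g x ω = 0 ∨ g x ω = 1
  measurable_S : Measurable[_, fellMeasurableSpace X] S
  S_symm : ∀ (σ : Equiv.Perm (Fin k)) x, S (x ∘ σ) = S x
  mem : ∀ x i, x i ∈ S x
  isLocalizedTo : IsLocalizedTo f g (fun x _ => S x)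

variable [LocallyCompactSpace X] [SecondCountableTopology X] [T2Space X] [BorelSpace X]
  {P : Measure Ω} [IsProbabilityMeasure P] {K : Measure X} [SigmaFinite K]
  {η : Ω → PointConfig X} {f : (Fin k → X) → PointConfig X → Y}
  {g : (Fin k → X) → PointConfig X → ℝ≥0∞} {S : (Fin k → X) → Closeds X}

namespace LocalSetting

theorem overlap_self (h : LocalSetting P η K f g S) (x : Fin k → X) : overlap S x x = 1 :=
  overlap_eq_one (h.mem x ⟨0, h.pos⟩) (h.mem x ⟨0, h.pos⟩)

theorem measurable_comp_addPoints (h : LocalSetting P η K f g S) :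
    Measurable fun p : (Fin k → X) × Ω => g p.1 ((η p.2).addPoints p.1) :=
  _root_.measurable_comp_addPoints h.measurable_g h.poisson.measurable

theorem measurable_nearPart (h : LocalSetting P η K f g S) :
    Measurable fun p : (Fin k → X) × (Fin k → X) × PointConfig X =>
      nearPart S g p.1 p.2.1 p.2.2 :=
  ((measurable_overlap h.measurable_S).comp
    (measurable_fst.prodMk (measurable_fst.comp measurable_snd))).mul
    (h.measurable_g.comp measurable_snd)

theorem measurable_farPart (h : LocalSetting P η K f g S) :
    Measurable fun p : (Fin k → X) × (Fin k → X) × PointConfig X =>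
      farPart S g p.1 p.2.1 p.2.2 :=
  (((measurable_overlap h.measurable_S).comp
    (measurable_fst.prodMk (measurable_fst.comp measurable_snd))).const_sub 1).mul
    (h.measurable_g.comp measurable_snd)

/-- Joint measurability of the number of points near `𝐱`. -/
theorem measurable_inducedProcess_nearPart (h : LocalSetting P η K f g S) {A : Type*}
    [MeasurableSpace A] {x : A → Fin k → X} (hx : Measurable x) {ω : A → PointConfig X}
    (hω : Measurable ω) (hfin : ∀ a n, (ω a).1 (spanningSets K n) < ∞) :
    Measurable fun a => inducedProcess f (nearPart S g (x a)) (ω a) univ := by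
  simp_rw [inducedProcess_univ]
  refine Measurable.const_mul (measurable_factorialSum (measurableSet_spanningSets K)
    (iUnion_spanningSets K) hω hfin ?_) _
  have h1 : Measurable fun p : A × (Fin k → X) => (x p.1, p.2, ω p.1) :=
    (hx.comp measurable_fst).prodMk (measurable_snd.prodMk (hω.comp measurable_fst))
  exact h.measurable_nearPart.comp h1

theorem lt_top_addPoints (h : LocalSetting P η K f g S) {m : ℕ} (x : Fin m → X) (w : Ω) (n : ℕ) :
    ((η w).addPoints x).1 (spanningSets K n) < ∞ :=
  PointConfig.addPoints_lt_top (measurableSet_spanningSets K n) (h.lt_top w n) x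

theorem lintegral_ne_top (h : LocalSetting P η K f g S) (x : Fin k → X) :
    ∫⁻ w, g x ((η w).addPoints x) ∂P ≠ ∞ := by
  refine ne_top_of_le_ne_top (b := ∫⁻ _, 1 ∂P) (by simp) (lintegral_mono fun w => ?_)
  rcases h.zero_or_one x ((η w).addPoints x) with h | h <;> simp [h]

theorem lintegral_nearPart (h : LocalSetting P η K f g S) (x : Fin k → X) :
    ∫⁻ w, inducedProcess f (nearPart S g x) (η w) univ ∂P =
      ((k ! : ℕ) : ℝ≥0∞)⁻¹ * ∫⁻ z, overlap S x z * ∫⁻ w, g z ((η w).addPoints z) ∂P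
        ∂(Measure.pi fun _ => K) := by
  have hm : Measurable fun p : (Fin k → X) × PointConfig X => nearPart S g x p.1 p.2 :=
    h.measurable_nearPart.comp measurable_prodMk_left
  simp_rw [inducedProcess_univ]
  rw [lintegral_const_mul _ (measurable_factorialSum (measurableSet_spanningSets K)
    (iUnion_spanningSets K) h.poisson.measurable h.lt_top
    (hm.comp (measurable_snd.prodMk (h.poisson.measurable.comp measurable_fst)))),
    h.poisson.mecke_spanningSets h.lt_top hm]
  congr 1
  refine lintegral_congr fun z => ?_
  simp only [nearPart]
  rw [lintegral_const_mul' _ _ (ne_top_of_le_ne_top ENNReal.one_ne_top (overlap_le_one S x z))]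

/-- Two independent copies of the process: the pairs of points with meeting regions. -/
theorem errorE2_eq (h : LocalSetting P η K f g S) :
    errorE2 P η K g S = 2 * (((k ! : ℕ) : ℝ≥0∞)⁻¹ *
      ∫⁻ x, (∫⁻ w, g x ((η w).addPoints x) ∂P) *
        (∫⁻ w, inducedProcess f (nearPart S g x) (η w) univ ∂P) ∂(Measure.pi fun _ => K)) := by
  have h1 : ∀ x, ∫⁻ z : Fin k → X, overlap S x z * (∫⁻ w, g x ((η w).addPoints x) ∂P) *
      (∫⁻ w, g z ((η w).addPoints z) ∂P) ∂(Measure.pi fun _ => K) =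
      ((k ! : ℕ) : ℝ≥0∞) * ((∫⁻ w, g x ((η w).addPoints x) ∂P) *
        (∫⁻ w, inducedProcess f (nearPart S g x) (η w) univ ∂P)) := by
    intro x
    have : ∀ z, overlap S x z * (∫⁻ w, g x ((η w).addPoints x) ∂P) *
      (∫⁻ w, g z ((η w).addPoints z) ∂P) = (∫⁻ w, g x ((η w).addPoints x) ∂P) *
        (overlap S x z * ∫⁻ w, g z ((η w).addPoints z) ∂P) := fun z => by ring
    simp_rw [this]
    rw [lintegral_const_mul' _ _ (h.lintegral_ne_top x), h.lintegral_nearPart,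
      mul_left_comm _ _ (_ * _),
      ENNReal.mul_inv_cancel_left (by exact_mod_cast Nat.factorial_ne_zero _) (by simp)]
  rw [errorE2, lintegral_congr h1, lintegral_const_mul' _ _ (by simp), ← mul_assoc, ← mul_assoc]
  congr 1
  have h0 : ((k ! : ℕ) : ℝ≥0∞) ≠ 0 := by exact_mod_cast Nat.factorial_ne_zero _
  rw [ENNReal.div_eq_inv_mul, sq, ENNReal.mul_inv (Or.inl h0) (Or.inl (by simp))]
  calc _ = 2 * ((k ! : ℕ) : ℝ≥0∞)⁻¹ * (((k ! : ℕ) : ℝ≥0∞)⁻¹ * ((k ! : ℕ) : ℝ≥0∞)) := by ring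
    _ = _ := by rw [ENNReal.inv_mul_cancel h0 (by simp), mul_one]

end LocalSetting

end Moments

/-! ### Tuples that share points -/

section MixTuple

open Set

variable {X : Type*} {k : ℕ}

theorem mixTuple_zero_mem_range (x : Fin k → X) {I : Finset (Fin k)} (hI : I.Nonempty)
    (z : Fin (k - I.card) → X) (hk : 0 < k) :
    ∃ i, mixTuple x I z ⟨0, hk⟩ = x i :=
  ⟨_, dif_pos (Finset.card_pos.2 hI)⟩

theorem mixTuple_univ (x : Fin k → X) (z : Fin (k - (Finset.univ : Finset (Fin k)).card) → X) :
    ∃ σ : Equiv.Perm (Fin k), mixTuple x Finset.univ z = x ∘ σ := by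
  have hc : (Finset.univ : Finset (Fin k)).card = k := by simp
  let e : Fin k → Fin k := fun j => Finset.univ.orderEmbOfFin rfl ⟨j, by rw [hc]; exact j.2⟩
  have he : Function.Injective e := fun i j hij => by
    have := (Finset.univ.orderEmbOfFin rfl).injective hij
    exact Fin.ext (Fin.mk.inj_iff.1 this)
  refine ⟨Equiv.ofBijective e (Finite.injective_iff_bijective.1 he), ?_⟩
  ext j
  exact dif_pos (by rw [hc]; exact j.2)

theorem mixTuple_empty (x : Fin k → X) (z : Fin (k - (∅ : Finset (Fin k)).card) → X) :
    mixTuple x ∅ z = fun j => z (Fin.cast (by simp) j) := by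
  ext j
  exact dif_neg (by simp)

theorem lintegral_pi_cast [MeasurableSpace X] (K : Measure X) [SigmaFinite K] {m : ℕ} (h : m = k)
    (F : (Fin m → X) → ℝ≥0∞) :
    ∫⁻ z, F z ∂(Measure.pi fun _ => K) =
      ∫⁻ z : Fin k → X, F (fun j => z (Fin.cast h j)) ∂(Measure.pi fun _ => K) := by
  subst h
  rfl

theorem PointConfig.addPoints_cast [MeasurableSpace X] (ω : PointConfig X) {m : ℕ} (h : m = k)
    (z : Fin k → X) : ω.addPoints (fun j : Fin m => z (Fin.cast h j)) = ω.addPoints z := by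
  subst h
  rfl

theorem PointConfig.addPoints_of_eq_zero [MeasurableSpace X] (ω : PointConfig X) {m : ℕ}
    (h : m = 0) (z : Fin m → X) : ω.addPoints z = ω := by
  subst h
  exact ext_measure fun B hB => by simp [addPoints_apply _ _ hB]

theorem lintegral_pi_const_of_eq_zero [MeasurableSpace X] (K : Measure X) [SigmaFinite K] {m : ℕ}
    (h : m = 0) (c : ℝ≥0∞) : ∫⁻ _ : Fin m → X, c ∂(Measure.pi fun _ => K) = c := by
  subst h
  simp

theorem measurable_mixTuple [MeasurableSpace X] (I : Finset (Fin k)) :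
    Measurable fun p : (Fin k → X) × (Fin (k - I.card) → X) => mixTuple p.1 I p.2 := by
  refine measurable_pi_lambda _ fun j => ?_
  by_cases hj : (j : ℕ) < I.card
  · simp only [mixTuple, dif_pos hj]
    exact (measurable_pi_apply _).comp measurable_fst
  · simp only [mixTuple, dif_neg hj]
    exact (measurable_pi_apply _).comp measurable_snd

end MixTuple

section SecondMoment

open Set

variable {Ω X Y : Type*} [MeasurableSpace Ω] [TopologicalSpace X] [MeasurableSpace X]
  [MeasurableSpace Y] {k : ℕ}
  [LocallyCompactSpace X] [SecondCountableTopology X] [T2Space X] [BorelSpace X]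
  {P : Measure Ω} [IsProbabilityMeasure P] {K : Measure X} [SigmaFinite K]
  {η : Ω → PointConfig X} {f : (Fin k → X) → PointConfig X → Y}
  {g : (Fin k → X) → PointConfig X → ℝ≥0∞} {S : (Fin k → X) → Closeds X}

namespace LocalSetting

/-- The contribution to the second moment of the pairs of tuples with meeting regions, the second
of which shares with the first tuple `𝐱` exactly the entries with index in `I`. -/
noncomputable def pairMoment (P : Measure Ω) (η : Ω → PointConfig X) (K : Measure X)
    (g : (Fin k → X) → PointConfig X → ℝ≥0∞) (S : (Fin k → X) → Closeds X)
    (I : Finset (Fin k)) : ℝ≥0∞ :=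
  ∫⁻ x : Fin k → X, ∫⁻ z : Fin (k - I.card) → X, ∫⁻ w,
    g x (((η w).addPoints x).addPoints z) *
      nearPart S g x (mixTuple x I z) (((η w).addPoints x).addPoints z)
    ∂P ∂(Measure.pi fun _ => K) ∂(Measure.pi fun _ => K)

/-- The tuples of points of `η + δ_𝐱` are sorted by the entries that they share with `𝐱`, and the
remaining entries are integrated out by the Mecke equation. -/
theorem lintegral_mul_factorialSum_nearPart (h : LocalSetting P η K f g S) (x : Fin k → X) :
    ∫⁻ w, g x ((η w).addPoints x) * factorialSum (fun z => nearPart S g x z ((η w).addPoints x))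
        ((η w).addPoints x) ∂P =
      ∑ I : Finset (Fin k), ((k ! : ℕ) : ℝ≥0∞) / ((k - I.card) ! : ℕ) *
        ∫⁻ z : Fin (k - I.card) → X, ∫⁻ w, g x (((η w).addPoints x).addPoints z) *
          nearPart S g x (mixTuple x I z) (((η w).addPoints x).addPoints z)
          ∂P ∂(Measure.pi fun _ => K) := by
  have hu : ∀ I : Finset (Fin k), Measurable fun p : (Fin (k - I.card) → X) × PointConfig X =>
      g x (p.2.addPoints x) * nearPart S g x (mixTuple x I p.1) (p.2.addPoints x) := by
    intro I
    have h1 : Measurable fun p : (Fin (k - I.card) → X) × PointConfig X => p.2.addPoints x :=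
      measurable_snd.addPoints measurable_const
    have h2 : Measurable fun p : (Fin (k - I.card) → X) × PointConfig X => mixTuple x I p.1 :=
      (measurable_mixTuple I).comp (measurable_const.prodMk measurable_fst)
    have h3 : Measurable fun p : (Fin (k - I.card) → X) × PointConfig X =>
        (x, p.2.addPoints x) := measurable_const.prodMk h1
    have h4 : Measurable fun p : (Fin (k - I.card) → X) × PointConfig X =>
        (x, mixTuple x I p.1, p.2.addPoints x) := measurable_const.prodMk (h2.prodMk h1)
    exact (h.measurable_g.comp h3).mul (h.measurable_nearPart.comp h4)
  have h1 : ∀ w, g x ((η w).addPoints x) *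
      factorialSum (fun z => nearPart S g x z ((η w).addPoints x)) ((η w).addPoints x) =
      ∑ I : Finset (Fin k), ((k ! : ℕ) : ℝ≥0∞) / ((k - I.card) ! : ℕ) *
        factorialSum (fun z : Fin (k - I.card) → X => g x ((η w).addPoints x) *
          nearPart S g x (mixTuple x I z) ((η w).addPoints x)) (η w) := by
    intro w
    rw [factorialSum_addPoints (fun σ z => nearPart_symm h.g_symm h.S_symm x σ z _),
      Finset.mul_sum]
    refine Finset.sum_congr rfl fun I _ => ?_
    rw [mul_left_comm]
    congr 1
    exact ENNReal.tsum_mul_left.symm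
  simp_rw [h1]
  have h2 : ∀ I : Finset (Fin k), Measurable fun w =>
      factorialSum (fun z : Fin (k - I.card) → X => g x ((η w).addPoints x) *
          nearPart S g x (mixTuple x I z) ((η w).addPoints x)) (η w) := fun I =>
    measurable_factorialSum (measurableSet_spanningSets K) (iUnion_spanningSets K)
      h.poisson.measurable h.lt_top
      ((hu I).comp (measurable_snd.prodMk (h.poisson.measurable.comp measurable_fst)))
  rw [lintegral_finsetSum _ fun I _ => (h2 I).const_mul _]
  refine Finset.sum_congr rfl fun I _ => ?_
  rw [lintegral_const_mul _ (h2 I)]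
  congr 1
  rw [h.poisson.mecke_spanningSets h.lt_top (u := fun z ω => g x (ω.addPoints x) *
    nearPart S g x (mixTuple x I z) (ω.addPoints x)) (hu I)]
  simp_rw [PointConfig.addPoints_comm _ x]

theorem measurable_pairMoment_integrand (h : LocalSetting P η K f g S) (I : Finset (Fin k)) :
    Measurable fun x : Fin k → X => ∫⁻ z : Fin (k - I.card) → X, ∫⁻ w,
      g x (((η w).addPoints x).addPoints z) *
        nearPart S g x (mixTuple x I z) (((η w).addPoints x).addPoints z)
      ∂P ∂(Measure.pi fun _ => K) := by
  have h0 : Measurable fun q : ((Fin k → X) × (Fin (k - I.card) → X)) × Ω =>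
      ((η q.2).addPoints q.1.1).addPoints q.1.2 :=
    ((h.poisson.measurable.comp measurable_snd).addPoints
      (measurable_fst.comp measurable_fst)).addPoints (measurable_snd.comp measurable_fst)
  have h1 : Measurable fun q : ((Fin k → X) × (Fin (k - I.card) → X)) × Ω =>
      (q.1.1, ((η q.2).addPoints q.1.1).addPoints q.1.2) :=
    (measurable_fst.comp measurable_fst).prodMk h0
  have h2 : Measurable fun q : ((Fin k → X) × (Fin (k - I.card) → X)) × Ω =>
      (q.1.1, mixTuple q.1.1 I q.1.2, ((η q.2).addPoints q.1.1).addPoints q.1.2) :=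
    (measurable_fst.comp measurable_fst).prodMk
      (((measurable_mixTuple I).comp measurable_fst).prodMk h0)
  exact ((h.measurable_g.comp h1).mul
    (h.measurable_nearPart.comp h2)).lintegral_prod_right'.lintegral_prod_right'

theorem pairMoment_empty :
    pairMoment P η K g S ∅ = ∫⁻ x : Fin k → X, ∫⁻ z : Fin k → X,
      overlap S x z * (∫⁻ w, g x (((η w).addPoints x).addPoints z) *
        g z (((η w).addPoints x).addPoints z) ∂P)
      ∂(Measure.pi fun _ => K) ∂(Measure.pi fun _ => K) := by
  have hc : k - (∅ : Finset (Fin k)).card = k := by simp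
  refine lintegral_congr fun x => ?_
  rw [lintegral_pi_cast K hc]
  refine lintegral_congr fun z => ?_
  rw [← lintegral_const_mul' _ _ (ne_top_of_le_ne_top ENNReal.one_ne_top (overlap_le_one S x z))]
  refine lintegral_congr fun w => ?_
  have hz : mixTuple x ∅ (fun j => z (Fin.cast hc j)) = z := by
    rw [mixTuple_empty]; rfl
  rw [hz, PointConfig.addPoints_cast _ hc, nearPart]
  ring

/-- The second tuple is a permutation of the first one. -/
theorem pairMoment_univ (h : LocalSetting P η K f g S) :
    pairMoment P η K g S Finset.univ =
      ∫⁻ x, ∫⁻ w, g x ((η w).addPoints x) ∂P ∂(Measure.pi fun _ => K) := by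
  have hc : k - (Finset.univ : Finset (Fin k)).card = 0 := by simp
  refine lintegral_congr fun x => ?_
  rw [← lintegral_pi_const_of_eq_zero K hc (∫⁻ w, g x ((η w).addPoints x) ∂P)]
  refine lintegral_congr fun z => lintegral_congr fun w => ?_
  obtain ⟨σ, hσ⟩ := mixTuple_univ x z
  rw [hσ, nearPart_symm h.g_symm h.S_symm, nearPart, h.overlap_self, one_mul,
    PointConfig.addPoints_of_eq_zero _ hc]
  rcases h.zero_or_one x ((η w).addPoints x) with h | h <;> simp [h]

/-- Tuples with a common entry have meeting regions. -/
theorem nearPart_mixTuple (h : LocalSetting P η K f g S) (x : Fin k → X) {I : Finset (Fin k)}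
    (hI : I.Nonempty) (z : Fin (k - I.card) → X) (ω : PointConfig X) :
    nearPart S g x (mixTuple x I z) ω = g (mixTuple x I z) ω := by
  obtain ⟨i, hi⟩ := mixTuple_zero_mem_range x hI z h.pos
  have h1 := h.mem (mixTuple x I z) ⟨0, h.pos⟩
  rw [hi] at h1
  rw [nearPart, overlap_eq_one (h.mem x i) h1, one_mul]

/-- The pairs of points of the process with meeting regions, by the number of shared entries:
`E₃` collects the disjoint tuples, `E₄` those with some but not all entries in common, and the
intensity the pairs of equal points. -/
theorem lintegral_nearPart_addPoints (h : LocalSetting P η K f g S) {L : Measure Y}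
    (hL : IsIntensityMeasure P (fun w => inducedProcess f g (η w)) L) :
    2 * (((k ! : ℕ) : ℝ≥0∞)⁻¹ * ∫⁻ x, ∫⁻ w, g x ((η w).addPoints x) *
        inducedProcess f (nearPart S g x) ((η w).addPoints x) univ ∂P
          ∂(Measure.pi fun _ => K)) =
      2 * L univ + errorE3 P η K g S + errorE4 P η K g := by
  classical
  have h0 : ((k ! : ℕ) : ℝ≥0∞) ≠ 0 := by exact_mod_cast Nat.factorial_ne_zero _
  have ht : ((k ! : ℕ) : ℝ≥0∞) ≠ ∞ := by simp
  have hit : ((k ! : ℕ) : ℝ≥0∞)⁻¹ ≠ ∞ := ENNReal.inv_ne_top.2 h0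
  have h1 : ∫⁻ x, ∫⁻ w, g x ((η w).addPoints x) *
        inducedProcess f (nearPart S g x) ((η w).addPoints x) univ ∂P ∂(Measure.pi fun _ => K) =
      ∑ I : Finset (Fin k), 1 / (((k - I.card) ! : ℕ) : ℝ≥0∞) * pairMoment P η K g S I := by
    simp_rw [inducedProcess_univ, mul_left_comm _ ((k ! : ℕ) : ℝ≥0∞)⁻¹]
    simp_rw [lintegral_const_mul' _ _ hit, h.lintegral_mul_factorialSum_nearPart]
    rw [lintegral_finsetSum _ fun I _ => (h.measurable_pairMoment_integrand I).const_mul _,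
      Finset.mul_sum]
    refine Finset.sum_congr rfl fun I _ => ?_
    rw [lintegral_const_mul _ (h.measurable_pairMoment_integrand I), ← mul_assoc,
      div_eq_mul_inv, ← mul_assoc, ENNReal.inv_mul_cancel h0 ht, one_mul, one_div]
    rfl
  have hne : (∅ : Finset (Fin k)) ≠ Finset.univ := by
    have : Nonempty (Fin k) := ⟨⟨0, h.pos⟩⟩
    exact Finset.univ_nonempty.ne_empty.symm
  have h2 : (Finset.univ : Finset (Finset (Fin k))) = insert ∅ (insert Finset.univ
      ((Finset.univ : Finset (Finset (Fin k))).filter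
        (fun I => I.Nonempty ∧ I ≠ Finset.univ))) := by
    ext I
    rcases I.eq_empty_or_nonempty with hI | hI <;> by_cases hI' : I = Finset.univ <;>
      simp [hI, hI']
  rw [h1, h2, Finset.sum_insert (by simp [hne]), Finset.sum_insert (by simp),
    pairMoment_empty, h.pairMoment_univ, h.poisson.intensity_univ h.lt_top h.measurable_f
      h.measurable_g hL, errorE3, errorE4]
  have h3 : ∀ I ∈ (Finset.univ : Finset (Finset (Fin k))).filter
      (fun I => I.Nonempty ∧ I ≠ Finset.univ), pairMoment P η K g S I =
      ∫⁻ x : Fin k → X, ∫⁻ z : Fin (k - I.card) → X, ∫⁻ w,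
        g x (((η w).addPoints x).addPoints z) *
          g (mixTuple x I z) (((η w).addPoints x).addPoints z)
        ∂P ∂(Measure.pi fun _ => K) ∂(Measure.pi fun _ => K) := by
    intro I hI
    simp only [pairMoment, h.nearPart_mixTuple _ (Finset.mem_filter.1 hI).2.1]
  rw [Finset.sum_congr rfl fun I hI => by rw [h3 I hI]]
  simp only [Finset.card_empty, Finset.card_univ, Fintype.card_fin, tsub_zero, tsub_self,
    Nat.factorial_zero, Nat.cast_one, div_one, one_mul, mul_add]
  rw [ENNReal.div_eq_inv_mul (a := 2) (b := ((k ! : ℕ) : ℝ≥0∞) ^ 2), sq,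
    ENNReal.mul_inv (Or.inl h0) (Or.inl ht), ENNReal.div_eq_inv_mul (a := 2), one_div]
  ring

/-- The points of `η` in `S_𝐱` together with the points of `η'` outside `S_𝐱`. -/
noncomputable def splice (S : (Fin k → X) → Closeds X) (x : Fin k → X) (ω ω' : PointConfig X) :
    PointConfig X := ω.restrict (S x) + ω'.restrict (S x : Set X)ᶜ

theorem splice_restrict_compl (x : Fin k → X) (ω ω' : PointConfig X) :
    (splice S x ω ω').restrict (S x : Set X)ᶜ = ω'.restrict (S x : Set X)ᶜ := by
  have hS := (S x).isClosed.measurableSet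
  refine PointConfig.ext_measure fun B hB => ?_
  rw [PointConfig.restrict_apply _ hB, splice, PointConfig.add_apply,
    PointConfig.restrict_apply _ (hB.inter hS.compl),
    PointConfig.restrict_apply _ (hB.inter hS.compl), PointConfig.restrict_apply _ hB,
    inter_assoc, inter_assoc, compl_inter_self, inter_empty, inter_self]
  simp

theorem splice_lt_top (h : LocalSetting P η K f g S) (x : Fin k → X) (w w' : Ω) (n : ℕ) :
    (splice S x (η w) (η w')).1 (spanningSets K n) < ∞ := by
  have hD := measurableSet_spanningSets K n
  rw [splice, PointConfig.add_apply, PointConfig.restrict_apply _ hD,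
    PointConfig.restrict_apply _ hD, ENNReal.add_lt_top]
  exact ⟨(measure_mono inter_subset_left).trans_lt (h.lt_top w n),
    (measure_mono inter_subset_left).trans_lt (h.lt_top w' n)⟩

/-- The functional of the points in `S_𝐱` of one copy of the process does not notice if the other
copy is replaced by the one that agrees with the first outside `S_𝐱`. -/
theorem lintegral_resample (h : LocalSetting P η K f g S) (x : Fin k → X)
    {v : Y → PointConfig X → ℝ≥0∞} (hv : Measurable fun p : Y × PointConfig X => v p.1 p.2) :
    ∫⁻ w', ∫⁻ w, g x ((η w').addPoints x) * v (f x ((η w').addPoints x)) (η w) ∂P ∂P =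
      ∫⁻ w', ∫⁻ w, g x ((η w').addPoints x) *
        v (f x ((η w').addPoints x)) (splice S x (η w) (η w')) ∂P ∂P := by
  have h1 : Measurable fun p : PointConfig X × PointConfig X => (x, p.1.addPoints x) :=
    measurable_const.prodMk (measurable_fst.addPoints measurable_const)
  have hu : Measurable fun p : PointConfig X × PointConfig X =>
      g x (p.1.addPoints x) * v (f x (p.1.addPoints x)) p.2 :=
    (h.measurable_g.comp h1).mul (hv.comp ((h.measurable_f.comp h1).prodMk measurable_snd))
  have h2 := h.poisson.lintegral_resample (S x).isClosed.measurableSet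
    (u := fun α ω => g x (α.addPoints x) * v (f x (α.addPoints x)) ω) hu
  have h3 : ∀ w' ω, g x (((η w').restrict (S x)).addPoints x) *
      v (f x (((η w').restrict (S x)).addPoints x)) ω =
      g x ((η w').addPoints x) * v (f x ((η w').addPoints x)) ω := by
    intro w' ω
    obtain ⟨h4, h5⟩ := h.isLocalizedTo.addPoints_restrict h.mem x (η w')
    rw [← h4]
    rcases h.zero_or_one x ((η w').addPoints x) with h0 | h0
    · rw [h0, zero_mul, zero_mul]
    · rw [h5 h0]
  simp only [h3] at h2
  exact h2

theorem farPart_splice (h : LocalSetting P η K f g S) (x : Fin k → X) (ω ω' : PointConfig X) :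
    inducedProcess f (farPart S g x) (splice S x ω ω') =
      inducedProcess f (farPart S g x) ω' := by
  rw [← inducedProcess_farPart_restrict h.isLocalizedTo h.zero_or_one h.mem x (splice S x ω ω'),
    splice_restrict_compl, inducedProcess_farPart_restrict h.isLocalizedTo h.zero_or_one h.mem]

theorem farPart_addPoints (h : LocalSetting P η K f g S) (x : Fin k → X) (ω : PointConfig X) :
    inducedProcess f (farPart S g x) (ω.addPoints x) = inducedProcess f (farPart S g x) ω := by
  have hS := (S x).isClosed.measurableSet
  rw [← inducedProcess_farPart_restrict h.isLocalizedTo h.zero_or_one h.mem x (ω.addPoints x),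
    PointConfig.restrict_addPoints_of_notMem _ hS.compl fun i => not_not.2 (h.mem x i),
    inducedProcess_farPart_restrict h.isLocalizedTo h.zero_or_one h.mem]

/-- On all configurations, the induced process is made measurable by truncation. -/
theorem measurable_inducedProcess_truncOn
    (hf : Measurable (fun p : (Fin k → X) × PointConfig X => f p.1 p.2))
    (hg : Measurable (fun p : (Fin k → X) × PointConfig X => g p.1 p.2)) :
    Measurable fun ω => inducedProcess f g (PointConfig.truncOn (spanningSets K) ω) :=
  _root_.measurable_inducedProcess hf hg (measurableSet_spanningSets K) (iUnion_spanningSets K)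
    (PointConfig.measurable_truncOn (measurableSet_spanningSets K))
    (PointConfig.truncOn_lt_top _)

/-- The points of the process far from `𝐱` are independent of the value of `g` at `𝐱`. -/
theorem lintegral_mul_farPart (h : LocalSetting P η K f g S) (x : Fin k → X) :
    ∫⁻ w, g x ((η w).addPoints x) * inducedProcess f (farPart S g x) (η w) univ ∂P =
      (∫⁻ w, g x ((η w).addPoints x) ∂P) *
        ∫⁻ w, inducedProcess f (farPart S g x) (η w) univ ∂P := by
  have hfar : Measurable fun p : (Fin k → X) × PointConfig X => farPart S g x p.1 p.2 :=
    h.measurable_farPart.comp measurable_prodMk_left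
  have hm := (Measure.measurable_coe MeasurableSet.univ).comp
    (measurable_inducedProcess_truncOn (K := K) h.measurable_f hfar)
  have h1 := h.lintegral_resample x (v := fun _ ω => inducedProcess f (farPart S g x)
    (PointConfig.truncOn (spanningSets K) ω) univ) (hm.comp measurable_snd)
  simp only [PointConfig.truncOn_eq (h.lt_top _), PointConfig.truncOn_eq (h.splice_lt_top x _ _),
    h.farPart_splice, lintegral_const, measure_univ, mul_one] at h1
  have hgx : Measurable fun w => g x ((η w).addPoints x) :=
    h.measurable_comp_addPoints.comp measurable_prodMk_left
  rw [← h1, ← lintegral_mul_const _ hgx]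
  refine lintegral_congr fun w => lintegral_const_mul' _ _ ?_
  rcases h.zero_or_one x ((η w).addPoints x) with h | h <;> simp [h]

/-- One of the two factors is a sum over tuples, to which the Mecke equation applies. -/
theorem lintegral_sq (h : LocalSetting P η K f g S) :
    ∫⁻ w, (inducedProcess f g (η w) univ) ^ 2 ∂P = ((k ! : ℕ) : ℝ≥0∞)⁻¹ *
      ∫⁻ x, ∫⁻ w, g x ((η w).addPoints x) * inducedProcess f g ((η w).addPoints x) univ ∂P
        ∂(Measure.pi fun _ => K) := by
  have hit : ((k ! : ℕ) : ℝ≥0∞)⁻¹ ≠ ∞ :=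
    ENNReal.inv_ne_top.2 (by exact_mod_cast Nat.factorial_ne_zero _)
  have hm : Measurable fun ω => inducedProcess f g (PointConfig.truncOn (spanningSets K) ω) univ :=
    (Measure.measurable_coe MeasurableSet.univ).comp
      (measurable_inducedProcess_truncOn (K := K) h.measurable_f h.measurable_g)
  have hu : Measurable fun p : (Fin k → X) × PointConfig X => g p.1 p.2 *
      inducedProcess f g (PointConfig.truncOn (spanningSets K) p.2) univ :=
    h.measurable_g.mul (hm.comp measurable_snd)
  have h1 := h.poisson.mecke_spanningSets h.lt_top (u := fun x ω => g x ω *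
    inducedProcess f g (PointConfig.truncOn (spanningSets K) ω) univ) hu
  simp only [PointConfig.truncOn_eq (h.lt_top _),
    PointConfig.truncOn_eq (h.lt_top_addPoints _ _)] at h1
  rw [← h1, ← lintegral_const_mul' _ _ hit]
  refine lintegral_congr fun w => ?_
  rw [sq]
  nth_rewrite 1 [inducedProcess_univ]
  rw [mul_assoc]
  congr 1
  exact ENNReal.tsum_mul_right.symm

theorem measurable_nearPart_comp (h : LocalSetting P η K f g S) :
    Measurable fun p : (Fin k → X) × Ω =>
      inducedProcess f (nearPart S g p.1) (η p.2) univ :=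
  h.measurable_inducedProcess_nearPart measurable_fst (h.poisson.measurable.comp measurable_snd)
    fun p => h.lt_top p.2

theorem measurable_nearPart_comp_addPoints (h : LocalSetting P η K f g S) :
    Measurable fun p : (Fin k → X) × Ω =>
      inducedProcess f (nearPart S g p.1) ((η p.2).addPoints p.1) univ :=
  h.measurable_inducedProcess_nearPart measurable_fst
    ((h.poisson.measurable.comp measurable_snd).addPoints measurable_fst)
    fun p => h.lt_top_addPoints p.1 p.2

theorem measurable_mul_nearPart_comp_addPoints (h : LocalSetting P η K f g S) :
    Measurable fun p : (Fin k → X) × Ω => g p.1 ((η p.2).addPoints p.1) *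
      inducedProcess f (nearPart S g p.1) ((η p.2).addPoints p.1) univ :=
  h.measurable_comp_addPoints.mul h.measurable_nearPart_comp_addPoints

theorem measurable_lintegral_comp_addPoints (h : LocalSetting P η K f g S) :
    Measurable fun x => ∫⁻ w, g x ((η w).addPoints x) ∂P :=
  h.measurable_comp_addPoints.lintegral_prod_right'

theorem measurable_lintegral_mul_nearPart (h : LocalSetting P η K f g S) :
    Measurable fun x => (∫⁻ w, g x ((η w).addPoints x) ∂P) *
        ∫⁻ w, inducedProcess f (nearPart S g x) (η w) univ ∂P :=
  h.measurable_lintegral_comp_addPoints.mul h.measurable_nearPart_comp.lintegral_prod_right'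

theorem lintegral_mul_induced (h : LocalSetting P η K f g S) (x : Fin k → X) :
    ∫⁻ w, g x ((η w).addPoints x) * inducedProcess f g ((η w).addPoints x) univ ∂P =
      ∫⁻ w, g x ((η w).addPoints x) *
        inducedProcess f (nearPart S g x) ((η w).addPoints x) univ ∂P +
      (∫⁻ w, g x ((η w).addPoints x) ∂P) *
        ∫⁻ w, inducedProcess f (farPart S g x) (η w) univ ∂P := by
  have hm : Measurable fun w => g x ((η w).addPoints x) *
      inducedProcess f (nearPart S g x) ((η w).addPoints x) univ :=
    h.measurable_mul_nearPart_comp_addPoints.of_uncurry_left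
      (f := fun x w => g x ((η w).addPoints x) *
        inducedProcess f (nearPart S g x) ((η w).addPoints x) univ)
  rw [← h.lintegral_mul_farPart, ← lintegral_add_left hm]
  refine lintegral_congr fun w => ?_
  rw [← mul_add, ← h.farPart_addPoints, add_comm (inducedProcess f (nearPart S g x) _ univ),
    ← Measure.add_apply, inducedProcess_farPart_add_nearPart]

theorem lintegral_farPart_add_nearPart (h : LocalSetting P η K f g S) {L : Measure Y}
    (hL : IsIntensityMeasure P (fun w => inducedProcess f g (η w)) L) (x : Fin k → X) :
    ∫⁻ w, inducedProcess f (farPart S g x) (η w) univ ∂P +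
      ∫⁻ w, inducedProcess f (nearPart S g x) (η w) univ ∂P = L univ := by
  have hm : Measurable fun w => inducedProcess f (nearPart S g x) (η w) univ :=
    h.measurable_nearPart_comp.of_uncurry_left
      (f := fun x w => inducedProcess f (nearPart S g x) (η w) univ)
  rw [hL univ MeasurableSet.univ, ← lintegral_add_right _ hm]
  refine lintegral_congr fun w => ?_
  rw [← Measure.add_apply, inducedProcess_farPart_add_nearPart]

/-- The second moment of the number of points. The far parts factorize by the spatial
independence of the Poisson process. -/
theorem lintegral_sq_add (h : LocalSetting P η K f g S) {L : Measure Y}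
    (hL : IsIntensityMeasure P (fun w => inducedProcess f g (η w)) L) :
    2 * ∫⁻ w, (inducedProcess f g (η w) univ) ^ 2 ∂P + errorE2 P η K g S =
      2 * L univ ^ 2 + (2 * L univ + errorE3 P η K g S + errorE4 P η K g) := by
  have hmB : Measurable fun x => ∫⁻ w, g x ((η w).addPoints x) *
        inducedProcess f (nearPart S g x) ((η w).addPoints x) univ ∂P :=
    h.measurable_mul_nearPart_comp_addPoints.lintegral_prod_right'
  have e5 : ((k ! : ℕ) : ℝ≥0∞)⁻¹ * ∫⁻ x, (∫⁻ w, g x ((η w).addPoints x) ∂P) *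
        (∫⁻ w, inducedProcess f (farPart S g x) (η w) univ ∂P) ∂(Measure.pi fun _ => K) +
      ((k ! : ℕ) : ℝ≥0∞)⁻¹ * ∫⁻ x, (∫⁻ w, g x ((η w).addPoints x) ∂P) *
        (∫⁻ w, inducedProcess f (nearPart S g x) (η w) univ ∂P) ∂(Measure.pi fun _ => K) =
      L univ ^ 2 := by
    rw [← mul_add, ← lintegral_add_right _ h.measurable_lintegral_mul_nearPart]
    simp_rw [← mul_add, h.lintegral_farPart_add_nearPart hL]
    rw [lintegral_mul_const _ h.measurable_lintegral_comp_addPoints, ← mul_assoc,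
      ← h.poisson.intensity_univ h.lt_top h.measurable_f h.measurable_g hL, sq]
  rw [h.lintegral_sq, lintegral_congr h.lintegral_mul_induced, lintegral_add_left hmB,
    ← h.lintegral_nearPart_addPoints hL, h.errorE2_eq, ← e5]
  ring

end LocalSetting

end SecondMoment

/-! ### Random measures as finite configurations -/

section ToFinPointConfig

open Set

variable {A Y : Type*} [MeasurableSpace A] [MeasurableSpace Y]

theorem toFinPointConfig_val {μ : Measure Y} (hμ : IsCountingMeasure μ) (h : μ univ < ∞) :
    (toFinPointConfig μ).1 = μ := by
  rw [toFinPointConfig, dif_pos ⟨⟨h⟩, hμ⟩]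

theorem toFinPointConfig_of_eq_top {μ : Measure Y} (h : μ univ = ∞) :
    (toFinPointConfig μ).1 = 0 := by
  rw [toFinPointConfig, dif_neg]
  rintro ⟨⟨h'⟩, -⟩
  exact h'.ne h

theorem measurable_toFinPointConfig {μ : A → Measure Y} (hm : Measurable μ)
    (hc : ∀ a, IsCountingMeasure (μ a)) : Measurable fun a => toFinPointConfig (μ a) := by
  classical
  refine FinPointConfig.measurable_iff.2 fun B hB => ?_
  have h : (fun a => (toFinPointConfig (μ a)).1 B) =
      fun a => if μ a univ < ∞ then μ a B else 0 := by
    ext a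
    split_ifs with h
    · rw [toFinPointConfig_val (hc a) h]
    · rw [toFinPointConfig_of_eq_top (not_lt_top_iff.1 h)]; simp
  rw [h]
  exact Measurable.ite (measurableSet_lt ((Measure.measurable_coe MeasurableSet.univ).comp hm)
    measurable_const) ((Measure.measurable_coe hB).comp hm) measurable_const

/-- This also holds for infinite `ν`, when both sides are empty. -/
theorem toFinPointConfig_add_dirac_remove [MeasurableSingletonClass Y] {ν : Measure Y}
    (hν : IsCountingMeasure ν) (y : Y) :
    (toFinPointConfig (ν + Measure.dirac y)).remove y = toFinPointConfig ν := by
  refine Subtype.ext ?_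
  change (toFinPointConfig (ν + Measure.dirac y)).1.removePoint y = _
  rcases eq_or_ne (ν univ) ∞ with h | h
  · rw [toFinPointConfig_of_eq_top h, toFinPointConfig_of_eq_top (by simp [h]), removePoint_zero]
  · rw [toFinPointConfig_val hν h.lt_top,
      toFinPointConfig_val (hν.add (isCountingMeasure_dirac y))
        (by rw [Measure.add_apply]; exact ENNReal.add_lt_top.2 ⟨h.lt_top, by simp⟩),
      removePoint_add_dirac_self]

end ToFinPointConfig

/-! ### The coupling with the reduced Palm process -/

section Coupling

open Set

variable {Ω X Y : Type*} [MeasurableSpace Ω] [TopologicalSpace X] [MeasurableSpace X]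
  [MeasurableSpace Y] {k : ℕ}
  [LocallyCompactSpace X] [SecondCountableTopology X] [T2Space X] [BorelSpace X]
  [TopologicalSpace Y] [SecondCountableTopology Y] [T2Space Y] [BorelSpace Y]
  {P : Measure Ω} [IsProbabilityMeasure P] {K : Measure X} [SigmaFinite K]
  {η : Ω → PointConfig X} {f : (Fin k → X) → PointConfig X → Y}
  {g : (Fin k → X) → PointConfig X → ℝ≥0∞} {S : (Fin k → X) → Closeds X}

theorem lintegral_add_add {A : Type*} [MeasurableSpace A] {μ : Measure A} (u : A → ℝ≥0∞)
    {v v' : A → ℝ≥0∞} (hv : Measurable v) (hv' : Measurable v') :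
    ∫⁻ a, (u a + (v a + v' a)) ∂μ = ∫⁻ a, u a ∂μ + (∫⁻ a, v a ∂μ + ∫⁻ a, v' a ∂μ) := by
  rw [← lintegral_add_left hv]
  exact lintegral_add_right _ (hv.add hv')

namespace LocalSetting

theorem isCountingMeasure (h : LocalSetting P η K f g S) (ω : PointConfig X) :
    IsCountingMeasure (inducedProcess f g ω) :=
  isCountingMeasure_inducedProcess h.f_symm h.g_symm h.zero_or_one ω

theorem isCountingMeasure_nearPart (h : LocalSetting P η K f g S) (x : Fin k → X)
    (ω : PointConfig X) : IsCountingMeasure (inducedProcess f (nearPart S g x) ω) :=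
  isCountingMeasure_inducedProcess h.f_symm
    (fun σ z ω => nearPart_symm h.g_symm h.S_symm x σ z ω)
    (fun z ω => nearPart_zero_or_one h.zero_or_one x z ω) ω

theorem isCountingMeasure_farPart (h : LocalSetting P η K f g S) (x : Fin k → X)
    (ω : PointConfig X) : IsCountingMeasure (inducedProcess f (farPart S g x) ω) := by
  refine isCountingMeasure_inducedProcess h.f_symm (fun σ z ω => ?_) (fun z ω => ?_) ω
  · rw [farPart, farPart, overlap, overlap, h.g_symm, h.S_symm]
  · rcases overlap_zero_or_one S x z with h1 | h1 <;> rcases h.zero_or_one z ω with h2 | h2 <;>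
      simp [farPart, h1, h2]

/-- Given a point of the process at a tuple `𝐱`, the process without this point agrees with the
process of any configuration with the same points outside `S_𝐱`, unless one of the two has a
(further) point near `𝐱`. -/
theorem remove_eq_or_two_le (h : LocalSetting P η K f g S) {x : Fin k → X} {ω ω' : PointConfig X}
    (hx : g x (ω'.addPoints x) = 1)
    (hfar : inducedProcess f (farPart S g x) ω = inducedProcess f (farPart S g x) ω') :
    1 ≤ inducedProcess f (nearPart S g x) (ω'.addPoints x) univ ∧
    ((toFinPointConfig (inducedProcess f g (ω'.addPoints x))).remove (f x (ω'.addPoints x)) =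
        toFinPointConfig (inducedProcess f g ω) ∨
      2 ≤ inducedProcess f (nearPart S g x) (ω'.addPoints x) univ +
        inducedProcess f (nearPart S g x) ω univ) := by
  set N₁ := inducedProcess f (nearPart S g x) (ω'.addPoints x)
  set N₂ := inducedProcess f (nearPart S g x) ω with hN₂
  set y := f x (ω'.addPoints x)
  have hle : Measure.dirac y ≤ N₁ := dirac_le_inducedProcess_addPoints h.f_symm
    (fun σ z ω => nearPart_symm h.g_symm h.S_symm x σ z ω) ω' x
    (by rw [nearPart, h.overlap_self, one_mul, hx])
  have h1 : 1 ≤ N₁ univ := by simpa using hle univ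
  refine ⟨h1, or_iff_not_imp_right.2 fun h2 => ?_⟩
  have hN2 : N₂ = 0 := by
    by_contra hne
    have := (h.isCountingMeasure_nearPart x ω).one_le_of_ne_zero MeasurableSet.univ
      (fun h0 => hne (Measure.measure_univ_eq_zero.1 h0))
    exact h2 (by rw [← one_add_one_eq_two]; exact add_le_add h1 this)
  have hN1 : Measure.dirac y = N₁ := by
    refine Measure.eq_of_le_of_measure_univ_eq hle ?_
    rw [measure_univ]
    obtain ⟨n, hn⟩ := h.isCountingMeasure_nearPart x (ω'.addPoints x) univ MeasurableSet.univ
    change N₁ univ = n at hn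
    rw [hN2, Measure.coe_zero, Pi.zero_apply, add_zero, hn] at h2
    rw [hn] at h1 ⊢
    refine le_antisymm h1 ?_
    have h3 : ¬ (2 : ℕ∞) ≤ n := fun h => h2 (by exact_mod_cast h)
    have h4 : n ≤ 1 := by
      rw [← one_add_one_eq_two, ENat.add_one_le_iff (by simp), not_lt] at h3
      exact h3
    exact_mod_cast h4
  rw [← inducedProcess_farPart_add_nearPart (S := S) x ω,
    ← inducedProcess_farPart_add_nearPart (S := S) x (ω'.addPoints x), h.farPart_addPoints, hfar,
    ← hN₂, hN2, add_zero]
  change (toFinPointConfig (_ + N₁)).remove y = _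
  rw [← hN1]
  exact toFinPointConfig_add_dirac_remove (h.isCountingMeasure_farPart x ω') y

theorem measurable_splice (x : Fin k → X) (hη : Measurable η) :
    Measurable fun p : Ω × Ω => splice S x (η p.2) (η p.1) := by
  have hS := (S x).isClosed.measurableSet
  exact PointConfig.measurable_add.comp
    (((PointConfig.measurable_restrict hS).comp (hη.comp measurable_snd)).prodMk
      ((PointConfig.measurable_restrict hS.compl).comp (hη.comp measurable_fst)))

/-- Points near `𝐱` in an independent copy of the process. -/
theorem lintegral_mul_nearPart_splice (h : LocalSetting P η K f g S) (x : Fin k → X) :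
    ∫⁻ w', ∫⁻ w, g x ((η w').addPoints x) *
        inducedProcess f (nearPart S g x) (splice S x (η w) (η w')) univ ∂P ∂P =
      (∫⁻ w, g x ((η w).addPoints x) ∂P) *
        ∫⁻ w, inducedProcess f (nearPart S g x) (η w) univ ∂P := by
  have hnear : Measurable fun p : (Fin k → X) × PointConfig X => nearPart S g x p.1 p.2 :=
    h.measurable_nearPart.comp measurable_prodMk_left
  have hm : Measurable fun ω => inducedProcess f (nearPart S g x)
      (PointConfig.truncOn (spanningSets K) ω) univ :=
    (Measure.measurable_coe MeasurableSet.univ).comp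
      (measurable_inducedProcess_truncOn (K := K) h.measurable_f hnear)
  have h1 := h.lintegral_resample x (v := fun _ ω => inducedProcess f (nearPart S g x)
    (PointConfig.truncOn (spanningSets K) ω) univ) (hm.comp measurable_snd)
  simp only [PointConfig.truncOn_eq (h.lt_top _),
    PointConfig.truncOn_eq (h.splice_lt_top x _ _)] at h1
  have hgx : Measurable fun w => g x ((η w).addPoints x) :=
    h.measurable_comp_addPoints.of_uncurry_left (f := fun x w => g x ((η w).addPoints x))
  rw [← h1, ← lintegral_mul_const _ hgx]
  refine lintegral_congr fun w => lintegral_const_mul' _ _ ?_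
  rcases h.zero_or_one x ((η w).addPoints x) with h | h <;> simp [h]

/-- If two functions on `P ⊗ P` are bounded by `2` and differ only where there are points near `𝐱`,
then their integrals are close. -/
theorem lintegral_le_of_near (h : LocalSetting P η K f g S) (x : Fin k → X) {p q : Ω → Ω → ℝ≥0∞}
    (hp : ∀ w' w, p w' w ≤ 2)
    (hpq : ∀ w' w, g x ((η w').addPoints x) = 1 → p w' w = q w' w ∨
      2 ≤ inducedProcess f (nearPart S g x) ((η w').addPoints x) univ +
        inducedProcess f (nearPart S g x) (splice S x (η w) (η w')) univ) :
    ∫⁻ w', ∫⁻ w, g x ((η w').addPoints x) * p w' w ∂P ∂P +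
        2 * ∫⁻ w, g x ((η w).addPoints x) ∂P ≤
      ∫⁻ w', ∫⁻ w, g x ((η w').addPoints x) * q w' w ∂P ∂P +
        (2 * ∫⁻ w, g x ((η w).addPoints x) *
            inducedProcess f (nearPart S g x) ((η w).addPoints x) univ ∂P +
          2 * ((∫⁻ w, g x ((η w).addPoints x) ∂P) *
            ∫⁻ w, inducedProcess f (nearPart S g x) (η w) univ ∂P)) := by
  set a : Ω → ℝ≥0∞ := fun w' => g x ((η w').addPoints x)
  set n₁ : Ω → ℝ≥0∞ := fun w' => inducedProcess f (nearPart S g x) ((η w').addPoints x) univ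
  set n₂ : Ω → Ω → ℝ≥0∞ := fun w' w =>
    inducedProcess f (nearPart S g x) (splice S x (η w) (η w')) univ
  have ham : Measurable a :=
    h.measurable_comp_addPoints.of_uncurry_left (f := fun x w => g x ((η w).addPoints x))
  have hn₁ : Measurable fun w' => a w' * n₁ w' :=
    h.measurable_mul_nearPart_comp_addPoints.of_uncurry_left
      (f := fun x w => g x ((η w).addPoints x) *
        inducedProcess f (nearPart S g x) ((η w).addPoints x) univ)
  have hn₂ : Measurable fun p : Ω × Ω => n₂ p.1 p.2 :=
    h.measurable_inducedProcess_nearPart (x := fun _ : Ω × Ω => x) measurable_const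
      (measurable_splice x h.poisson.measurable) fun p => h.splice_lt_top x p.2 p.1
  have han₂ : Measurable fun p : Ω × Ω => a p.1 * n₂ p.1 p.2 :=
    (ham.comp measurable_fst).mul hn₂
  have key : ∀ w' w, a w' * p w' w + 2 * a w' ≤
      a w' * q w' w + (2 * (a w' * n₁ w') + 2 * (a w' * n₂ w' w)) := by
    intro w' w
    rcases h.zero_or_one x ((η w').addPoints x) with h0 | h0
    · have : a w' = 0 := h0
      simp [this]
    · have h1 : a w' = 1 := h0
      simp only [h1, one_mul, mul_one]
      -- if `p` and `q` agree, the added `2` is covered by the point of the process at `𝐱` itself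
      rcases hpq w' w h0 with h2 | h2
      · have h3 : 1 ≤ n₁ w' := (h.remove_eq_or_two_le (ω := splice S x (η w) (η w')) h0
          (h.farPart_splice x _ _)).1
        rw [h2]
        gcongr
        calc (2 : ℝ≥0∞) = 2 * 1 := by ring
          _ ≤ 2 * n₁ w' := by gcongr
          _ ≤ _ := le_self_add
      · calc p w' w + 2 ≤ 2 + 2 := by gcongr; exact hp w' w
          _ = 2 * 2 := by norm_num
          _ ≤ 2 * (n₁ w' + n₂ w' w) := by gcongr
          _ = 2 * n₁ w' + 2 * n₂ w' w := mul_add _ _ _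
          _ ≤ _ := le_add_self
  rw [← h.lintegral_mul_nearPart_splice x, ← lintegral_const_mul _ ham,
    ← lintegral_const_mul _ hn₁, ← lintegral_const_mul _ han₂.lintegral_prod_right',
    ← lintegral_add_right _ (ham.const_mul 2),
    ← lintegral_add_add _ (hn₁.const_mul 2) (han₂.lintegral_prod_right'.const_mul 2)]
  refine lintegral_mono fun w' => ?_
  have hw : Measurable fun w => a w' * n₂ w' w :=
    han₂.of_uncurry_left (f := fun w' w => a w' * n₂ w' w)
  calc _ = ∫⁻ w, (a w' * p w' w + 2 * a w') ∂P := by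
        rw [lintegral_add_right _ measurable_const, lintegral_const, measure_univ, mul_one]
    _ ≤ ∫⁻ w, (a w' * q w' w + (2 * (a w' * n₁ w') + 2 * (a w' * n₂ w' w))) ∂P :=
        lintegral_mono fun w => key w' w
    _ = _ := by
        rw [lintegral_add_add _ measurable_const (hw.const_mul 2), lintegral_const, measure_univ,
          mul_one, lintegral_const_mul _ hw]

/-- The sum over all tuples of the bound of `lintegral_le_of_near`. -/
theorem lintegral_le_add_errors (h : LocalSetting P η K f g S) {L : Measure Y}
    (hL : IsIntensityMeasure P (fun w => inducedProcess f g (η w)) L) (hL_fin : L univ ≠ ∞)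
    {u v : (Fin k → X) → ℝ≥0∞}
    (huv : ∀ x, u x + 2 * ∫⁻ w, g x ((η w).addPoints x) ∂P ≤ v x +
      (2 * ∫⁻ w, g x ((η w).addPoints x) *
            inducedProcess f (nearPart S g x) ((η w).addPoints x) univ ∂P +
          2 * ((∫⁻ w, g x ((η w).addPoints x) ∂P) *
            ∫⁻ w, inducedProcess f (nearPart S g x) (η w) univ ∂P))) :
    ((k ! : ℕ) : ℝ≥0∞)⁻¹ * ∫⁻ x, u x ∂(Measure.pi fun _ => K) ≤
      ((k ! : ℕ) : ℝ≥0∞)⁻¹ * ∫⁻ x, v x ∂(Measure.pi fun _ => K) +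
        (errorE2 P η K g S + errorE3 P η K g S + errorE4 P η K g) := by
  have hm1 := h.measurable_lintegral_comp_addPoints
  have hm2 : Measurable fun x => ∫⁻ w, g x ((η w).addPoints x) *
        inducedProcess f (nearPart S g x) ((η w).addPoints x) univ ∂P :=
    h.measurable_mul_nearPart_comp_addPoints.lintegral_prod_right'
  have hm3 := h.measurable_lintegral_mul_nearPart
  have h1 := mul_le_mul_right (lintegral_mono (μ := Measure.pi fun _ => K) huv)
    ((k ! : ℕ) : ℝ≥0∞)⁻¹
  rw [lintegral_add_right _ (hm1.const_mul 2), lintegral_const_mul _ hm1,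
    lintegral_add_add _ (hm2.const_mul 2) (hm3.const_mul 2), lintegral_const_mul _ hm2,
    lintegral_const_mul _ hm3,
    mul_add, mul_add, mul_add, mul_left_comm _ 2, mul_left_comm _ 2, mul_left_comm _ 2,
    ← h.poisson.intensity_univ h.lt_top h.measurable_f h.measurable_g hL,
    h.lintegral_nearPart_addPoints hL, ← h.errorE2_eq] at h1
  have h2 : (2 : ℝ≥0∞) * L univ ≠ ∞ := ENNReal.mul_ne_top (by simp) hL_fin
  refine (ENNReal.add_le_add_iff_right h2).1 (h1.trans (le_of_eq ?_))
  ring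

/-- The Palm expectation `𝔼 ∫ G(y, ξ - δ_y) ξ(dy)`, as an integral over tuples. -/
theorem lintegral_remove_eq (h : LocalSetting P η K f g S) {G : Y → FinPointConfig Y → ℝ≥0∞}
    (hG : Measurable fun p : Y × FinPointConfig Y => G p.1 p.2) :
    ∫⁻ w, ∫⁻ y, G y ((toFinPointConfig (inducedProcess f g (η w))).remove y)
        ∂(inducedProcess f g (η w)) ∂P =
      ((k ! : ℕ) : ℝ≥0∞)⁻¹ * ∫⁻ x, ∫⁻ w, g x ((η w).addPoints x) *
        G (f x ((η w).addPoints x)) ((toFinPointConfig (inducedProcess f g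
          ((η w).addPoints x))).remove (f x ((η w).addPoints x))) ∂P
            ∂(Measure.pi fun _ => K) := by
  have hit : ((k ! : ℕ) : ℝ≥0∞)⁻¹ ≠ ∞ :=
    ENNReal.inv_ne_top.2 (by exact_mod_cast Nat.factorial_ne_zero _)
  have hm : Measurable fun ω => toFinPointConfig (inducedProcess f g
      (PointConfig.truncOn (spanningSets K) ω)) := measurable_toFinPointConfig
    (measurable_inducedProcess_truncOn (K := K) h.measurable_f h.measurable_g)
    fun ω => h.isCountingMeasure _
  have hr : Measurable fun p : (Fin k → X) × PointConfig X => (toFinPointConfig (inducedProcess f g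
      (PointConfig.truncOn (spanningSets K) p.2))).remove (f p.1 p.2) :=
    (hm.comp measurable_snd).remove h.measurable_f
  have hu : Measurable fun p : (Fin k → X) × PointConfig X => g p.1 p.2 *
      G (f p.1 p.2) ((toFinPointConfig (inducedProcess f g
      (PointConfig.truncOn (spanningSets K) p.2))).remove (f p.1 p.2)) :=
    h.measurable_g.mul (hG.comp (h.measurable_f.prodMk hr))
  have h1 := h.poisson.mecke_spanningSets h.lt_top (u := fun x ω => g x ω *
      G (f x ω) ((toFinPointConfig (inducedProcess f g
      (PointConfig.truncOn (spanningSets K) ω))).remove (f x ω))) hu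
  simp only [PointConfig.truncOn_eq (h.lt_top _),
    PointConfig.truncOn_eq (h.lt_top_addPoints _ _)] at h1
  rw [← h1, ← lintegral_const_mul' _ _ hit]
  refine lintegral_congr fun w => ?_
  have hw : Measurable fun y => G y ((toFinPointConfig (inducedProcess f g (η w))).remove y) :=
    hG.comp (measurable_id.prodMk (measurable_const.remove measurable_id))
  rw [lintegral_inducedProcess _ hw]

/-- The expectation `𝔼 ∫ G(y, ξ) L(dy)`, as an integral over tuples and two independent copies. -/
theorem lintegral_intensity_eq (h : LocalSetting P η K f g S) {L : Measure Y}
    (hL : IsIntensityMeasure P (fun w => inducedProcess f g (η w)) L)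
    {G : Y → FinPointConfig Y → ℝ≥0∞}
    (hG : Measurable fun p : Y × FinPointConfig Y => G p.1 p.2) :
    ∫⁻ w, ∫⁻ y, G y (toFinPointConfig (inducedProcess f g (η w))) ∂L ∂P =
      ((k ! : ℕ) : ℝ≥0∞)⁻¹ * ∫⁻ x, ∫⁻ w', ∫⁻ w, g x ((η w').addPoints x) *
        G (f x ((η w').addPoints x)) (toFinPointConfig (inducedProcess f g (η w))) ∂P ∂P
            ∂(Measure.pi fun _ => K) := by
  have hit : ((k ! : ℕ) : ℝ≥0∞)⁻¹ ≠ ∞ :=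
    ENNReal.inv_ne_top.2 (by exact_mod_cast Nat.factorial_ne_zero _)
  have hξ : Measurable fun w => toFinPointConfig (inducedProcess f g (η w)) :=
    measurable_toFinPointConfig (h.poisson.measurable_induced h.lt_top h.measurable_f
      h.measurable_g) fun w => h.isCountingMeasure _
  have hfx : Measurable fun p : (Fin k → X) × Ω => f p.1 ((η p.2).addPoints p.1) :=
    _root_.measurable_comp_addPoints h.measurable_f h.poisson.measurable
  have hm : Measurable fun p : ((Fin k → X) × Ω) × Ω => g p.1.1 ((η p.1.2).addPoints p.1.1) *
      G (f p.1.1 ((η p.1.2).addPoints p.1.1))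
        (toFinPointConfig (inducedProcess f g (η p.2))) :=
    (h.measurable_comp_addPoints.comp measurable_fst).mul
      (hG.comp ((hfx.comp measurable_fst).prodMk (hξ.comp measurable_snd)))
  have h1 : ∀ w, ∫⁻ y, G y (toFinPointConfig (inducedProcess f g (η w))) ∂L =
      ((k ! : ℕ) : ℝ≥0∞)⁻¹ * ∫⁻ x, ∫⁻ w', g x ((η w').addPoints x) *
        G (f x ((η w').addPoints x)) (toFinPointConfig (inducedProcess f g (η w))) ∂P
          ∂(Measure.pi fun _ => K) := fun w =>
    h.poisson.lintegral_intensity h.lt_top h.measurable_f h.measurable_g hL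
      (hG.comp (measurable_id.prodMk measurable_const))
  simp_rw [h1]
  rw [lintegral_const_mul' _ _ hit]
  congr 1
  have hm2 : Measurable fun p : Ω × ((Fin k → X) × Ω) =>
      g p.2.1 ((η p.2.2).addPoints p.2.1) * G (f p.2.1 ((η p.2.2).addPoints p.2.1))
        (toFinPointConfig (inducedProcess f g (η p.1))) := hm.comp measurable_swap
  have hm3 : Measurable fun q : (Ω × (Fin k → X)) × Ω => g q.1.2 ((η q.2).addPoints q.1.2) *
      G (f q.1.2 ((η q.2).addPoints q.1.2))
        (toFinPointConfig (inducedProcess f g (η q.1.1))) :=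
    hm2.comp ((measurable_fst.comp measurable_fst).prodMk
      ((measurable_snd.comp measurable_fst).prodMk measurable_snd))
  rw [lintegral_lintegral_swap (f := fun w x => ∫⁻ w', g x ((η w').addPoints x) *
        G (f x ((η w').addPoints x)) (toFinPointConfig (inducedProcess f g (η w))) ∂P)
      hm3.lintegral_prod_right'.aemeasurable]
  refine lintegral_congr fun x => ?_
  have hm4 : Measurable fun q : Ω × Ω => g x ((η q.2).addPoints x) *
      G (f x ((η q.2).addPoints x)) (toFinPointConfig (inducedProcess f g (η q.1))) :=
    hm2.comp (measurable_fst.prodMk (measurable_const.prodMk measurable_snd))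
  exact lintegral_lintegral_swap hm4.aemeasurable

/-- The main estimate of the coupling: `𝔼 ∫ G(y, ξ - δ_y) ξ(dy)` and `𝔼 ∫ G(y, ξ) L(dy)` differ by
at most `E₂ + E₃ + E₄`. -/
theorem coupling_bounds (h : LocalSetting P η K f g S) {L : Measure Y}
    (hL : IsIntensityMeasure P (fun w => inducedProcess f g (η w)) L) (hL_fin : L univ ≠ ∞)
    {G : Y → FinPointConfig Y → ℝ≥0∞}
    (hG : Measurable fun p : Y × FinPointConfig Y => G p.1 p.2) (hG2 : ∀ y ω, G y ω ≤ 2) :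
    (∫⁻ w, ∫⁻ y, G y ((toFinPointConfig (inducedProcess f g (η w))).remove y)
        ∂(inducedProcess f g (η w)) ∂P ≤
      ∫⁻ w, ∫⁻ y, G y (toFinPointConfig (inducedProcess f g (η w))) ∂L ∂P +
        (errorE2 P η K g S + errorE3 P η K g S + errorE4 P η K g)) ∧
    (∫⁻ w, ∫⁻ y, G y (toFinPointConfig (inducedProcess f g (η w))) ∂L ∂P ≤
      ∫⁻ w, ∫⁻ y, G y ((toFinPointConfig (inducedProcess f g (η w))).remove y)
        ∂(inducedProcess f g (η w)) ∂P +
        (errorE2 P η K g S + errorE3 P η K g S + errorE4 P η K g)) := by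
  have hm : Measurable fun ω => toFinPointConfig (inducedProcess f g
      (PointConfig.truncOn (spanningSets K) ω)) := measurable_toFinPointConfig
    (measurable_inducedProcess_truncOn (K := K) h.measurable_f h.measurable_g)
    fun ω => h.isCountingMeasure _
  have hv : Measurable fun p : Y × PointConfig X => G p.1 (toFinPointConfig (inducedProcess f g
      (PointConfig.truncOn (spanningSets K) p.2))) :=
    hG.comp (measurable_fst.prodMk (hm.comp measurable_snd))
  have hres : ∀ x, ∫⁻ w', ∫⁻ w, g x ((η w').addPoints x) * G (f x ((η w').addPoints x))
        (toFinPointConfig (inducedProcess f g (η w))) ∂P ∂P =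
      ∫⁻ w', ∫⁻ w, g x ((η w').addPoints x) * G (f x ((η w').addPoints x))
        (toFinPointConfig (inducedProcess f g (splice S x (η w) (η w')))) ∂P ∂P := by
    intro x
    have h1 := h.lintegral_resample x (v := fun y ω => G y (toFinPointConfig
      (inducedProcess f g (PointConfig.truncOn (spanningSets K) ω)))) hv
    simpa only [PointConfig.truncOn_eq (h.lt_top _),
      PointConfig.truncOn_eq (h.splice_lt_top x _ _)] using h1
  have hconst : ∀ x, ∫⁻ w, g x ((η w).addPoints x) *
        G (f x ((η w).addPoints x)) ((toFinPointConfig (inducedProcess f g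
          ((η w).addPoints x))).remove (f x ((η w).addPoints x))) ∂P =
      ∫⁻ w', ∫⁻ _, g x ((η w').addPoints x) *
        G (f x ((η w').addPoints x)) ((toFinPointConfig (inducedProcess f g
          ((η w').addPoints x))).remove (f x ((η w').addPoints x))) ∂P ∂P := fun x => by
    simp only [lintegral_const, measure_univ, mul_one]
  have hcases := fun x w' w (h0 : g x ((η w').addPoints x) = 1) =>
    (h.remove_eq_or_two_le (ω := splice S x (η w) (η w')) h0 (h.farPart_splice x _ _)).2
  rw [h.lintegral_remove_eq hG, h.lintegral_intensity_eq hL hG]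
  refine ⟨h.lintegral_le_add_errors hL hL_fin fun x => ?_,
    h.lintegral_le_add_errors hL hL_fin fun x => ?_⟩
  · rw [hres, hconst]
    exact h.lintegral_le_of_near x (fun _ _ => hG2 _ _) fun w' w h0 =>
      (hcases x w' w h0).imp_left fun h1 => by rw [h1]
  · rw [hres, hconst]
    exact h.lintegral_le_of_near x (fun _ _ => hG2 _ _) fun w' w h0 =>
      (hcases x w' w h0).imp_left fun h1 => by rw [h1]

end LocalSetting

end Coupling

/-! ### Total variation and Lipschitz functionals -/

section TotalVariation

open Set

variable {Y : Type*} [MeasurableSpace Y]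

theorem tvDist_le_ofReal {μ ν : Measure Y} {r : ℝ}
    (h : ∀ B, MeasurableSet B → |(μ B).toReal - (ν B).toReal| ≤ r) :
    tvDist μ ν ≤ ENNReal.ofReal r :=
  iSup₂_le fun B hB => ENNReal.ofReal_le_ofReal (h B hB.1)

theorem tvDist_ne_top (μ ν : Measure Y) [IsFiniteMeasure μ] [IsFiniteMeasure ν] :
    tvDist μ ν ≠ ∞ := by
  refine ne_top_of_le_ne_top ENNReal.ofReal_ne_top
    (tvDist_le_ofReal (r := μ.real univ + ν.real univ) fun B _ => ?_)
  have h1 : μ.real B ≤ μ.real univ := measureReal_mono (subset_univ B)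
  have h2 : ν.real B ≤ ν.real univ := measureReal_mono (subset_univ B)
  have h3 : 0 ≤ μ.real B := measureReal_nonneg
  have h4 : 0 ≤ ν.real B := measureReal_nonneg
  change |μ.real B - ν.real B| ≤ _
  exact abs_le.2 ⟨by linarith, by linarith⟩

theorem abs_measureReal_sub_le_tvDist (μ ν : Measure Y) [IsFiniteMeasure μ] [IsFiniteMeasure ν]
    {B : Set Y} (hB : MeasurableSet B) : |μ.real B - ν.real B| ≤ (tvDist μ ν).toReal :=
  (ENNReal.ofReal_le_iff_le_toReal (tvDist_ne_top μ ν)).1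
    (le_iSup₂_of_le (f := fun (A : Set Y) (_ : MeasurableSet A ∧ μ A < ∞ ∧ ν A < ∞) =>
      ENNReal.ofReal |(μ A).toReal - (ν A).toReal|) B
      ⟨hB, measure_lt_top _ _, measure_lt_top _ _⟩ le_rfl)

theorem setIntegral_sub_le_of_restrict_le {μ ν : Measure Y} [IsFiniteMeasure μ] [IsFiniteMeasure ν]
    {A : Set Y} (hle : ν.restrict A ≤ μ.restrict A) {u : Y → ℝ} (hu : Measurable u) {C s : ℝ}
    (hC : ∀ y, |u y| ≤ C) (hs : ∀ y, u y ≤ s) :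
    ∫ y in A, u y ∂μ - ∫ y in A, u y ∂ν ≤ s * (μ.real A - ν.real A) := by
  have hi : ∀ m : Measure Y, IsFiniteMeasure m → Integrable u (m.restrict A) := fun m _ =>
    integrable_of_bound hu hC
  have h := integral_mono_measure hle (f := fun y => s - u y)
    (Filter.Eventually.of_forall fun y => sub_nonneg.2 (hs y))
    ((integrable_const s).sub (hi μ inferInstance))
  rw [integral_sub (integrable_const s) (hi μ inferInstance),
    integral_sub (integrable_const s) (hi ν inferInstance)] at h
  simp only [integral_const, measureReal_restrict_apply MeasurableSet.univ, univ_inter,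
    smul_eq_mul] at h
  linarith

/-- A function with values in `[-1, 1]` and oscillation at most `1` integrates to at most the total
variation distance. -/
theorem integral_sub_le_of_osc_le {μ ν : Measure Y} [IsFiniteMeasure μ] [IsFiniteMeasure ν]
    {t : ℝ} (ht : ∀ B, MeasurableSet B → |μ.real B - ν.real B| ≤ t) {u : Y → ℝ} (hu : Measurable u)
    (hb : ∀ y, |u y| ≤ 1) (hosc : ∀ y z, u y - u z ≤ 1) :
    ∫ y, u y ∂μ - ∫ y, u y ∂ν ≤ t := by
  rcases isEmpty_or_nonempty Y with hY | hY
  · rw [Measure.eq_zero_of_isEmpty μ, Measure.eq_zero_of_isEmpty ν]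
    simpa using (abs_nonneg _).trans (ht ∅ MeasurableSet.empty)
  have hbdd : BddAbove (range u) := ⟨1, by rintro _ ⟨y, rfl⟩; exact (abs_le.1 (hb y)).2⟩
  set s := ⨆ y, u y
  have hs : ∀ y, u y ≤ s := fun y => le_ciSup hbdd y
  have hi : ∀ y, s - 1 ≤ u y := fun y => by
    have : s ≤ u y + 1 := ciSup_le fun z => by linarith [hosc z y]
    linarith
  have hs1 : s ≤ 1 := ciSup_le fun y => (abs_le.1 (hb y)).2
  have hs2 : 0 ≤ s ∨ s < 0 := le_or_gt 0 s
  -- `u` takes values in `[s - 1, s]`; integrate the upper bound where `μ ≥ ν` and the lower bound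
  -- where `ν ≥ μ`
  obtain ⟨A, hA⟩ := exists_isHahnDecomposition ν μ
  have h1 := setIntegral_sub_le_of_restrict_le hA.le_on hu hb hs
  have h2 := setIntegral_sub_le_of_restrict_le hA.ge_on_compl hu.neg (s := 1 - s)
    (fun y => by rw [Pi.neg_apply, abs_neg]; exact hb y)
    (fun y => by have := hi y; simp only [Pi.neg_apply]; linarith)
  simp only [Pi.neg_apply, integral_neg] at h2
  have h3 := abs_le.1 (ht A hA.measurableSet)
  have h4 := abs_le.1 (ht Aᶜ hA.measurableSet.compl)
  have hint : ∀ m : Measure Y, IsFiniteMeasure m → Integrable u m := fun m _ =>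
    integrable_of_bound hu hb
  rw [← integral_add_compl hA.measurableSet (hint μ inferInstance),
    ← integral_add_compl hA.measurableSet (hint ν inferInstance)]
  have h5 : 0 ≤ μ.real A - ν.real A := by
    have := hA.le_on univ
    simp only [Measure.restrict_apply_univ] at this
    exact sub_nonneg.2 (ENNReal.toReal_mono (measure_ne_top _ _) this)
  have h6 : 0 ≤ ν.real Aᶜ - μ.real Aᶜ := by
    have := hA.ge_on_compl univ
    simp only [Measure.restrict_apply_univ] at this
    exact sub_nonneg.2 (ENNReal.toReal_mono (measure_ne_top _ _) this)
  rcases hs2 with hs2 | hs2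
  · nlinarith [mul_le_mul_of_nonneg_left h3.2 hs2,
      mul_le_mul_of_nonneg_left h4.1 (sub_nonneg.2 hs1)]
  · -- here `u` is negative, and `-u ≤ 1`
    have h7 := setIntegral_sub_le_of_restrict_le hA.ge_on_compl hu.neg (s := 1)
      (fun y => by rw [Pi.neg_apply, abs_neg]; exact hb y)
      (fun y => by have := (abs_le.1 (hb y)).1; simp only [Pi.neg_apply]; linarith)
    simp only [Pi.neg_apply, integral_neg] at h7
    nlinarith [mul_nonneg (neg_nonneg.2 hs2.le) h5]

theorem abs_integral_sub_le_tvDist {μ ν : Measure Y} [IsFiniteMeasure μ] [IsFiniteMeasure ν]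
    {u : Y → ℝ} (hu : Measurable u) (hb : ∀ y, |u y| ≤ 1) (hosc : ∀ y z, u y - u z ≤ 1) :
    |∫ y, u y ∂μ - ∫ y, u y ∂ν| ≤ (tvDist μ ν).toReal := by
  have h := fun (B : Set Y) hB => abs_measureReal_sub_le_tvDist μ ν (B := B) hB
  refine abs_le.2 ⟨?_, integral_sub_le_of_osc_le h hu hb hosc⟩
  have := integral_sub_le_of_osc_le (μ := ν) (ν := μ)
    (fun B hB => by rw [abs_sub_comm]; exact h B hB) hu hb hosc
  linarith

theorem abs_sub_le_of_mem_lipFunctionals {h : FinPointConfig Y → ℝ} (hh : h ∈ LipFunctionals Y)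
    {ω ω' : FinPointConfig Y} {r : ℝ} (hr : 0 ≤ r)
    (hB : ∀ B, MeasurableSet B → |ω.1.real B - ω'.1.real B| ≤ r) : |h ω - h ω'| ≤ r :=
  (ENNReal.ofReal_le_ofReal_iff hr).1 ((hh.2 ω ω').trans (tvDist_le_ofReal hB))

theorem abs_addPoint_sub_le {h : FinPointConfig Y → ℝ} (hh : h ∈ LipFunctionals Y)
    (ω : FinPointConfig Y) (y : Y) : |h (ω.addPoint y) - h ω| ≤ 1 := by
  refine abs_sub_le_of_mem_lipFunctionals hh zero_le_one fun B _ => ?_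
  rw [FinPointConfig.addPoint, measureReal_add_apply, add_sub_cancel_left,
    abs_of_nonneg measureReal_nonneg]
  exact measureReal_le_one

theorem addPoint_sub_addPoint_le {h : FinPointConfig Y → ℝ} (hh : h ∈ LipFunctionals Y)
    (ω : FinPointConfig Y) (y z : Y) : h (ω.addPoint y) - h (ω.addPoint z) ≤ 1 := by
  refine (le_abs_self _).trans (abs_sub_le_of_mem_lipFunctionals hh zero_le_one fun B _ => ?_)
  rw [FinPointConfig.addPoint, FinPointConfig.addPoint, measureReal_add_apply,
    measureReal_add_apply, add_sub_add_left_eq_sub]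
  have h1 : (Measure.dirac y).real B ≤ 1 := measureReal_le_one
  have h2 : (Measure.dirac z).real B ≤ 1 := measureReal_le_one
  have h3 : 0 ≤ (Measure.dirac y).real B := measureReal_nonneg
  have h4 : 0 ≤ (Measure.dirac z).real B := measureReal_nonneg
  exact abs_le.2 ⟨by linarith, by linarith⟩

theorem abs_sub_le_of_eq_add {h : FinPointConfig Y → ℝ} (hh : h ∈ LipFunctionals Y)
    {ω ω' : FinPointConfig Y} {ρ : Measure Y} (hρ : ω.1 = ω'.1 + ρ) :
    |h ω - h ω'| ≤ ρ.real univ := by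
  have : IsFiniteMeasure ρ := ⟨by
    have := measure_lt_top ω.1 univ
    rw [hρ, Measure.add_apply, ENNReal.add_lt_top] at this
    exact this.2⟩
  refine abs_sub_le_of_mem_lipFunctionals hh measureReal_nonneg fun B _ => ?_
  rw [hρ, measureReal_add_apply, add_sub_cancel_left, abs_of_nonneg measureReal_nonneg]
  exact measureReal_mono (subset_univ B)

end TotalVariation

/-! ### Poisson approximation from the coupling bounds -/

section Approximation

open Set Filter

variable {Ω Ω' Y : Type*} [MeasurableSpace Ω] [MeasurableSpace Ω'] [MeasurableSpace Y]
  {P : Measure Ω} [IsProbabilityMeasure P]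

/-- The expected integral of a function with values in `[-1, 1]` with respect to a random measure,
by a shift to nonnegative functions. -/
theorem integral_integral_eq {m : Ω → Measure Y} (hfin : ∀ w, IsFiniteMeasure (m w))
    (hm1 : Measurable fun w => m w univ) (hm : ∫⁻ w, m w univ ∂P ≠ ∞) {v : Ω → Y → ℝ}
    (hv : ∀ w, Measurable (v w)) (hb : ∀ w y, |v w y| ≤ 1)
    (hvm : Measurable fun w => ∫⁻ y, ENNReal.ofReal (v w y + 1) ∂(m w)) :
    Integrable (fun w => ∫ y, v w y ∂(m w)) P ∧
      ∫ w, ∫ y, v w y ∂(m w) ∂P =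
        (∫⁻ w, ∫⁻ y, ENNReal.ofReal (v w y + 1) ∂(m w) ∂P).toReal -
          (∫⁻ w, m w univ ∂P).toReal := by
  have h1 : ∀ w, ∫ y, v w y ∂(m w) =
      (∫⁻ y, ENNReal.ofReal (v w y + 1) ∂(m w)).toReal - (m w univ).toReal := by
    intro w
    have := hfin w
    rw [← integral_eq_lintegral_of_nonneg_ae
      (Eventually.of_forall fun y => by
        have := (abs_le.1 (hb w y)).1
        simp only [Pi.zero_apply]
        linarith)
      ((hv w).add_const 1).aestronglyMeasurable,
      integral_add (integrable_of_bound (hv w) (hb w)) (integrable_const 1)]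
    simp [Measure.real]
  have h2 : ∀ w, ∫⁻ y, ENNReal.ofReal (v w y + 1) ∂(m w) ≤ 2 * m w univ := fun w => by
    rw [← lintegral_const]
    refine lintegral_mono fun y => ENNReal.ofReal_le_of_le_toReal ?_
    have := (abs_le.1 (hb w y)).2
    simp only [ENNReal.toReal_ofNat]; linarith
  have h3 : ∫⁻ w, ∫⁻ y, ENNReal.ofReal (v w y + 1) ∂(m w) ∂P ≠ ∞ := by
    refine ne_top_of_le_ne_top ?_ (lintegral_mono h2)
    rw [lintegral_const_mul _ hm1]
    exact ENNReal.mul_ne_top (by simp) hm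
  have i1 := integrable_toReal_of_lintegral_ne_top hvm.aemeasurable h3
  have i2 := integrable_toReal_of_lintegral_ne_top hm1.aemeasurable hm
  simp_rw [h1]
  refine ⟨i1.sub i2, ?_⟩
  rw [integral_sub i1 i2, integral_toReal hvm.aemeasurable (ae_lt_top hvm h3),
    integral_toReal hm1.aemeasurable (ae_lt_top hm1 hm)]

variable [TopologicalSpace Y] [SecondCountableTopology Y] [T2Space Y] [BorelSpace Y]

/-- The expectation of the Stein equation. -/
theorem integral_stein {M : Measure Y} [IsFiniteMeasure M] {R : Ω → FinPointConfig Y}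
    (hR : Measurable R) (hmass : ∫⁻ w, (R w).1 univ ∂P ≠ ∞) {g : Y → FinPointConfig Y → ℝ}
    (hg : Measurable fun p : Y × FinPointConfig Y => g p.1 p.2) (hgb : ∀ y ω, |g y ω| ≤ 1)
    {h : FinPointConfig Y → ℝ} {c : ℝ}
    (hc : ∀ ω, h ω - c = ∫ x, g x (ω.remove x) ∂ω.1 - ∫ z, g z ω ∂M) :
    Integrable (fun w => h (R w)) P ∧
      ∫ w, h (R w) ∂P - c =
        ((∫⁻ w, ∫⁻ y, ENNReal.ofReal (g y ((R w).remove y) + 1) ∂(R w).1 ∂P).toReal -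
          (∫⁻ w, (R w).1 univ ∂P).toReal) - ∫ w, ∫ z, g z (R w) ∂M ∂P := by
  have hm : Measurable fun p : Ω × Y => g p.2 ((R p.1).remove p.2) :=
    hg.comp (measurable_snd.prodMk ((hR.comp measurable_fst).remove measurable_snd))
  have hm' : Measurable fun p : Ω × Y => g p.2 (R p.1) :=
    hg.comp (measurable_snd.prodMk (hR.comp measurable_fst))
  obtain ⟨i1, e1⟩ := integral_integral_eq (P := P) (m := fun w => (R w).1)
    (v := fun w y => g y ((R w).remove y))
    (fun w => inferInstance) (FinPointConfig.measurable_iff.1 hR univ MeasurableSet.univ) hmass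
    (fun w => hm.of_uncurry_left (f := fun w y => g y ((R w).remove y)))
    (fun w y => hgb _ _)
    (FinPointConfig.measurable_lintegral hR (hm.add_const 1).ennreal_ofReal)
  obtain ⟨i2, -⟩ := integral_integral_eq (P := P) (m := fun _ => M) (v := fun w y => g y (R w))
    (fun w => inferInstance) measurable_const (by simp)
    (fun w => hm'.of_uncurry_left (f := fun w y => g y (R w)))
    (fun w y => hgb _ _) ((hm'.add_const 1).ennreal_ofReal.lintegral_prod_right')
  have h1 : (fun w => h (R w)) = fun w =>
      (∫ x, g x ((R w).remove x) ∂(R w).1 - ∫ z, g z (R w) ∂M) + c := by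
    ext w; rw [← hc]; ring
  have i3 : Integrable (fun w => ∫ x, g x ((R w).remove x) ∂(R w).1 - ∫ z, g z (R w) ∂M) P :=
    i1.sub i2
  rw [h1]
  refine ⟨i3.add (integrable_const c), ?_⟩
  rw [integral_add i3 (integrable_const c), integral_sub i1 i2, e1]
  simp

/-- A Poisson process can be modified on a null set so as to be finite on given sets of finite
intensity everywhere. -/
theorem IsPoissonProcess.ae_truncOn_eq {X : Type*} [MeasurableSpace X] {K : Measure X}
    {η : Ω → PointConfig X} (hη : IsPoissonProcess P η K) {D : ℕ → Set X}
    (hD : ∀ n, MeasurableSet (D n)) (hKD : ∀ n, K (D n) ≠ ∞) :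
    (fun w => PointConfig.truncOn D (η w)) =ᵐ[P] η := by
  filter_upwards [ae_all_iff.2 fun n => hη.ae_lt_top (hD n) (hKD n)] with w hw
  exact PointConfig.truncOn_eq hw

theorem IsPoissonProcess.truncOn {X : Type*} [MeasurableSpace X] {K : Measure X}
    {η : Ω → PointConfig X} (hη : IsPoissonProcess P η K) {D : ℕ → Set X}
    (hD : ∀ n, MeasurableSet (D n)) (hKD : ∀ n, K (D n) ≠ ∞) :
    IsPoissonProcess P (fun w => PointConfig.truncOn D (η w)) K := by
  have hae := hη.ae_truncOn_eq hD hKD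
  refine ⟨(PointConfig.measurable_truncOn hD).comp hη.measurable, fun B hB hK n => ?_,
    fun B hB hK => ?_, fun m B hB hdisj => ?_⟩
  · rw [← hη.law B hB hK n]
    refine measure_congr ?_
    filter_upwards [hae] with w hw
    simp only [eq_iff_iff]
    change (_ = _) ↔ (_ = _)
    rw [hw]
  · filter_upwards [hae, hη.law_top B hB hK] with w hw h
    rwa [hw]
  · refine (hη.indep m B hB hdisj).congr fun i => ?_
    filter_upwards [hae] with w hw
    rw [hw]

/-- For a Poisson process, `𝔼 ∫ G(y, ζ - δ_y) ζ(dy) = 𝔼 ∫ G(y, ζ) M(dy)`. -/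
theorem lintegral_remove_poisson {Q : Measure Ω'} [IsProbabilityMeasure Q] {M : Measure Y}
    [IsFiniteMeasure M] {ζ : Ω' → PointConfig Y} (hζ : IsPoissonProcess Q ζ M)
    {G : Y → FinPointConfig Y → ℝ≥0∞} (hG : Measurable fun p : Y × FinPointConfig Y => G p.1 p.2) :
    ∫⁻ w, ∫⁻ y, G y ((toFinPointConfig (ζ w).1).remove y) ∂(ζ w).1 ∂Q =
      ∫⁻ w, ∫⁻ y, G y (toFinPointConfig (ζ w).1) ∂M ∂Q := by
  -- modify `ζ` on a null set so that all its configurations are finite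
  wlog hfin : ∀ w, (ζ w).1 univ < ∞ generalizing ζ
  · have hD : ∀ _ : ℕ, MeasurableSet (univ : Set Y) := fun _ => MeasurableSet.univ
    have hKD : ∀ _ : ℕ, M univ ≠ ∞ := fun _ => measure_ne_top M univ
    have hae := hζ.ae_truncOn_eq hD hKD
    have := this (hζ.truncOn hD hKD) fun w => PointConfig.truncOn_lt_top (fun _ => univ) (ζ w) 0
    exact (lintegral_congr_ae (hae.fun_comp fun ω : PointConfig Y =>
      ∫⁻ y, G y ((toFinPointConfig ω.1).remove y) ∂ω.1)).symm.trans (this.trans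
        (lintegral_congr_ae (hae.fun_comp fun ω : PointConfig Y =>
          ∫⁻ y, G y (toFinPointConfig ω.1) ∂M)))
  have hm : Measurable fun ω : PointConfig Y => toFinPointConfig ω.1 :=
    measurable_toFinPointConfig measurable_subtype_coe fun ω => ω.2.2
  have hu : Measurable fun p : Y × PointConfig Y => G p.1 ((toFinPointConfig p.2.1).remove p.1) :=
    hG.comp (measurable_fst.prodMk ((hm.comp measurable_snd).remove measurable_fst))
  have h1 := hζ.mecke (D := fun _ => univ) (fun _ => MeasurableSet.univ) (iUnion_const _)
    (fun _ => measure_ne_top M univ) (fun w _ => hfin w)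
    (u := fun y ω => G y ((toFinPointConfig ω.1).remove y)) hu
  have h2 : ∀ w y, (toFinPointConfig ((ζ w).addPoints fun _ : Fin 1 => y).1).remove y =
      toFinPointConfig (ζ w).1 := fun w y => by
    rw [← toFinPointConfig_add_dirac_remove (ζ w).2.2 y]
    simp [PointConfig.addPoints]
  simp only [h2] at h1
  rw [h1, lintegral_lintegral_swap]
  exact (hG.comp (measurable_fst.prodMk
    ((hm.comp hζ.measurable).comp measurable_snd))).aemeasurable

/-- The expectation of `h` under the law of a Poisson process is the constant in the Stein
equation. -/
theorem integral_poisson_eq_const {Q : Measure Ω'} [IsProbabilityMeasure Q] {M : Measure Y}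
    [IsFiniteMeasure M] {ζ : Ω' → PointConfig Y} (hζ : IsPoissonProcess Q ζ M)
    {g : Y → FinPointConfig Y → ℝ}
    (hg : Measurable fun p : Y × FinPointConfig Y => g p.1 p.2) (hgb : ∀ y ω, |g y ω| ≤ 1)
    {h : FinPointConfig Y → ℝ} {c : ℝ}
    (hc : ∀ ω, h ω - c = ∫ x, g x (ω.remove x) ∂ω.1 - ∫ z, g z ω ∂M) :
    ∫ w, h (toFinPointConfig (ζ w).1) ∂Q = c := by
  have hae : ∀ᵐ w ∂Q, (toFinPointConfig (ζ w).1).1 = (ζ w).1 :=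
    (hζ.ae_lt_top MeasurableSet.univ (measure_ne_top M univ)).mono fun w hw =>
      toFinPointConfig_val (ζ w).2.2 hw
  have hR : Measurable fun w => toFinPointConfig (ζ w).1 :=
    measurable_toFinPointConfig (measurable_subtype_coe.comp hζ.measurable) fun w => (ζ w).2.2
  have hmass : ∫⁻ w, (toFinPointConfig (ζ w).1).1 univ ∂Q = M univ := by
    rw [← hζ.lintegral_apply MeasurableSet.univ (measure_ne_top M univ)]
    exact lintegral_congr_ae (hae.mono fun w hw => by simp only [hw])
  obtain ⟨-, h1⟩ := integral_stein hR (hmass ▸ measure_ne_top M univ) hg hgb hc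
  have hm : Measurable fun p : Ω' × Y => g p.2 (toFinPointConfig (ζ p.1).1) :=
    hg.comp (measurable_snd.prodMk (hR.comp measurable_fst))
  obtain ⟨-, h2⟩ := integral_integral_eq (P := Q) (m := fun _ => M)
    (v := fun w y => g y (toFinPointConfig (ζ w).1)) (fun w => inferInstance) measurable_const
    (by simp) (fun w => hm.of_uncurry_left (f := fun w y => g y (toFinPointConfig (ζ w).1)))
    (fun w y => hgb _ _) ((hm.add_const 1).ennreal_ofReal.lintegral_prod_right')
  have h3 : ∫⁻ w, ∫⁻ y, ENNReal.ofReal (g y ((toFinPointConfig (ζ w).1).remove y) + 1)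
      ∂(toFinPointConfig (ζ w).1).1 ∂Q =
      ∫⁻ w, ∫⁻ y, ENNReal.ofReal (g y (toFinPointConfig (ζ w).1) + 1) ∂M ∂Q := by
    rw [← lintegral_remove_poisson hζ (G := fun y ω => ENNReal.ofReal (g y ω + 1))
      (hg.add_const 1).ennreal_ofReal]
    exact lintegral_congr_ae (hae.mono fun w hw => by simp only [hw])
  rw [h2, h3, hmass] at h1
  simp only [lintegral_const, measure_univ, mul_one] at h1
  linarith

/-- Poisson approximation of a point process `R + ρ`, where the Palm processes of `R` are within `ε`
of its law on average and `ρ` has few points. -/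
theorem abs_integral_sub_le_of_coupling {L L' M : Measure Y} [IsFiniteMeasure L]
    [IsFiniteMeasure L'] [IsFiniteMeasure M] {R R' : Ω → FinPointConfig Y} (hR : Measurable R)
    (hR' : Measurable R')
    (hL : ∫⁻ w, (R w).1 univ ∂P = L univ) {ρ : Ω → Measure Y} (hρ : Measurable ρ)
    (hL' : ∫⁻ w, ρ w univ ∂P = L' univ) (hRρ : ∀ᵐ w ∂P, (R' w).1 = (R w).1 + ρ w)
    {ε : ℝ≥0∞} (hε : ε ≠ ∞)
    (hcoup : ∀ G : Y → FinPointConfig Y → ℝ≥0∞,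
      Measurable (fun p : Y × FinPointConfig Y => G p.1 p.2) → (∀ y ω, G y ω ≤ 2) →
      ∫⁻ w, ∫⁻ y, G y ((R w).remove y) ∂(R w).1 ∂P ≤ ∫⁻ w, ∫⁻ y, G y (R w) ∂L ∂P + ε ∧
      ∫⁻ w, ∫⁻ y, G y (R w) ∂L ∂P ≤ ∫⁻ w, ∫⁻ y, G y ((R w).remove y) ∂(R w).1 ∂P + ε)
    {g : Y → FinPointConfig Y → ℝ}
    (hg : Measurable fun p : Y × FinPointConfig Y => g p.1 p.2) (hgb : ∀ y ω, |g y ω| ≤ 1)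
    (hgosc : ∀ y z ω, g y ω - g z ω ≤ 1)
    {h : FinPointConfig Y → ℝ} (hh : h ∈ LipFunctionals Y) {c : ℝ}
    (hc : ∀ ω, h ω - c = ∫ x, g x (ω.remove x) ∂ω.1 - ∫ z, g z ω ∂M) :
    |∫ w, h (R' w) ∂P - c| ≤
      (tvDist (L + L') M).toReal + 2 * L'.real univ + ε.toReal := by
  have hm : Measurable fun p : Ω × Y => g p.2 (R p.1) :=
    hg.comp (measurable_snd.prodMk (hR.comp measurable_fst))
  have hgR : ∀ w, Measurable fun y => g y (R w) := fun w =>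
    hm.of_uncurry_left (f := fun w y => g y (R w))
  obtain ⟨iR, e1⟩ := integral_stein hR (hL ▸ measure_ne_top L univ) hg hgb hc
  have key : ∀ m : Measure Y, IsFiniteMeasure m → _ := fun m _ =>
    integral_integral_eq (P := P) (m := fun _ => m)
      (v := fun w y => g y (R w)) (fun w => inferInstance) measurable_const (by simp) hgR
      (fun w y => hgb _ _) ((hm.add_const 1).ennreal_ofReal.lintegral_prod_right')
  obtain ⟨iL, e2⟩ := key L inferInstance
  obtain ⟨iM, -⟩ := key M inferInstance
  -- the coupling bounds, for `g + 1` with values in `[0, 2]`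
  have hG2 : ∀ y ω, ENNReal.ofReal (g y ω + 1) ≤ 2 := fun y ω => by
    refine ENNReal.ofReal_le_of_le_toReal ?_
    have := (abs_le.1 (hgb y ω)).2
    simp only [ENNReal.toReal_ofNat]; linarith
  obtain ⟨c1, c2⟩ := hcoup (fun y ω => ENNReal.ofReal (g y ω + 1))
    (hg.add_const 1).ennreal_ofReal hG2
  have hB : ∫⁻ w, ∫⁻ y, ENNReal.ofReal (g y (R w) + 1) ∂L ∂P ≠ ∞ := by
    refine ne_top_of_le_ne_top (b := 2 * L univ) (ENNReal.mul_ne_top (by simp)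
      (measure_ne_top _ _)) ((lintegral_mono fun w => lintegral_mono fun y => hG2 _ _).trans ?_)
    simp
  have hA := ne_top_of_le_ne_top (ENNReal.add_ne_top.2 ⟨hB, hε⟩) c1
  have d1 := ENNReal.toReal_mono (ENNReal.add_ne_top.2 ⟨hB, hε⟩) c1
  have d2 := ENNReal.toReal_mono (ENNReal.add_ne_top.2 ⟨hA, hε⟩) c2
  rw [ENNReal.toReal_add hB hε] at d1
  rw [ENNReal.toReal_add hA hε] at d2
  -- `L` is replaced by `M`: the oscillation bound for `L + L'` and `M`, and the mass of `L'`
  have f1 : |∫ w, ∫ y, g y (R w) ∂L ∂P - ∫ w, ∫ y, g y (R w) ∂M ∂P| ≤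
      (tvDist (L + L') M).toReal + L'.real univ := by
    rw [← integral_sub iL iM]
    have a0 : ∀ w, ‖∫ y, g y (R w) ∂L - ∫ y, g y (R w) ∂M‖ ≤
        (tvDist (L + L') M).toReal + L'.real univ := by
      intro w
      have a1 := abs_le.1 (abs_integral_sub_le_tvDist (μ := L + L') (ν := M) (hgR w)
        (fun y => hgb _ _) (fun y z => hgosc _ _ _))
      rw [integral_add_measure (integrable_of_bound (hgR w) fun y => hgb _ _)
        (integrable_of_bound (hgR w) fun y => hgb _ _)] at a1
      have a2 := norm_integral_le_of_norm_le_const (μ := L') (f := fun y => g y (R w)) (C := 1)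
        (Eventually.of_forall fun y => hgb _ _)
      rw [one_mul, Real.norm_eq_abs] at a2
      have a3 := abs_le.1 a2
      exact abs_le.2 ⟨by linarith, by linarith⟩
    have a4 := norm_integral_le_of_norm_le_const (μ := P) (Eventually.of_forall a0)
    rwa [probReal_univ (μ := P), mul_one] at a4
  -- the points of `ρ` change `h` by at most their number
  have hρm : Measurable fun w => ρ w univ := (Measure.measurable_coe MeasurableSet.univ).comp hρ
  have hρi : Integrable (fun w => (ρ w univ).toReal) P :=
    integrable_toReal_of_lintegral_ne_top hρm.aemeasurable (hL' ▸ measure_ne_top L' univ)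
  have hle : ∀ᵐ w ∂P, ‖h (R' w) - h (R w)‖ ≤ (ρ w univ).toReal :=
    hRρ.mono fun w hw => abs_sub_le_of_eq_add hh hw
  have iD : Integrable (fun w => h (R' w) - h (R w)) P :=
    hρi.mono' ((hh.1.comp hR').sub (hh.1.comp hR)).aestronglyMeasurable hle
  have f2 : |∫ w, (h (R' w) - h (R w)) ∂P| ≤ L'.real univ := by
    refine (norm_integral_le_of_norm_le hρi hle).trans (le_of_eq ?_)
    rw [integral_toReal hρm.aemeasurable
      (ae_lt_top hρm (hL' ▸ measure_ne_top L' univ)), hL', Measure.real]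
  have f3 : ∫ w, h (R' w) ∂P = ∫ w, (h (R' w) - h (R w)) ∂P + ∫ w, h (R w) ∂P := by
    rw [← integral_add iD iR]
    simp
  rw [hL] at e1
  simp only [lintegral_const, measure_univ, mul_one] at e2
  have g1 := abs_le.1 f1
  have g2 := abs_le.1 f2
  exact abs_le.2 ⟨by linarith, by linarith⟩

end Approximation

/-! ### The variance form of the bound -/

section Variance

open Set

variable {Ω X Y : Type*} [MeasurableSpace Ω] [TopologicalSpace X] [MeasurableSpace X]
  [MeasurableSpace Y] {k : ℕ}
  [LocallyCompactSpace X] [SecondCountableTopology X] [T2Space X] [BorelSpace X]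
  {P : Measure Ω} [IsProbabilityMeasure P] {K : Measure X} [SigmaFinite K]
  {η : Ω → PointConfig X} {f : (Fin k → X) → PointConfig X → Y}
  {g : (Fin k → X) → PointConfig X → ℝ≥0∞} {S : (Fin k → X) → Closeds X}

/-- `Var N + (𝔼 N)² = 𝔼 N²`, also for infinite variance. -/
theorem evariance_toReal_add_sq {N : Ω → ℝ≥0∞} (hN : Measurable N) (hfin : ∫⁻ w, N w ∂P ≠ ∞) :
    evariance (fun w => (N w).toReal) P + (∫⁻ w, N w ∂P) ^ 2 = ∫⁻ w, N w ^ 2 ∂P := by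
  have hm : AEStronglyMeasurable (fun w => (N w).toReal) P :=
    hN.ennreal_toReal.aestronglyMeasurable
  have h1 : ∫⁻ w, ‖(N w).toReal‖ₑ ^ 2 ∂P = ∫⁻ w, N w ^ 2 ∂P :=
    lintegral_congr_ae ((ae_lt_top hN hfin).mono fun w hw => by
      simp only [Real.enorm_of_nonneg ENNReal.toReal_nonneg, ENNReal.ofReal_toReal hw.ne])
  have h2 : ENNReal.ofReal ((∫ w, (N w).toReal ∂P) ^ 2) = (∫⁻ w, N w ∂P) ^ 2 := by
    rw [integral_toReal hN.aemeasurable (ae_lt_top hN hfin), ← ENNReal.toReal_pow,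
      ENNReal.ofReal_toReal (ENNReal.pow_ne_top hfin)]
  have h3 : (∫⁻ w, N w ∂P) ^ 2 ≤ ∫⁻ w, N w ^ 2 ∂P := by
    have := ENNReal.lintegral_mul_le_Lp_mul_Lq P Real.HolderConjugate.two_two hN.aemeasurable
      (measurable_one (α := ℝ≥0∞) (β := Ω)).aemeasurable
    simp only [Pi.mul_apply, Pi.one_apply, mul_one, ENNReal.one_rpow, lintegral_const,
      measure_univ] at this
    calc (∫⁻ w, N w ∂P) ^ 2 ≤ ((∫⁻ w, N w ^ (2 : ℝ) ∂P) ^ (1 / 2 : ℝ)) ^ 2 := by gcongr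
      _ = ∫⁻ w, N w ^ 2 ∂P := by
        rw [← ENNReal.rpow_natCast, ← ENNReal.rpow_mul]; simp
  rw [evariance_def' hm, h1, h2, tsub_add_cancel_of_le h3]

namespace LocalSetting

theorem measurable_induced (h : LocalSetting P η K f g S) :
    Measurable fun w => inducedProcess f g (η w) :=
  h.poisson.measurable_induced h.lt_top h.measurable_f h.measurable_g

/-- `E₂` is finite: without the indicator it is twice the square of the mass of the intensity. -/
theorem errorE2_le (h : LocalSetting P η K f g S) {L : Measure Y}
    (hL : IsIntensityMeasure P (fun w => inducedProcess f g (η w)) L) :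
    errorE2 P η K g S ≤ 2 * (L univ * L univ) := by
  rw [h.errorE2_eq]
  refine mul_le_mul_right ?_ 2
  calc _ ≤ ((k ! : ℕ) : ℝ≥0∞)⁻¹ * ∫⁻ x, (∫⁻ w, g x ((η w).addPoints x) ∂P) * L univ
        ∂(Measure.pi fun _ => K) := by
        gcongr with x
        rw [← h.lintegral_farPart_add_nearPart hL x]
        exact le_add_self
    _ = L univ * L univ := by
      rw [lintegral_mul_const _ h.measurable_lintegral_comp_addPoints, ← mul_assoc,
        ← h.poisson.intensity_univ h.lt_top h.measurable_f h.measurable_g hL]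

/-- The excess of the variance over the mean, in terms of `E₂`, `E₃` and `E₄`. -/
theorem two_mul_evariance_add (h : LocalSetting P η K f g S) {L : Measure Y}
    (hL : IsIntensityMeasure P (fun w => inducedProcess f g (η w)) L) (hL_fin : L univ ≠ ∞) :
    2 * evariance (fun w => (inducedProcess f g (η w) univ).toReal) P + errorE2 P η K g S =
      2 * L univ + errorE3 P η K g S + errorE4 P η K g := by
  have hLu := hL univ MeasurableSet.univ
  have h1 := evariance_toReal_add_sq (P := P)
    ((Measure.measurable_coe MeasurableSet.univ).comp h.measurable_induced)
    (by change ∫⁻ w, inducedProcess f g (η w) univ ∂P ≠ ∞; rwa [← hLu])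
  simp only [Function.comp] at h1
  have h2 := h.lintegral_sq_add hL
  rw [← h1, ← hLu, mul_add, add_right_comm, add_comm (2 * L univ ^ 2)] at h2
  exact (ENNReal.add_left_inj (ENNReal.mul_ne_top (by simp) (ENNReal.pow_ne_top hL_fin))).1 h2

end LocalSetting

/-- Both forms of the bound are the same number; with `V` and `e` infinite at the same time. -/
theorem ereal_two_forms {V l t e₁ e₂ e : ℝ≥0∞} (hl : l ≠ ∞) (ht : t ≠ ∞) (he₁ : e₁ ≠ ∞)
    (he₂ : e₂ ≠ ∞) (h : 2 * V + e₂ = 2 * l + e) :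
    (t : EReal) + 2 * ((V : EReal) - (l : EReal)) + (e₁ : EReal) + 2 * (e₂ : EReal) =
      ((t + e₁ + e₂ + e : ℝ≥0∞) : EReal) := by
  lift l to ℝ≥0 using hl
  lift t to ℝ≥0 using ht
  lift e₁ to ℝ≥0 using he₁
  lift e₂ to ℝ≥0 using he₂
  have h2 : (2 : EReal) = ((2 : ℝ) : EReal) := rfl
  rcases eq_or_ne V ∞ with hV | hV
  · have he : e = ∞ := by
      rw [hV, ENNReal.mul_top (by simp), top_add] at h
      rcases ENNReal.add_eq_top.1 h.symm with h' | h'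
      · exact absurd h' (ENNReal.mul_ne_top (by simp) (by simp))
      · exact h'
    have h3 : ∀ r : ℝ≥0, ((r : ℝ≥0∞) : EReal) = ((r : ℝ) : EReal) := fun r => rfl
    rw [hV, he, add_top, EReal.coe_ennreal_top, h3, h3, h3, h3, EReal.top_sub_coe, h2,
      EReal.coe_mul_top_of_pos (by norm_num), EReal.coe_add_top, EReal.top_add_coe, ← EReal.coe_mul,
      EReal.top_add_coe]
  · have he : e ≠ ∞ := by
      intro he
      rw [he, add_top] at h
      exact ENNReal.add_ne_top.2 ⟨ENNReal.mul_ne_top (by simp) hV, by simp⟩ h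
    lift V to ℝ≥0 using hV
    lift e to ℝ≥0 using he
    have h4 : 2 * (V : ℝ) + e₂ = 2 * l + e := by exact_mod_cast h
    have h3 : ∀ r : ℝ≥0, ((r : ℝ≥0∞) : EReal) = ((r : ℝ) : EReal) := fun r => rfl
    rw [← ENNReal.coe_add, ← ENNReal.coe_add, ← ENNReal.coe_add]
    simp only [h3, h2]
    rw [← EReal.coe_sub, ← EReal.coe_mul, ← EReal.coe_mul, ← EReal.coe_add, ← EReal.coe_add,
      ← EReal.coe_add]
    congr 1
    push_cast
    linarith

end Variance

/-! ### The bound for the truncated process -/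

section Main

open Set

variable {Ω Ω' X Y : Type*} [MeasurableSpace Ω] [MeasurableSpace Ω'] [TopologicalSpace X]
  [MeasurableSpace X] [MeasurableSpace Y] {k : ℕ}
  {f : (Fin k → X) → PointConfig X → Y} {g : (Fin k → X) → PointConfig X → ℝ≥0∞}
  {𝒮 : (Fin k → X) → PointConfig X → Closeds X} {S : (Fin k → X) → Closeds X}

open Classical in
/-- The part of `g` that is lost by the truncation. -/
noncomputable def escaped (g : (Fin k → X) → PointConfig X → ℝ≥0∞)
    (𝒮 : (Fin k → X) → PointConfig X → Closeds X) (S : (Fin k → X) → Closeds X)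
    (x : Fin k → X) (ω : PointConfig X) : ℝ≥0∞ :=
  if (𝒮 x ω : Set X) ⊆ S x then 0 else g x ω

theorem truncated_add_escaped (x : Fin k → X) (ω : PointConfig X) :
    truncated g 𝒮 S x ω + escaped g 𝒮 S x ω = g x ω := by
  rw [truncated, escaped]
  split_ifs <;> simp

theorem inducedProcess_truncated_add_escaped (ω : PointConfig X) :
    inducedProcess f (truncated g 𝒮 S) ω + inducedProcess f (escaped g 𝒮 S) ω =
      inducedProcess f g ω := by
  ext B hB
  rw [Measure.add_apply, inducedProcess_apply _ hB, inducedProcess_apply _ hB,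
    inducedProcess_apply _ hB, ← mul_add, factorialSum, factorialSum, ← ENNReal.tsum_add]
  congr 1
  refine tsum_congr fun t => ?_
  rw [← add_mul, truncated_add_escaped]

theorem isIntensityMeasure_bind {P : Measure Ω} {ξ : Ω → Measure Y} (hξ : Measurable ξ) :
    IsIntensityMeasure P ξ (P.bind ξ) := fun _ hB =>
  Measure.bind_apply hB hξ.aemeasurable

variable [LocallyCompactSpace X] [SecondCountableTopology X] [T2Space X] [BorelSpace X]
  {P : Measure Ω} [IsProbabilityMeasure P] {K : Measure X} [SigmaFinite K]
  {η : Ω → PointConfig X}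

theorem measurable_escaped
    (hg : Measurable (fun p : (Fin k → X) × PointConfig X => g p.1 p.2))
    (h𝒮 : Measurable[_, fellMeasurableSpace X]
      (fun p : (Fin k → X) × PointConfig X => 𝒮 p.1 p.2))
    (hS : Measurable[_, fellMeasurableSpace X] S) :
    Measurable (fun p : (Fin k → X) × PointConfig X => escaped g 𝒮 S p.1 p.2) := by
  classical
  have hS' : Measurable[_, fellMeasurableSpace X]
      (fun p : (Fin k → X) × PointConfig X => S p.1) := fun B hB => measurable_fst (hS hB)
  simp only [escaped]
  exact Measurable.ite (measurableSet_closeds_subset h𝒮 hS') measurable_const hg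

/-- `E₁` is twice the expected number of points lost by the truncation. -/
theorem errorE1_eq (hη : IsPoissonProcess P η K)
    (hfin : ∀ w n, (η w).1 (spanningSets K n) < ∞)
    (hf : Measurable (fun p : (Fin k → X) × PointConfig X => f p.1 p.2))
    (he : Measurable (fun p : (Fin k → X) × PointConfig X => escaped g 𝒮 S p.1 p.2))
    {L : Measure Y}
    (hL : IsIntensityMeasure P (fun w => inducedProcess f (escaped g 𝒮 S) (η w)) L) :
    errorE1 P η K g 𝒮 S = 2 * L univ := by
  rw [hη.intensity_univ hfin hf he hL, ← mul_assoc, errorE1, div_eq_mul_inv]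
  rfl

variable [TopologicalSpace Y] [SecondCountableTopology Y] [T2Space Y] [BorelSpace Y]

/-- The Stein equation for the truncated process, which is within `E₂ + E₃ + E₄` of satisfying the
Mecke equation; the points lost by the truncation enter through `E₁`, once for the change of the
process and once for the change of the intensity. -/
theorem LocalSetting.krDist_le (h : LocalSetting P η K f (truncated g 𝒮 S) S)
    (hg : Measurable (fun p : (Fin k → X) × PointConfig X => g p.1 p.2))
    (hg_symm : ∀ (σ : Equiv.Perm (Fin k)) x ω, g (x ∘ σ) ω = g x ω)
    (hg01 : ∀ x ω, g x ω = 0 ∨ g x ω = 1)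
    (he : Measurable (fun p : (Fin k → X) × PointConfig X => escaped g 𝒮 S p.1 p.2))
    {Ltr L' M : Measure Y}
    (hL : IsIntensityMeasure P (fun w => inducedProcess f (truncated g 𝒮 S) (η w)) Ltr)
    (hL' : IsIntensityMeasure P (fun w => inducedProcess f (escaped g 𝒮 S) (η w)) L')
    [IsFiniteMeasure Ltr] [IsFiniteMeasure L'] [IsFiniteMeasure M]
    {Q : Measure Ω'} [IsProbabilityMeasure Q] {ζ : Ω' → PointConfig Y}
    (hζ : IsPoissonProcess Q ζ M) :
    krDist P (fun w => toFinPointConfig (inducedProcess f g (η w)))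
        Q (fun w => toFinPointConfig (ζ w).1) ≤
      tvDist (Ltr + L') M + errorE1 P η K g 𝒮 S + (errorE2 P η K (truncated g 𝒮 S) S
        + errorE3 P η K (truncated g 𝒮 S) S + errorE4 P η K (truncated g 𝒮 S)) := by
  rw [errorE1_eq h.poisson h.lt_top h.measurable_f he hL']
  set ε := errorE2 P η K (truncated g 𝒮 S) S
        + errorE3 P η K (truncated g 𝒮 S) S + errorE4 P η K (truncated g 𝒮 S) with hεdef
  rcases eq_or_ne ε ∞ with hε | hε
  · rw [hε, add_top]; exact le_top
  have hc := fun ω => isCountingMeasure_inducedProcess h.f_symm hg_symm hg01 ω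
  have hm := h.poisson.measurable_induced h.lt_top h.measurable_f hg
  have hmρ := h.poisson.measurable_induced h.lt_top h.measurable_f he
  have hLu := hL univ MeasurableSet.univ
  have hLu' := hL' univ MeasurableSet.univ
  have hlt : ∀ᵐ w ∂P, inducedProcess f (truncated g 𝒮 S) (η w) univ < ∞ :=
    ae_lt_top ((Measure.measurable_coe MeasurableSet.univ).comp h.measurable_induced)
      (by change ∫⁻ w, inducedProcess f (truncated g 𝒮 S) (η w) univ ∂P ≠ ∞
          rw [← hLu]; exact measure_ne_top _ _)
  have hlt' : ∀ᵐ w ∂P, inducedProcess f (escaped g 𝒮 S) (η w) univ < ∞ :=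
    ae_lt_top ((Measure.measurable_coe MeasurableSet.univ).comp hmρ)
      (by change ∫⁻ w, inducedProcess f (escaped g 𝒮 S) (η w) univ ∂P ≠ ∞
          rw [← hLu']; exact measure_ne_top _ _)
  have hval : ∀ᵐ w ∂P, (toFinPointConfig (inducedProcess f (truncated g 𝒮 S) (η w))).1 =
      inducedProcess f (truncated g 𝒮 S) (η w) :=
    hlt.mono fun w hw => toFinPointConfig_val (h.isCountingMeasure _) hw
  refine iSup₂_le fun F hF => ?_
  obtain ⟨u, hu, hub, huosc, c, huc⟩ := exists_stein_gradient M hF.1 (abs_addPoint_sub_le hF)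
    (addPoint_sub_addPoint_le hF)
  rw [integral_poisson_eq_const hζ hu hub huc]
  have key := abs_integral_sub_le_of_coupling (P := P) (L := Ltr) (L' := L') (M := M)
    (R := fun w => toFinPointConfig (inducedProcess f (truncated g 𝒮 S) (η w)))
    (R' := fun w => toFinPointConfig (inducedProcess f g (η w)))
    (ρ := fun w => inducedProcess f (escaped g 𝒮 S) (η w))
    (measurable_toFinPointConfig h.measurable_induced fun w => h.isCountingMeasure _)
    (measurable_toFinPointConfig hm fun w => hc _)
    ((lintegral_congr_ae (hval.mono fun w hw => by simp only [hw])).trans hLu.symm)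
    hmρ hLu'.symm
    (by
      filter_upwards [hval, hlt, hlt'] with w h1 h2 h3
      rw [h1, inducedProcess_truncated_add_escaped]
      refine toFinPointConfig_val (hc _) ?_
      rw [← inducedProcess_truncated_add_escaped (𝒮 := 𝒮) (S := S), Measure.add_apply]
      exact ENNReal.add_lt_top.2 ⟨h2, h3⟩)
    hε
    (fun G hG hG2 => by
      have h1 := h.coupling_bounds hL (measure_ne_top _ _) hG hG2
      have h2 : ∫⁻ w, ∫⁻ y, G y ((toFinPointConfig
            (inducedProcess f (truncated g 𝒮 S) (η w))).remove y)
            ∂(toFinPointConfig (inducedProcess f (truncated g 𝒮 S) (η w))).1 ∂P =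
          ∫⁻ w, ∫⁻ y, G y ((toFinPointConfig
            (inducedProcess f (truncated g 𝒮 S) (η w))).remove y)
            ∂(inducedProcess f (truncated g 𝒮 S) (η w)) ∂P :=
        lintegral_congr_ae (hval.mono fun w hw => by simp only [hw])
      rw [h2]
      exact h1)
    hu hub huosc hF huc
  have ht : tvDist (Ltr + L') M ≠ ∞ := tvDist_ne_top _ _
  have hl : 2 * L' univ ≠ ∞ := ENNReal.mul_ne_top (by simp) (measure_ne_top _ _)
  refine ENNReal.ofReal_le_of_le_toReal ?_
  rw [ENNReal.toReal_add (ENNReal.add_ne_top.2 ⟨ht, hl⟩) hε, ENNReal.toReal_add ht hl,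
    ENNReal.toReal_mul, ENNReal.toReal_ofNat]
  exact key

end Main

/-! ### Modifying the Poisson process on a null set -/

section Congr

open Set Filter

variable {Ω Ω' X Y : Type*} [MeasurableSpace Ω] [MeasurableSpace Ω'] [TopologicalSpace X]
  [MeasurableSpace X] [MeasurableSpace Y] {k : ℕ} {P : Measure Ω}
  {η η' : Ω → PointConfig X} {K : Measure X}
  {g : (Fin k → X) → PointConfig X → ℝ≥0∞}
  {𝒮 : (Fin k → X) → PointConfig X → Closeds X} {S : (Fin k → X) → Closeds X}

theorem lintegral_comp_congr (h : η =ᵐ[P] η') (F : PointConfig X → ℝ≥0∞) :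
    ∫⁻ w, F (η w) ∂P = ∫⁻ w, F (η' w) ∂P :=
  lintegral_congr_ae (h.fun_comp F)

theorem errorE1_congr (h : η =ᵐ[P] η') : errorE1 P η K g 𝒮 S = errorE1 P η' K g 𝒮 S := by
  unfold errorE1
  congr 1
  exact lintegral_congr fun x => lintegral_comp_congr h fun ω =>
    escaped g 𝒮 S x (ω.addPoints x)

theorem errorE2_congr (h : η =ᵐ[P] η') : errorE2 P η K g S = errorE2 P η' K g S := by
  have h1 := fun x => lintegral_comp_congr h fun ω => g x (ω.addPoints x)
  simp only [errorE2, h1]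

theorem errorE3_congr (h : η =ᵐ[P] η') : errorE3 P η K g S = errorE3 P η' K g S := by
  have h1 := fun x z : Fin k → X => lintegral_comp_congr h fun ω =>
    g x ((ω.addPoints x).addPoints z) * g z ((ω.addPoints x).addPoints z)
  simp only [errorE3, h1]

theorem errorE4_congr (h : η =ᵐ[P] η') : errorE4 P η K g = errorE4 P η' K g := by
  have h1 := fun (x : Fin k → X) I (z : Fin (k - I.card) → X) => lintegral_comp_congr h fun ω =>
    g x ((ω.addPoints x).addPoints z) * g (mixTuple x I z) ((ω.addPoints x).addPoints z)
  simp only [errorE4, h1]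

theorem krDist_congr {Q : Measure Ω'} {ξ ξ' : Ω → FinPointConfig Y} (h : ξ =ᵐ[P] ξ')
    (ζ : Ω' → FinPointConfig Y) : krDist P ξ Q ζ = krDist P ξ' Q ζ := by
  have h1 := fun F : FinPointConfig Y → ℝ => integral_congr_ae (h.fun_comp F)
  simp only [Function.comp_def] at h1
  simp only [krDist, h1]

end Congr

theorem theorem4p1
    {X Y Ω Ω' : Type*}
    [TopologicalSpace X] [LocallyCompactSpace X] [SecondCountableTopology X] [T2Space X]
    [MeasurableSpace X] [BorelSpace X]
    [TopologicalSpace Y] [LocallyCompactSpace Y] [SecondCountableTopology Y] [T2Space Y]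
    [MeasurableSpace Y] [BorelSpace Y]
    [MeasurableSpace Ω] [MeasurableSpace Ω']
    (P : Measure Ω) [IsProbabilityMeasure P] (Q : Measure Ω') [IsProbabilityMeasure Q]
    (k : ℕ) (hk : 1 ≤ k)
    -- the Poisson process `η` and its intensity measure
    (K : Measure X) [SigmaFinite K]
    (η : Ω → PointConfig X) (hη : IsPoissonProcess P η K)
    -- the functionals `f` and `g`
    (f : (Fin k → X) → PointConfig X → Y)
    (hf : Measurable (fun p : (Fin k → X) × PointConfig X => f p.1 p.2))
    (hf_symm : ∀ (σ : Equiv.Perm (Fin k)) x ω, f (x ∘ σ) ω = f x ω)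
    (g : (Fin k → X) → PointConfig X → ℝ≥0∞)
    (hg : Measurable (fun p : (Fin k → X) × PointConfig X => g p.1 p.2))
    (hg_symm : ∀ (σ : Equiv.Perm (Fin k)) x ω, g (x ∘ σ) ω = g x ω)
    (hg01 : ∀ x ω, g x ω = 0 ∨ g x ω = 1)
    -- the localizing sets and the truncation regions
    (𝒮 : (Fin k → X) → PointConfig X → Closeds X)
    (h𝒮 : Measurable[_, fellMeasurableSpace X]
      (fun p : (Fin k → X) × PointConfig X => 𝒮 p.1 p.2))
    (h𝒮_symm : ∀ (σ : Equiv.Perm (Fin k)) x ω, 𝒮 (x ∘ σ) ω = 𝒮 x ω)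
    (hloc : IsLocalizedTo f g 𝒮)
    (S : (Fin k → X) → Closeds X)
    (hS : Measurable[_, fellMeasurableSpace X] S)
    (hS_symm : ∀ (σ : Equiv.Perm (Fin k)) x, S (x ∘ σ) = S x)
    (hxS : ∀ x i, x i ∈ S x)
    (h_stopping : ∀ (x : Fin k → X) (A : Closeds X),
      IsCompact (A : Set X) ∨ A = S x → StopsAt 𝒮 x A)
    -- the intensity measure of `ξ = ξ[η]`
    (L : Measure Y) (hL : IsIntensityMeasure P (fun w => inducedProcess f g (η w)) L)
    (hL_fin : L Set.univ < ∞)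
    -- the approximating Poisson process
    (M : Measure Y) [IsFiniteMeasure M]
    (ζ : Ω' → PointConfig Y) (hζ : IsPoissonProcess Q ζ M) :
    -- `ξ` and `ζ` are almost surely finite point processes
    (AEMeasurable (fun w => toFinPointConfig (inducedProcess f g (η w))) P ∧
      (∀ᵐ w ∂P, (toFinPointConfig (inducedProcess f g (η w))).1 = inducedProcess f g (η w)) ∧
      AEMeasurable (fun w => toFinPointConfig (ζ w).1) Q ∧
      (∀ᵐ w ∂Q, (toFinPointConfig (ζ w).1).1 = (ζ w).1)) ∧
    -- the bound through the variance of the truncated process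
    ((krDist P (fun w => toFinPointConfig (inducedProcess f g (η w)))
        Q (fun w => toFinPointConfig (ζ w).1) : ℝ≥0∞) : EReal) ≤
      (tvDist L M : EReal)
        + 2 * ((evariance
              (fun w => (inducedProcess f (truncated g 𝒮 S) (η w) Set.univ).toReal) P : EReal)
            - ((∫⁻ w, inducedProcess f (truncated g 𝒮 S) (η w) Set.univ ∂P : ℝ≥0∞) : EReal))
        + (errorE1 P η K g 𝒮 S : EReal)
        + 2 * (errorE2 P η K (truncated g 𝒮 S) S : EReal) ∧
    -- the two forms of the bound coincide
    (tvDist L M : EReal)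
        + 2 * ((evariance
              (fun w => (inducedProcess f (truncated g 𝒮 S) (η w) Set.univ).toReal) P : EReal)
            - ((∫⁻ w, inducedProcess f (truncated g 𝒮 S) (η w) Set.univ ∂P : ℝ≥0∞) : EReal))
        + (errorE1 P η K g 𝒮 S : EReal)
        + 2 * (errorE2 P η K (truncated g 𝒮 S) S : EReal) =
      ((tvDist L M + errorE1 P η K g 𝒮 S + errorE2 P η K (truncated g 𝒮 S) S
        + errorE3 P η K (truncated g 𝒮 S) S + errorE4 P η K (truncated g 𝒮 S) : ℝ≥0∞) : EReal) :=
  by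
  -- A version of `η` that is finite on the spanning sets everywhere, not only almost surely.
  have hD := measurableSet_spanningSets K
  have hKD := fun n => (measure_spanningSets_lt_top K n).ne
  have hηe := (hη.ae_truncOn_eq hD hKD).symm
  have hη₀ := hη.truncOn hD hKD
  have hlt := fun w n => PointConfig.truncOn_lt_top (spanningSets K) (η w) n
  set η₀ := fun w => PointConfig.truncOn (spanningSets K) (η w)
  have hξe : (fun w => inducedProcess f g (η w)) =ᵐ[P] fun w => inducedProcess f g (η₀ w) :=
    hηe.fun_comp (inducedProcess f g)
  have hgt := measurable_truncated hg h𝒮 hS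
  have he := measurable_escaped hg h𝒮 hS
  have hset : LocalSetting P η₀ K f (truncated g 𝒮 S) S :=
    { poisson := hη₀
      lt_top := hlt
      pos := hk
      measurable_f := hf
      f_symm := hf_symm
      measurable_g := hgt
      g_symm := truncated_symm hg_symm h𝒮_symm hS_symm
      zero_or_one := truncated_zero_or_one hg01
      measurable_S := hS
      S_symm := hS_symm
      mem := hxS
      isLocalizedTo := isLocalizedTo_truncated hloc fun x => h_stopping x (S x) (Or.inr rfl) }
  have hm := hη₀.measurable_induced hlt hf hg
  have hmt := hset.measurable_induced
  have hme := hη₀.measurable_induced hlt hf he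
  have hc := isCountingMeasure_inducedProcess hf_symm hg_symm hg01
  have hLt := isIntensityMeasure_bind (P := P) hmt
  have hLe := isIntensityMeasure_bind (P := P) hme
  set Lt := P.bind fun w => inducedProcess f (truncated g 𝒮 S) (η₀ w)
  set Le := P.bind fun w => inducedProcess f (escaped g 𝒮 S) (η₀ w)
  have hLadd : L = Lt + Le := by
    ext B hB
    rw [Measure.add_apply, hL B hB, hLt B hB, hLe B hB]
    refine Eq.trans ?_ (lintegral_add_left ((Measure.measurable_coe hB).comp hmt) _)
    refine lintegral_congr_ae (hξe.mono fun w hw => ?_)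
    simp only [hw, Function.comp]
    rw [← inducedProcess_truncated_add_escaped (𝒮 := 𝒮) (S := S), Measure.add_apply]
  have hLu : Lt Set.univ < ∞ ∧ Le Set.univ < ∞ := by
    rw [hLadd, Measure.add_apply] at hL_fin
    exact ENNReal.add_lt_top.1 hL_fin
  have : IsFiniteMeasure L := ⟨hL_fin⟩
  have : IsFiniteMeasure Lt := ⟨hLu.1⟩
  have : IsFiniteMeasure Le := ⟨hLu.2⟩
  have hξlt : ∀ᵐ w ∂P, inducedProcess f g (η w) Set.univ < ∞ := by
    have h1 := hL Set.univ MeasurableSet.univ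
    rw [lintegral_comp_congr hηe fun ω => inducedProcess f g ω Set.univ] at h1
    have h2 : ∀ᵐ w ∂P, inducedProcess f g (η₀ w) Set.univ < ∞ :=
      ae_lt_top ((Measure.measurable_coe MeasurableSet.univ).comp hm) (h1 ▸ hL_fin.ne)
    filter_upwards [h2, hξe] with w hw hw'
    rwa [hw']
  have hforms := ereal_two_forms
    (V := evariance (fun w => (inducedProcess f (truncated g 𝒮 S) (η₀ w) Set.univ).toReal) P)
    (measure_ne_top Lt Set.univ) (tvDist_ne_top L M)
    (e₁ := errorE1 P η₀ K g 𝒮 S) (e₂ := errorE2 P η₀ K (truncated g 𝒮 S) S)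
    (by rw [errorE1_eq hη₀ hlt hf he hLe]
        exact ENNReal.mul_ne_top (by simp) (measure_ne_top _ _))
    (ne_top_of_le_ne_top (ENNReal.mul_ne_top (by simp)
      (ENNReal.mul_ne_top (measure_ne_top _ _) (measure_ne_top _ _))) (hset.errorE2_le hLt))
    ((hset.two_mul_evariance_add hLt (measure_ne_top _ _)).trans (add_assoc _ _ _))
  rw [hLt Set.univ MeasurableSet.univ] at hforms
  have hvar : evariance
      (fun w => (inducedProcess f (truncated g 𝒮 S) (η w) Set.univ).toReal) P =
      evariance (fun w => (inducedProcess f (truncated g 𝒮 S) (η₀ w) Set.univ).toReal) P :=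
    evariance_congr (hηe.fun_comp fun ω => (inducedProcess f (truncated g 𝒮 S) ω Set.univ).toReal)
  have hkr := krDist_congr (P := P) (Q := Q) (hξe.fun_comp toFinPointConfig)
    fun w => toFinPointConfig (ζ w).1
  simp only [Function.comp_def] at hkr
  rw [hvar, hkr, lintegral_comp_congr hηe fun ω => inducedProcess f (truncated g 𝒮 S) ω Set.univ,
    errorE1_congr hηe, errorE2_congr hηe, errorE3_congr hηe, errorE4_congr hηe, hforms]
  refine ⟨⟨?_, ?_, ?_, ?_⟩, ?_, ?_⟩
  · exact (measurable_toFinPointConfig hm fun w => hc _).aemeasurable.congr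
      (hξe.fun_comp toFinPointConfig).symm
  · exact hξlt.mono fun w hw => toFinPointConfig_val (hc _) hw
  · exact (measurable_toFinPointConfig hζ.measurable.subtype_val fun w => (ζ w).2.2).aemeasurable
  · exact (hζ.ae_lt_top MeasurableSet.univ (measure_ne_top _ _)).mono fun w hw =>
      toFinPointConfig_val (ζ w).2.2 hw
  · rw [EReal.coe_ennreal_le_coe_ennreal_iff, hLadd]
    refine (hset.krDist_le hg hg_symm hg01 he hLt hLe hζ).trans (le_of_eq ?_)
    ring
  · congr 1
    ring
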